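/- Let $p=3$. Homomorphisms of pro-$3$-groups are continuous and subgroups are closed. For a pro-$3$-group $G$ let $D_i(G)$ denote the Zassenhaus filtration, given by $D_1(G)=G$ and, for $i\ge2$, by letting $D_i(G)$ be the closed subgroup generated by the cubes of the elements of $D_{\lceil i/3\rceil}(G)$ and by all $[D_j(G),D_k(G)]$ with $j,k\ge1$ and $j+k=i$. Let $\operatorname{gr}_i^D(G)=D_i(G)/D_{i+1}(G)$, an $\mathbb F_3$-vector space, and $d(G)=\dim_{\mathbb F_3}\operatorname{gr}_1^D(G)$. A weak Schur $\sigma$-group is a pro-$3$-group $G$ with an action of a group $\{1,\sigma\}$ of order $2$ such that $\dim_{\mathbb F_3} H^2(G,\mathbb F_3)\le\dim_{\mathbb F_3} H^1(G,\mathbb F_3)<\infty$ and $\sigma$ acts by $-1$ on both (continuous cohomology) spaces. Let $F_2$ be the free pro-$3$-group on two generators; then $\dim_{\mathbb{F}_3}\operatorname{gr}_3^D(F_2)=4$. A weak Schur $\sigma$-group $G$ with $d(G)=2$ has Zassenhaus type $(3,3)$ if it is isomorphic to the quotient of $F_2$ by the closed normal subgroup generated by two relations in $D_3(F_2)$ whose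 classes generate a subspace of dimension $2$ of $\operatorname{gr}_3^D(F_2)$. For any finite $3$-group $H$ the following are equivalent: (a) $H$ is isomorphic to $G/D_4(G)$ for a weak Schur $\sigma$-group $G$ with $d(G)=2$. (b) $\dim\operatorname{gr}_1^D(H)=2$, $\dim\operatorname{gr}_2^D(H)=1$, $\dim\operatorname{gr}_3^D(H)\ge2$ and $D_4(H)=1$. Moreover, for any such $G$ and $H$ we have: (c) $G$ has Zassenhaus type $(3,3)$ if and only if $\dim\operatorname{gr}_3^D(H)=2$. (d) There is an automorphism $\sigma$ of $H$ with $\sigma^2=1$ for which $H$ is generated by odd elements, that is, by elements $a$ with $\sigma(a)=a^{-1}$; and any group isomorphic to $H$, with any such automorphism, is isomorphic to $(H,\sigma)$ by an isomorphism that commutes with the automorphisms. (e) For any $\sigma$ as in (d), the subgroup $\operatorname{Aut}_\sigma(H)$ of automorphisms of $H$ that commute with $\sigma$ has index $3^2$ in $\operatorname{Aut}(H)$. Finally, as $G$ runs through all weak Schur $\sigma$-groups with $d(G)=2$, there are exactly $19$ isomorphism classes of groups $G/D_4(G)$, and exactly $13$ of them arise from groups $G$ of Zassenhaus type $(3,3)$.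 -/

import Mathlib

universe u v

namespace SchurSigma

/-! ### The Zassenhaus filtration -/

section Zassenhaus

theorem ceilDiv_lt {p i : ℕ} (hp : 2 ≤ p) (hi : 1 < i) : i ⌈/⌉ p < i := by
  rw [Nat.ceilDiv_eq_add_pred_div, Nat.div_lt_iff_lt_mul (by omega)]
  nlinarith [Nat.sub_add_cancel (show 1 ≤ i + p by omega)]

/-- The dimension subgroups `D_i(G)`, as closed subgroups of a topological group `G`:
`D_1(G) = G`, and for `i ≥ 2` the subgroup `D_i(G)` is topologically generated by the `p`-th powers
of the elements of `D_{⌈i/p⌉}(G)` and by all `[D_j(G), D_k(G)]` with `j, k ≥ 1`, `j + k = i`.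
(The irrelevant value at `i = 0` is `G`.) -/
def zassenhaus (p : ℕ) [hp : Fact p.Prime]
    (G : Type u) [Group G] [TopologicalSpace G] [IsTopologicalGroup G] (i : ℕ) : Subgroup G :=
  if _hi : i ≤ 1 then ⊤ else
    (Subgroup.closure ((fun a : G => a ^ p) '' (zassenhaus p G (i ⌈/⌉ p) : Set G)) ⊔
      ⨆ (j : ℕ) (k : ℕ) (_ : 0 < j ∧ 0 < k ∧ j + k = i),
        ⁅zassenhaus p G j, zassenhaus p G k⁆).topologicalClosure
termination_by i
decreasing_by
  · exact ceilDiv_lt hp.out.two_le (by omega)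
  · omega
  · omega

variable (p : ℕ) [hp : Fact p.Prime]
variable (G : Type u) [Group G] [TopologicalSpace G] [IsTopologicalGroup G]

theorem zassenhaus_of_le_one {i : ℕ} (hi : i ≤ 1) : zassenhaus p G i = ⊤ := by
  rw [zassenhaus, dif_pos hi]

theorem zassenhaus_of_one_lt {i : ℕ} (hi : 1 < i) : zassenhaus p G i =
    (Subgroup.closure ((fun a : G => a ^ p) '' (zassenhaus p G (i ⌈/⌉ p) : Set G)) ⊔
      ⨆ (j : ℕ) (k : ℕ) (_ : 0 < j ∧ 0 < k ∧ j + k = i),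
        ⁅zassenhaus p G j, zassenhaus p G k⁆).topologicalClosure := by
  rw [zassenhaus, dif_neg (by omega)]

theorem pow_mem_zassenhaus {i : ℕ} (hi : 1 < i) {a : G} (ha : a ∈ zassenhaus p G (i ⌈/⌉ p)) :
    a ^ p ∈ zassenhaus p G i := by
  rw [zassenhaus_of_one_lt p G hi]
  exact Subgroup.le_topologicalClosure _
    (Subgroup.mem_sup_left (Subgroup.subset_closure ⟨a, ha, rfl⟩))

theorem commutator_le_zassenhaus {i j k : ℕ} (hj : 0 < j) (hk : 0 < k) (h : j + k = i) :
    ⁅zassenhaus p G j, zassenhaus p G k⁆ ≤ zassenhaus p G i := by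
  rw [zassenhaus_of_one_lt p G (i := i) (by omega)]
  refine le_trans (le_trans ?_ le_sup_right) (Subgroup.le_topologicalClosure _)
  exact le_iSup_of_le j (le_iSup_of_le k (le_iSup_of_le ⟨hj, hk, h⟩ le_rfl))

instance zassenhaus_normal (i : ℕ) : (zassenhaus p G i).Normal := by
  induction i using Nat.strong_induction_on with
  | _ i ih =>
    by_cases hi : i ≤ 1
    · rw [zassenhaus_of_le_one p G hi]; infer_instance
    · push Not at hi
      rw [zassenhaus_of_one_lt p G hi]
      have h1 : (Subgroup.closure
          ((fun a : G => a ^ p) '' (zassenhaus p G (i ⌈/⌉ p) : Set G))).Normal := by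
        have hn := ih _ (ceilDiv_lt hp.out.two_le hi)
        refine ⟨fun x hx g => ?_⟩
        suffices h : Subgroup.closure
            ((fun a : G => a ^ p) '' (zassenhaus p G (i ⌈/⌉ p) : Set G)) ≤
            (Subgroup.closure ((fun a : G => a ^ p) ''
              (zassenhaus p G (i ⌈/⌉ p) : Set G))).comap (MulAut.conj g).toMonoidHom from h hx
        rw [Subgroup.closure_le]
        rintro _ ⟨a, ha, rfl⟩
        exact Subgroup.subset_closure ⟨g * a * g⁻¹, hn.conj_mem a ha g, conj_pow⟩
      have h2 : (⨆ (j : ℕ) (k : ℕ) (_ : 0 < j ∧ 0 < k ∧ j + k = i),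
          ⁅zassenhaus p G j, zassenhaus p G k⁆).Normal := by
        refine @Subgroup.iSup_normal G _ ℕ _ fun j => @Subgroup.iSup_normal G _ ℕ _ fun k =>
          @Subgroup.iSup_normal G _ _ _ fun h => ?_
        have := ih j (by omega)
        have := ih k (by omega)
        exact Subgroup.commutator_normal _ _
      exact Subgroup.is_normal_topologicalClosure _

theorem zassenhaus_succ_le (i : ℕ) : zassenhaus p G (i + 1) ≤ zassenhaus p G i := by
  induction i using Nat.strong_induction_on with
  | _ i ih =>
    by_cases hi : i ≤ 1
    · rw [zassenhaus_of_le_one p G hi]; exact le_top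
    · push Not at hi
      have hmono : zassenhaus p G ((i + 1) ⌈/⌉ p) ≤ zassenhaus p G (i ⌈/⌉ p) := by
        have hlt := ceilDiv_lt hp.out.two_le hi
        have h0 : i ⌈/⌉ p ≤ (i + 1) ⌈/⌉ p := by
          simp only [Nat.ceilDiv_eq_add_pred_div]
          exact Nat.div_le_div_right (by omega)
        have h1 : (i + 1) ⌈/⌉ p ≤ i ⌈/⌉ p + 1 := by
          have h2 := hp.out.two_le
          simp only [Nat.ceilDiv_eq_add_pred_div]
          rw [← Nat.add_div_right _ (by omega)]
          exact Nat.div_le_div_right (by omega)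
        rcases Nat.lt_or_ge (i ⌈/⌉ p) ((i + 1) ⌈/⌉ p) with h | h
        · rw [show (i + 1) ⌈/⌉ p = i ⌈/⌉ p + 1 by omega]
          exact ih _ hlt
        · rw [show (i + 1) ⌈/⌉ p = i ⌈/⌉ p by omega]
      conv_lhs => rw [zassenhaus_of_one_lt p G (i := i + 1) (by omega)]
      have hclosed : IsClosed (zassenhaus p G i : Set G) := by
        rw [zassenhaus_of_one_lt p G hi]; exact Subgroup.isClosed_topologicalClosure _
      refine Subgroup.topologicalClosure_minimal _ (sup_le ?_ ?_) hclosed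
      · rw [Subgroup.closure_le]
        rintro _ ⟨a, ha, rfl⟩
        exact pow_mem_zassenhaus p G hi (hmono ha)
      · refine iSup_le fun j => iSup_le fun k => iSup_le fun h => ?_
        by_cases hj : 1 < j
        · refine le_trans (Subgroup.commutator_mono (?_ : _ ≤ zassenhaus p G (j - 1)) le_rfl)
            (commutator_le_zassenhaus p G (by omega) h.2.1 (by omega))
          have := ih (j - 1) (by omega)
          rwa [show j - 1 + 1 = j by omega] at this
        · refine le_trans (Subgroup.commutator_mono le_rfl (?_ : _ ≤ zassenhaus p G (k - 1)))
            (commutator_le_zassenhaus p G h.1 (by omega) (by omega))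
          have := ih (k - 1) (by omega)
          rwa [show k - 1 + 1 = k by omega] at this

theorem zassenhaus_antitone : Antitone (zassenhaus p G) :=
  antitone_nat_of_succ_le (zassenhaus_succ_le p G)

/-- The subquotient `gr_i^D(G) = D_i(G) / D_{i+1}(G)`, written additively. -/
def Gr (i : ℕ) : Type u :=
  Additive (zassenhaus p G i ⧸ (zassenhaus p G (i + 1)).subgroupOf (zassenhaus p G i))

instance (i : ℕ) : AddGroup (Gr p G i) :=
  have : ((zassenhaus p G (i + 1)).subgroupOf (zassenhaus p G i)).Normal :=
    (zassenhaus_normal p G (i + 1)).subgroupOf _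
  inferInstanceAs (AddGroup
    (Additive (zassenhaus p G i ⧸ (zassenhaus p G (i + 1)).subgroupOf (zassenhaus p G i))))

/-- The class in `gr_i^D(G)` of an element of `D_i(G)`. -/
def Gr.mk {i : ℕ} (a : G) (ha : a ∈ zassenhaus p G i) : Gr p G i :=
  Additive.ofMul (QuotientGroup.mk ⟨a, ha⟩)

instance (i : ℕ) : AddCommGroup (Gr p G i) where
  add_comm := by
    intro x y
    induction x using Additive.rec with | _ x
    induction y using Additive.rec with | _ y
    induction x using QuotientGroup.induction_on with | _ a
    induction y using QuotientGroup.induction_on with | _ b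
    refine congrArg Additive.ofMul (QuotientGroup.eq.mpr ?_)
    rw [Subgroup.mem_subgroupOf]
    rcases Nat.eq_zero_or_pos i with rfl | hi
    · rw [zassenhaus_of_le_one p G (by omega)]; trivial
    · have h := commutator_le_zassenhaus p G hi Nat.one_pos rfl
        (Subgroup.commutator_mem_commutator
          ((zassenhaus p G i).inv_mem b.2) (zassenhaus_of_le_one p G le_rfl ▸
            Subgroup.mem_top (a : G)⁻¹ : (a : G)⁻¹ ∈ zassenhaus p G 1))
      simpa [commutatorElement_def, mul_assoc] using h

/-- `gr_i^D(G)` is annihilated by `p`, and hence is an `𝔽_p`-vector space. -/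
instance (i : ℕ) : Module (ZMod p) (Gr p G i) :=
  AddCommGroup.zmodModule (by
    intro x
    induction x using Additive.rec with | _ x
    induction x using QuotientGroup.induction_on with | _ a
    refine congrArg Additive.ofMul ((QuotientGroup.eq_one_iff (a ^ p)).mpr ?_)
    rw [Subgroup.mem_subgroupOf]
    rcases Nat.eq_zero_or_pos i with rfl | hi
    · rw [zassenhaus_of_le_one p G (by omega)]; trivial
    · refine pow_mem_zassenhaus p G (by omega) (zassenhaus_antitone p G ?_ a.2)
      have := ceilDiv_lt hp.out.two_le (show 1 < i + 1 by omega)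
      omega)

/-- `dim gr_i^D(G)` over `𝔽_p`. -/
noncomputable def grDim (i : ℕ) : ℕ := Module.finrank (ZMod p) (Gr p G i)

end Zassenhaus

/-! ### Pro-`p`-groups and free pro-`p`-groups -/

/-- Pro-`p`-groups: profinite groups all of whose quotients by open normal subgroups are
`p`-groups. -/
structure IsProP (p : ℕ) (G : Type u) [Group G] [TopologicalSpace G] : Prop where
  isTopologicalGroup : IsTopologicalGroup G
  compact : CompactSpace G
  totallyDisconnected : TotallyDisconnectedSpace G
  isPGroup_quotient : ∀ U : OpenNormalSubgroup G, IsPGroup p (G ⧸ U.toSubgroup)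

section FreeProP

variable (p n : ℕ)

/-- The normal subgroups of `p`-power index in the abstract free group on `n` generators. -/
def PIndexSubgroup : Type :=
  {N : Subgroup (FreeGroup (Fin n)) // N.Normal ∧ ∃ k : ℕ, N.index = p ^ k}

instance (N : PIndexSubgroup p n) : N.1.Normal := N.2.1

/-- The finite `p`-group `FreeGroup (Fin n) ⧸ N`, as a discrete group. -/
def FreeQuot (N : PIndexSubgroup p n) : Type := FreeGroup (Fin n) ⧸ N.1

instance (N : PIndexSubgroup p n) : Group (FreeQuot p n N) :=
  inferInstanceAs (Group (FreeGroup (Fin n) ⧸ N.1))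

instance (N : PIndexSubgroup p n) : TopologicalSpace (FreeQuot p n N) := ⊥

instance (N : PIndexSubgroup p n) : DiscreteTopology (FreeQuot p n N) := ⟨rfl⟩

/-- The projection `FreeGroup (Fin n) ⧸ M → FreeGroup (Fin n) ⧸ N` for `M ≤ N`. -/
def FreeQuot.proj {M N : PIndexSubgroup p n} (h : M.1 ≤ N.1) :
    FreeQuot p n M →* FreeQuot p n N :=
  QuotientGroup.map M.1 N.1 (MonoidHom.id _) h

/-- The free pro-`p`-group on `n` generators: the inverse limit of the quotients of the abstract
free group on `n` generators by its normal subgroups of `p`-power index, as a subgroup of the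
product of these discrete groups. -/
def freeProPSubgroup : Subgroup (∀ N : PIndexSubgroup p n, FreeQuot p n N) where
  carrier := {f | ∀ (M N : PIndexSubgroup p n) (h : M.1 ≤ N.1), FreeQuot.proj p n h (f M) = f N}
  one_mem' := fun _ _ h => map_one (FreeQuot.proj p n h)
  mul_mem' := fun hf hg M N h => by simp [hf M N h, hg M N h]
  inv_mem' := fun hf M N h => by simp [hf M N h]

/-- The free pro-`p`-group `F_n`, with the topology induced from the product topology. -/
abbrev FreeProP : Type := freeProPSubgroup p n

end FreeProP

/-! ### Continuous cohomology with coefficients in `𝔽_p` -/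

section Cohomology

variable (p : ℕ) [hp : Fact p.Prime] (G : Type u) [Group G] [TopologicalSpace G]

/-- Continuous (that is, locally constant) `1`-cocycles with values in the trivial module `𝔽_p`. -/
def Z1 : Submodule (ZMod p) (G → ZMod p) where
  carrier := {f | Continuous f ∧ ∀ g h, f (g * h) = f g + f h}
  zero_mem' := ⟨continuous_const, by simp⟩
  add_mem' := fun ha hb => ⟨ha.1.add hb.1, fun g h => by
    simp only [Pi.add_apply, ha.2, hb.2]; ring⟩
  smul_mem' := fun c f hf => ⟨hf.1.const_smul c, fun g h => by
    simp only [Pi.smul_apply, hf.2, smul_add]⟩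

/-- `H^1(G, 𝔽_p)`; the `1`-coboundaries vanish because the action on `𝔽_p` is trivial. -/
abbrev H1 : Type u := Z1 p G

/-- Continuous `2`-cocycles with values in the trivial module `𝔽_p`. -/
def Z2 : Submodule (ZMod p) (G × G → ZMod p) where
  carrier := {f | Continuous f ∧
    ∀ g h k, f (h, k) - f (g * h, k) + f (g, h * k) - f (g, h) = 0}
  zero_mem' := ⟨continuous_const, by simp⟩
  add_mem' := fun {a b} ha hb => ⟨ha.1.add hb.1, fun g h k => by
    simp only [Pi.add_apply]; linear_combination ha.2 g h k + hb.2 g h k⟩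
  smul_mem' := fun c f hf => ⟨hf.1.const_smul c, fun g h k => by
    simp only [Pi.smul_apply, smul_eq_mul]; linear_combination c * hf.2 g h k⟩

/-- The `2`-coboundaries of continuous `1`-cochains. -/
def B2 : Submodule (ZMod p) (G × G → ZMod p) where
  carrier := {f | ∃ c : G → ZMod p, Continuous c ∧
    ∀ g h, f (g, h) = c h - c (g * h) + c g}
  zero_mem' := ⟨0, continuous_const, by simp⟩
  add_mem' := by
    rintro a b ⟨c, hc, h⟩ ⟨c', hc', h'⟩
    refine ⟨c + c', hc.add hc', fun x y => ?_⟩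
    simp only [Pi.add_apply, h, h']; ring
  smul_mem' := by
    rintro r a ⟨c, hc, h⟩
    refine ⟨r • c, hc.const_smul r, fun x y => ?_⟩
    simp only [Pi.smul_apply, smul_eq_mul, h]; ring

/-- `H^2(G, 𝔽_p)`: continuous `2`-cocycles modulo coboundaries (every coboundary of a continuous
`1`-cochain is a continuous cocycle when `G` is a topological group). -/
abbrev H2 : Type u := Z2 p G ⧸ (B2 p G).comap (Z2 p G).subtype

variable {G}

/-- The action of a continuous automorphism on `H^1(G, 𝔽_p)`. -/
def H1.map (σ : G ≃ₜ* G) : H1 p G →ₗ[ZMod p] H1 p G :=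
  (LinearMap.funLeft (ZMod p) (ZMod p) σ).restrict fun f hf =>
    ⟨hf.1.comp σ.continuous, fun g h => by
      simp only [LinearMap.funLeft_apply, map_mul, hf.2]⟩

/-- The action of a continuous automorphism on continuous `2`-cocycles. -/
def Z2.map (σ : G ≃ₜ* G) : Z2 p G →ₗ[ZMod p] Z2 p G :=
  (LinearMap.funLeft (ZMod p) (ZMod p) (Prod.map σ σ)).restrict fun f hf =>
    ⟨hf.1.comp (σ.continuous.prodMap σ.continuous), fun g h k => by
      simpa only [LinearMap.funLeft_apply, Prod.map_apply, map_mul] using hf.2 (σ g) (σ h) (σ k)⟩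

/-- The action of a continuous automorphism on `H^2(G, 𝔽_p)`. -/
def H2.map (σ : G ≃ₜ* G) : H2 p G →ₗ[ZMod p] H2 p G :=
  Submodule.mapQ _ _ (Z2.map p σ) (by
    rintro f ⟨c, hc, h⟩
    exact ⟨c ∘ σ, hc.comp σ.continuous, fun x y =>
      (h (σ x) (σ y)).trans (by simp only [Function.comp_apply, map_mul])⟩)

end Cohomology

/-! ### Weak Schur `σ`-groups -/

/-- A weak Schur `σ`-group: a pro-`p`-group `G` with an action of `{1, σ}` such that
`dim H^2(G, 𝔽_p) ≤ dim H^1(G, 𝔽_p) < ∞` and `σ` acts by `-1` on both spaces. -/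
structure WeakSchurGroup (p : ℕ) [Fact p.Prime] where
  /-- the underlying type -/
  carrier : Type u
  [group : Group carrier]
  [topologicalSpace : TopologicalSpace carrier]
  [isTopologicalGroup : IsTopologicalGroup carrier]
  isProP : IsProP p carrier
  /-- the action of `σ` -/
  σ : carrier ≃ₜ* carrier
  σ_σ : ∀ g, σ (σ g) = g
  rank_H2_le : Module.rank (ZMod p) (H2 p carrier) ≤ Module.rank (ZMod p) (H1 p carrier)
  rank_H1_lt : Module.rank (ZMod p) (H1 p carrier) < Cardinal.aleph0
  σ_H1 : ∀ x : H1 p carrier, H1.map p σ x = -x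
  σ_H2 : ∀ x : H2 p carrier, H2.map p σ x = -x

attribute [instance] WeakSchurGroup.group WeakSchurGroup.topologicalSpace
  WeakSchurGroup.isTopologicalGroup

/-- `H ≅ G / D_4(G)` as topological groups. -/
def IsD4Quotient {p : ℕ} [Fact p.Prime] (G : WeakSchurGroup.{v} p)
    (H : Type u) [Group H] [TopologicalSpace H] : Prop :=
  Nonempty (H ≃ₜ* G.carrier ⧸ zassenhaus p G.carrier 4)

/-- A pro-`p`-group has Zassenhaus type `(3,3)` if it is the quotient of the free pro-`p`-group
`F_2` by the closed normal subgroup generated by two relations in `D_3(F_2)` whose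
classes generate a subspace of dimension `2` of `gr_3^D(F_2)`. -/
def HasZassenhausType33 (p : ℕ) [Fact p.Prime]
    (G : Type u) [Group G] [TopologicalSpace G] : Prop :=
  ∃ (φ : FreeProP p 2 →ₜ* G) (r : Fin 2 → FreeProP p 2)
    (hr : ∀ i, r i ∈ zassenhaus p (FreeProP p 2) 3),
    Function.Surjective φ ∧
    φ.toMonoidHom.ker = (Subgroup.normalClosure (Set.range r)).topologicalClosure ∧
    Module.finrank (ZMod p)
      (Submodule.span (ZMod p) (Set.range fun i => Gr.mk p (FreeProP p 2) (r i) (hr i))) = 2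

/-! ### `σ`-structures on finite groups -/

/-- `σ` is an action of a group `{1, σ}` of order `2` on `H`, for which `H` is generated by odd
elements, that is, by elements `a` with `σ a = a⁻¹`. -/
def IsOddlyGenerated {H : Type u} [Group H] (σ : MulAut H) : Prop :=
  (∀ a, σ (σ a) = a) ∧ Subgroup.closure {a : H | σ a = a⁻¹} = ⊤

/-- The group `Aut_σ(H)` of automorphisms of `H` that commute with `σ`. -/
def sigmaAut {H : Type u} [Group H] (σ : MulAut H) : Subgroup (MulAut H) where
  carrier := {φ | ∀ a, φ (σ a) = σ (φ a)}
  one_mem' := fun _ => rfl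
  mul_mem' := fun {φ ψ} hφ hψ a => by simp only [MulAut.mul_apply]; rw [hψ a, hφ]
  inv_mem' := fun {φ} hφ a => by
    apply φ.injective
    rw [hφ]
    simp

end SchurSigma

set_option linter.unusedSectionVars false

namespace SchurSigma

open scoped commutatorElement

/-! ### Functoriality of the Zassenhaus filtration, and graded dimensions as indices -/

section General

variable {p : ℕ} [hp : Fact p.Prime]
variable {G : Type u} [Group G] [TopologicalSpace G] [IsTopologicalGroup G]
variable {G' : Type v} [Group G'] [TopologicalSpace G'] [IsTopologicalGroup G']

/-! Let F = `FreeProP 3 2` with free generators x, y, and let `flip` invert both. The Magnus map x ↦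
1 + X, y ↦ 1 + Y, truncated after degree three, makes F/D_4(F) explicit: gr_1(F) is V = 𝔽_3²,
gr_2(F) is the line Λ²V spanned by [x,y], and gr_3(F) is the space of symmetric tensors in V⊗V⊗V, of
dimension four, with coordinates `cub`. Hence `flip` acts on gr_1, gr_2, gr_3 by -1, 1, -1.

A weak Schur σ-group G with d(G) = 2 has odd generators, so there is a surjection φ : F → G that
carries `flip` to σ and has kernel N in D_2(F). Since H² of F vanishes (`FreeProP.exists_cochain`),
H²(G) is computed by transgression from invariant homomorphisms N → 𝔽_3. As σ is -1 on H²(G) but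
`flip` is 1 on gr_2(F), N lies in D_3(F) (`ker_le_zassenhaus_three`). As dim H²(G) ≤ 2, the image W
of N in gr_3(F) has dimension at most 2, and if it is 2, two relators lifting a basis of W already
generate N (`hasZassenhausType33_of_finrank`). So G/D_4(G) is F modulo the preimage of W in D_3(F),
and its gr_3 has dimension 4 - dim W. Conversely, a basis of any W of dimension at most 2 lifts to
odd relators, which define a weak Schur σ-group (`exists_weakSchurGroup`). This gives (a), (b) and
(c).

Two such quotients of F are isomorphic exactly when an element of GL_2(𝔽_3) maps one W to the other
(`exists_matrix_of_mulEquiv`, `exists_mulEquiv_of_endo`). Each matrix lifts to an endomorphism of F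
commuting with `flip`, so the isomorphism can be made equivariant, which gives (d). For (e), cosets
of Aut_σ(H) correspond to conjugates τ of σ, and τ is determined by the classes of τ(x)x and τ(y)y
in gr_2 = 𝔽_3, which can be arbitrary (`index_sigmaAut`).

It remains to count the orbits of GL_2(𝔽_3) on subspaces of dimension at most 2 of 𝔽_3⁴. A finite
computation, with vectors coded by ternary digits and subspaces by bit masks, finds 1 + 5 + 13 of
them (`subspace_check`, `reps_check`). -/

theorem isClosed_zassenhaus (p : ℕ) [Fact p.Prime] (G : Type u) [Group G] [TopologicalSpace G]
    [IsTopologicalGroup G] (i : ℕ) : IsClosed (zassenhaus p G i : Set G) := by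
  by_cases hi : i ≤ 1
  · rw [zassenhaus_of_le_one p G hi]; exact isClosed_univ
  · rw [zassenhaus_of_one_lt p G (by omega)]; exact Subgroup.isClosed_topologicalClosure _

theorem mem_zassenhaus_one (a : G) : a ∈ zassenhaus p G 1 := by
  rw [zassenhaus_of_le_one p G le_rfl]; trivial

/-- `D_i(G)` is the smallest closed subgroup containing its generators. -/
theorem zassenhaus_le {i : ℕ} (hi : 1 < i) {S : Subgroup G} (hS : IsClosed (S : Set G))
    (hpow : ∀ a ∈ zassenhaus p G (i ⌈/⌉ p), a ^ p ∈ S)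
    (hcomm : ∀ j k, 0 < j → 0 < k → j + k = i → ∀ a ∈ zassenhaus p G j,
      ∀ b ∈ zassenhaus p G k, ⁅a, b⁆ ∈ S) : zassenhaus p G i ≤ S := by
  rw [zassenhaus_of_one_lt p G hi]
  refine Subgroup.topologicalClosure_minimal _ (sup_le ?_ ?_) hS
  · rw [Subgroup.closure_le]
    rintro _ ⟨a, ha, rfl⟩
    exact hpow a ha
  · refine iSup_le fun j => iSup_le fun k => iSup_le fun h => ?_
    rw [Subgroup.commutator_le]
    exact fun a ha b hb => hcomm j k h.1 h.2.1 h.2.2 a ha b hb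

theorem commutator_mem_zassenhaus {j k : ℕ} (hj : 0 < j) (hk : 0 < k) {a b : G}
    (ha : a ∈ zassenhaus p G j) (hb : b ∈ zassenhaus p G k) : ⁅a, b⁆ ∈ zassenhaus p G (j + k) :=
  commutator_le_zassenhaus p G hj hk rfl (Subgroup.commutator_mem_commutator ha hb)

theorem map_mem_zassenhaus (φ : G →ₜ* G') {i : ℕ} {a : G} (ha : a ∈ zassenhaus p G i) :
    φ a ∈ zassenhaus p G' i := by
  induction i using Nat.strong_induction_on generalizing a with
  | _ i ih =>
    by_cases hi : i ≤ 1
    · rw [zassenhaus_of_le_one p G' hi]; trivial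
    · push Not at hi
      suffices h : zassenhaus p G i ≤ (zassenhaus p G' i).comap φ.toMonoidHom from h ha
      refine zassenhaus_le hi ((isClosed_zassenhaus p G' i).preimage φ.continuous_toFun) ?_ ?_
      · intro b hb
        rw [Subgroup.mem_comap, map_pow]
        exact pow_mem_zassenhaus p G' hi (ih _ (ceilDiv_lt hp.out.two_le hi) hb)
      · rintro j k hj hk rfl b hb c hc
        rw [Subgroup.mem_comap, map_commutatorElement]
        exact commutator_mem_zassenhaus hj hk (ih j (by omega) hb) (ih k (by omega) hc)

/-- A closed map sends `D_i(G)` to a closed subgroup, so the minimality `zassenhaus_le` applies to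
the image once the generators have been lifted by induction. -/
theorem exists_mem_zassenhaus_map_eq (φ : G →ₜ* G') (hφ : Function.Surjective φ)
    (hc : IsClosedMap φ) {i : ℕ} {b : G'} (hb : b ∈ zassenhaus p G' i) :
    ∃ a ∈ zassenhaus p G i, φ a = b := by
  induction i using Nat.strong_induction_on generalizing b with
  | _ i ih =>
    by_cases hi : i ≤ 1
    · obtain ⟨a, rfl⟩ := hφ b
      exact ⟨a, by rw [zassenhaus_of_le_one p G hi]; trivial, rfl⟩
    · push Not at hi
      suffices h : zassenhaus p G' i ≤ (zassenhaus p G i).map φ.toMonoidHom from h hb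
      refine zassenhaus_le hi (hc _ (isClosed_zassenhaus p G i)) ?_ ?_
      · intro b hb
        obtain ⟨a, ha, rfl⟩ := ih _ (ceilDiv_lt hp.out.two_le hi) hb
        exact ⟨a ^ p, pow_mem_zassenhaus p G hi ha, map_pow φ a p⟩
      · rintro j k hj hk rfl b hb c hc
        obtain ⟨a, ha, rfl⟩ := ih j (by omega) hb
        obtain ⟨d, hd, rfl⟩ := ih k (by omega) hc
        exact ⟨⁅a, d⁆, commutator_mem_zassenhaus hj hk ha hd,
          map_commutatorElement φ.toMonoidHom a d⟩

theorem map_zassenhaus (φ : G →ₜ* G') (hφ : Function.Surjective φ)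
    (hc : IsClosedMap φ) (i : ℕ) :
    (zassenhaus p G i).map φ.toMonoidHom = zassenhaus p G' i := by
  ext b
  constructor
  · rintro ⟨a, ha, rfl⟩
    exact map_mem_zassenhaus φ ha
  · intro hb
    obtain ⟨a, ha, rfl⟩ := exists_mem_zassenhaus_map_eq φ hφ hc hb
    exact ⟨a, ha, rfl⟩

theorem natCard_gr (i : ℕ) :
    Nat.card (Gr p G i) = (zassenhaus p G (i + 1)).relIndex (zassenhaus p G i) := rfl

theorem grDim_eq_of_relIndex {i n : ℕ}
    (h : (zassenhaus p G (i + 1)).relIndex (zassenhaus p G i) = p ^ n) : grDim p G i = n := by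
  have hfin : Finite (Gr p G i) := by
    refine Nat.finite_of_card_ne_zero ?_
    rw [natCard_gr, h]
    exact pow_ne_zero _ hp.out.ne_zero
  have h1 := Module.natCard_eq_pow_finrank (K := ZMod p) (V := Gr p G i)
  rw [natCard_gr, h, Nat.card_zmod] at h1
  exact (Nat.pow_right_injective hp.out.two_le h1).symm

/-- For `n = 0` this could fail, because `finrank` takes the value 0 on spaces of infinite
dimension. -/
theorem relIndex_of_grDim {i n : ℕ} (hn : n ≠ 0) (h : grDim p G i = n) :
    (zassenhaus p G (i + 1)).relIndex (zassenhaus p G i) = p ^ n := by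
  have hfin : Module.Finite (ZMod p) (Gr p G i) :=
    Module.finite_of_finrank_pos (by rw [← grDim, h]; omega)
  have h1 := Module.natCard_eq_pow_finrank (K := ZMod p) (V := Gr p G i)
  rwa [natCard_gr, Nat.card_zmod, ← grDim, h] at h1

theorem relIndex_comap_zassenhaus (φ : G →ₜ* G') (hφ : Function.Surjective φ)
    (hc : IsClosedMap φ) (i j : ℕ) :
    ((zassenhaus p G' i).comap φ.toMonoidHom).relIndex (zassenhaus p G j) =
      (zassenhaus p G' i).relIndex (zassenhaus p G' j) := by
  rw [Subgroup.relIndex_comap, map_zassenhaus φ hφ hc]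

end General

/-! ### Factoring homomorphisms through topological quotients -/

section Quotients

/-- A continuous surjection onto a compact Hausdorff group induces a map out of it. -/
theorem exists_factor {F : Type*} [Group F] [TopologicalSpace F]
    {G : Type u} [Group G] [TopologicalSpace G] {G' : Type v} [Group G'] [TopologicalSpace G']
    (φ : F →ₜ* G) (hφ : Topology.IsQuotientMap φ) (ψ : F →ₜ* G')
    (h : ∀ a, φ a = 1 → ψ a = 1) : ∃ e : G →ₜ* G', ∀ a, e (φ a) = ψ a := by
  have hs := hφ.surjective
  have key : ∀ a b, φ a = φ b → ψ a = ψ b := by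
    intro a b hab
    have := h (a * b⁻¹) (by rw [map_mul, map_inv, hab, mul_inv_cancel])
    rwa [map_mul, map_inv, mul_inv_eq_one] at this
  have hval : ∀ a, ψ (Function.surjInv hs (φ a)) = ψ a :=
    fun a => key _ _ (Function.surjInv_eq hs _)
  refine ⟨⟨⟨⟨fun g => ψ (Function.surjInv hs g), ?_⟩, ?_⟩, ?_⟩, hval⟩
  · simpa using hval 1
  · intro g g'
    obtain ⟨a, rfl⟩ := hs g
    obtain ⟨b, rfl⟩ := hs g'
    change ψ _ = ψ _ * ψ _
    rw [← map_mul, hval, hval, hval, map_mul]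
  · refine hφ.continuous_iff.mpr ?_
    convert ψ.continuous_toFun using 1
    exact funext hval

/-- Two continuous surjections with the same kernel have isomorphic images. -/
theorem exists_equiv_of_ker_eq {F : Type*} [Group F] [TopologicalSpace F]
    {G : Type u} [Group G] [TopologicalSpace G] {G' : Type v} [Group G'] [TopologicalSpace G']
    (φ : F →ₜ* G) (hφ : Topology.IsQuotientMap φ) (ψ : F →ₜ* G') (hψ : Topology.IsQuotientMap ψ)
    (h : ∀ a, φ a = 1 ↔ ψ a = 1) : ∃ e : G ≃ₜ* G', ∀ a, e (φ a) = ψ a := by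
  obtain ⟨e, he⟩ := exists_factor φ hφ ψ fun a => (h a).1
  obtain ⟨e', he'⟩ := exists_factor ψ hψ φ fun a => (h a).2
  refine ⟨⟨⟨⟨e, e', ?_, ?_⟩, map_mul e⟩, e.continuous_toFun, e'.continuous_toFun⟩, he⟩
  · intro g
    obtain ⟨a, rfl⟩ := hφ.surjective g
    rw [he, he']
  · intro g
    obtain ⟨a, rfl⟩ := hψ.surjective g
    rw [he', he]

end Quotients

end SchurSigma

namespace SchurSigma

open scoped commutatorElement

/-! ### Free pro-p-groups: density of the free group and maps to finite p-groups -/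

section FreeProP

variable {p n : ℕ} [hp : Fact p.Prime]

instance (N : PIndexSubgroup p n) : Finite (FreeQuot p n N) := by
  obtain ⟨k, hk⟩ := N.2.2
  have : N.1.FiniteIndex := ⟨by rw [hk]; exact pow_ne_zero _ hp.out.ne_zero⟩
  exact inferInstanceAs (Finite (FreeGroup (Fin n) ⧸ N.1))

theorem isPGroup_freeQuot (N : PIndexSubgroup p n) : IsPGroup p (FreeQuot p n N) := by
  obtain ⟨k, hk⟩ := N.2.2
  exact IsPGroup.of_card (n := k) hk

theorem isClosed_freeProPSubgroup :
    IsClosed (freeProPSubgroup p n : Set (∀ N : PIndexSubgroup p n, FreeQuot p n N)) := by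
  have : (freeProPSubgroup p n : Set (∀ N : PIndexSubgroup p n, FreeQuot p n N)) =
      ⋂ (M : PIndexSubgroup p n) (N : PIndexSubgroup p n) (h : M.1 ≤ N.1),
        {f | FreeQuot.proj p n h (f M) = f N} := by
    ext f; simp [freeProPSubgroup]
  rw [this]
  refine isClosed_iInter fun M => isClosed_iInter fun N => isClosed_iInter fun h => ?_
  exact isClosed_eq (continuous_of_discreteTopology.comp (continuous_apply M)) (continuous_apply N)

instance : CompactSpace (FreeProP p n) :=
  isCompact_iff_compactSpace.mp isClosed_freeProPSubgroup.isCompact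

/-- The canonical map from the abstract free group. -/
def FreeProP.ofFreeGroup (p n : ℕ) : FreeGroup (Fin n) →* FreeProP p n where
  toFun w := ⟨fun _ => QuotientGroup.mk w, fun _ _ _ => rfl⟩
  map_one' := rfl
  map_mul' _ _ := rfl

/-- The free generators of the free pro-`p`-group. -/
def FreeProP.gen (p : ℕ) {n : ℕ} (i : Fin n) : FreeProP p n :=
  FreeProP.ofFreeGroup p n (FreeGroup.of i)

/-- The projections of the free pro-`p`-group to its defining finite quotients. -/
def FreeProP.eval (N : PIndexSubgroup p n) : FreeProP p n →ₜ* FreeQuot p n N where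
  toFun f := f.1 N
  map_one' := rfl
  map_mul' _ _ := rfl
  continuous_toFun := (continuous_apply N).comp continuous_subtype_val

/-- The index system is closed under finite intersections. A basic open set of the product restricts
finitely many coordinates, so a single coordinate controls it. -/
theorem exists_pIndexSubgroup_le (I : Finset (PIndexSubgroup p n)) :
    ∃ N : PIndexSubgroup p n, ∀ M ∈ I, N.1 ≤ M.1 := by
  classical
  induction I using Finset.induction_on with
  | empty => exact ⟨⟨⊤, inferInstance, 0, by simp⟩, by simp⟩
  | insert M I _ ih =>
    obtain ⟨N, hN⟩ := ih
    obtain ⟨a, ha⟩ := M.2.2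
    obtain ⟨b, hb⟩ := N.2.2
    have hidx : (M.1 ⊓ N.1).index ∣ p ^ (b + a) := by
      rw [← Subgroup.relIndex_mul_index (inf_le_left : M.1 ⊓ N.1 ≤ M.1), Subgroup.inf_relIndex_left,
        ha, pow_add, ← hb]
      exact mul_dvd_mul_right (Subgroup.relIndex_dvd_index_of_normal _ _) _
    obtain ⟨k, -, hk⟩ := (Nat.dvd_prime_pow hp.out).mp hidx
    refine ⟨⟨M.1 ⊓ N.1, inferInstance, k, hk⟩, fun L hL => ?_⟩
    rcases Finset.mem_insert.mp hL with rfl | hL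
    · exact inf_le_left
    · exact inf_le_right.trans (hN L hL)

theorem FreeProP.exists_eval_subset {f : FreeProP p n} {U : Set (FreeProP p n)} (hU : IsOpen U)
    (hf : f ∈ U) : ∃ N : PIndexSubgroup p n,
      ∀ g, FreeProP.eval N g = FreeProP.eval N f → g ∈ U := by
  obtain ⟨V, hV, rfl⟩ := isOpen_induced_iff.mp hU
  obtain ⟨I, u, hu, hI⟩ := isOpen_pi_iff.mp hV f.1 hf
  obtain ⟨N, hN⟩ := exists_pIndexSubgroup_le I
  refine ⟨N, fun g hg => hI fun M hM => ?_⟩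
  have h1 : g.1 M = f.1 M := by
    rw [← g.2 N M (hN M hM), ← f.2 N M (hN M hM)]
    exact congrArg _ hg
  rw [h1]
  exact (hu M hM).2

theorem FreeProP.denseRange_ofFreeGroup : DenseRange (FreeProP.ofFreeGroup p n) := by
  intro f
  rw [mem_closure_iff]
  intro U hU hf
  obtain ⟨N, hN⟩ := FreeProP.exists_eval_subset hU hf
  obtain ⟨w, hw⟩ := QuotientGroup.mk_surjective (FreeProP.eval N f)
  exact ⟨_, hN (FreeProP.ofFreeGroup p n w) hw, w, rfl⟩

/-- The free generators generate the free pro-`p`-group topologically. -/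
theorem FreeProP.eq_top_of_gen_mem {S : Subgroup (FreeProP p n)}
    (hS : IsClosed (S : Set (FreeProP p n))) (h : ∀ i, FreeProP.gen p i ∈ S) : S = ⊤ := by
  have h1 : ∀ w, FreeProP.ofFreeGroup p n w ∈ S := by
    intro w
    induction w using FreeGroup.induction_on with
    | C1 => rw [map_one]; exact S.one_mem
    | of i => exact h i
    | inv_of i hi => rw [map_inv]; exact S.inv_mem hi
    | mul a b ha hb => rw [map_mul]; exact S.mul_mem ha hb
  rw [eq_top_iff]
  rintro f -
  have := FreeProP.denseRange_ofFreeGroup (p := p) f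
  refine hS.closure_subset_iff.mpr ?_ this
  rintro _ ⟨w, rfl⟩
  exact h1 w

theorem FreeProP.hom_ext {G : Type*} [Group G] [TopologicalSpace G] [T2Space G]
    {φ ψ : FreeProP p n →ₜ* G} (h : ∀ i, φ (gen p i) = ψ (gen p i)) (f : FreeProP p n) :
    φ f = ψ f := by
  have : (φ.toMonoidHom.eqLocus ψ.toMonoidHom) = ⊤ :=
    FreeProP.eq_top_of_gen_mem (isClosed_eq φ.continuous_toFun ψ.continuous_toFun) h
  exact (this ▸ Subgroup.mem_top f : f ∈ φ.toMonoidHom.eqLocus ψ.toMonoidHom)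

theorem FreeProP.isProP : IsProP p (FreeProP p n) where
  isTopologicalGroup := inferInstance
  compact := inferInstance
  totallyDisconnected := inferInstance
  isPGroup_quotient U := by
    intro g
    obtain ⟨f, rfl⟩ := QuotientGroup.mk_surjective g
    obtain ⟨N, hN⟩ := FreeProP.exists_eval_subset U.isOpen' U.one_mem
    obtain ⟨k, hk⟩ := isPGroup_freeQuot N (FreeProP.eval N f)
    refine ⟨k, ?_⟩
    rw [← QuotientGroup.mk_pow, QuotientGroup.eq_one_iff]
    exact hN _ (by rw [map_pow, hk, map_one])

/-- Universal property of the free pro-`p`-group for finite `p`-groups. -/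
theorem FreeProP.exists_hom_of_finite {P : Type*} [Group P] [TopologicalSpace P]
    [DiscreteTopology P] [Finite P] (hP : IsPGroup p P) (a : Fin n → P) :
    ∃ ψ : FreeProP p n →ₜ* P, ∀ i, ψ (gen p i) = a i := by
  obtain ⟨k, hk⟩ := (IsPGroup.iff_card).mp (hP.to_subgroup (FreeGroup.lift a).range)
  let N : PIndexSubgroup p n :=
    ⟨(FreeGroup.lift a).ker, inferInstance, k, by rw [Subgroup.index_ker]; exact hk⟩
  refine ⟨⟨(QuotientGroup.kerLift (FreeGroup.lift a)).comp (FreeProP.eval N).toMonoidHom,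
    (continuous_of_discreteTopology (α := FreeQuot p n N)).comp
      (FreeProP.eval N).continuous_toFun⟩, fun i => ?_⟩
  change FreeGroup.lift a (FreeGroup.of i) = a i
  simp

end FreeProP

/-! ### Pro-p-groups: universal property of the free group and the Frattini argument -/

section ProP

variable {p : ℕ} [hp : Fact p.Prime] {G : Type u} [Group G] [TopologicalSpace G]

theorem IsProP.exists_openNormalSubgroup_subset (hG : IsProP p G) {U : Set G} (hU : IsOpen U)
    (h1 : 1 ∈ U) : ∃ H : OpenNormalSubgroup G, (H : Set G) ⊆ U :=
  have := hG.isTopologicalGroup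
  have := hG.compact
  have := hG.totallyDisconnected
  ProfiniteGrp.exist_openNormalSubgroup_sub_open_nhds_of_one hU h1

theorem IsProP.t2Space (hG : IsProP p G) : T2Space G :=
  have := hG.isTopologicalGroup
  have := hG.totallyDisconnected
  inferInstance

theorem IsProP.finite_quotient (hG : IsProP p G) (U : OpenNormalSubgroup G) :
    Finite (G ⧸ U.toSubgroup) :=
  have := hG.isTopologicalGroup
  have := hG.compact
  Subgroup.quotient_finite_of_isOpen _ U.isOpen'

/-- Universal property of the free pro-`p`-group for pro-`p`-groups. -/
theorem FreeProP.exists_hom {n : ℕ} (hG : IsProP p G) (a : Fin n → G) :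
    ∃ ψ : FreeProP p n →ₜ* G, ∀ i, ψ (gen p i) = a i := by
  have := hG.isTopologicalGroup
  have := hG.compact
  have := hG.t2Space
  -- `Γ` is the closure of the graph of the desired homomorphism. It is single-valued because an
  -- element of `G` over `1` dies in every finite quotient of `G` (`hinj`), and total because its
  -- first projection is compact and contains the generators (`hsurj`).
  let Γ : Subgroup (FreeProP p n × G) :=
    (Subgroup.closure (Set.range fun i => (gen p i, a i))).topologicalClosure
  have hΓ : IsClosed (Γ : Set (FreeProP p n × G)) := Subgroup.isClosed_topologicalClosure _
  have hmem : ∀ i, (gen p i, a i) ∈ Γ := fun i =>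
    Subgroup.le_topologicalClosure _ (Subgroup.subset_closure ⟨i, rfl⟩)
  have hquot : ∀ U : OpenNormalSubgroup G, ∃ ψ : FreeProP p n →* G ⧸ U.toSubgroup,
      IsOpen (ψ.ker : Set (FreeProP p n)) ∧ ∀ f g, (f, g) ∈ Γ → ψ f = QuotientGroup.mk g := by
    intro U
    have := hG.finite_quotient U
    have hd : DiscreteTopology (G ⧸ U.toSubgroup) := QuotientGroup.discreteTopology U.isOpen'
    obtain ⟨ψ, hψ⟩ := FreeProP.exists_hom_of_finite (hG.isPGroup_quotient U)
      fun i => (QuotientGroup.mk (a i) : G ⧸ U.toSubgroup)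
    refine ⟨ψ.toMonoidHom, (isOpen_discrete {1}).preimage ψ.continuous_toFun, ?_⟩
    let S : Subgroup (FreeProP p n × G) :=
      (ψ.toMonoidHom.comp (MonoidHom.fst _ _)).eqLocus
        ((QuotientGroup.mk' U.toSubgroup).comp (MonoidHom.snd _ _))
    have hS : IsClosed (S : Set (FreeProP p n × G)) :=
      isClosed_eq (ψ.continuous_toFun.comp continuous_fst)
        (QuotientGroup.continuous_mk.comp continuous_snd)
    have : Γ ≤ S := by
      refine Subgroup.topologicalClosure_minimal _ ?_ hS
      rw [Subgroup.closure_le]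
      rintro _ ⟨i, rfl⟩
      exact hψ i
    exact fun f g h => this h
  have hinj : ∀ g, ((1 : FreeProP p n), g) ∈ Γ → g = 1 := by
    intro g hg
    by_contra hne
    obtain ⟨U, hU⟩ := hG.exists_openNormalSubgroup_subset
      (isOpen_compl_singleton (x := g)) (Ne.symm hne)
    obtain ⟨ψ, -, hψ⟩ := hquot U
    have h1 := hψ 1 g hg
    rw [map_one, eq_comm, QuotientGroup.eq_one_iff] at h1
    exact hU h1 rfl
  have hsurj : ∀ f, ∃ g, (f, g) ∈ Γ := by
    have htop : Γ.map (MonoidHom.fst _ _) = ⊤ := by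
      refine FreeProP.eq_top_of_gen_mem ?_ fun i => ⟨_, hmem i, rfl⟩
      exact (hΓ.isCompact.image continuous_fst).isClosed
    intro f
    obtain ⟨⟨f', g⟩, h, rfl⟩ := (htop ▸ Subgroup.mem_top f : f ∈ Γ.map (MonoidHom.fst _ _))
    exact ⟨g, h⟩
  choose φ hφ using hsurj
  have huniq : ∀ f g, (f, g) ∈ Γ → φ f = g := by
    intro f g h
    have := hinj _ (by simpa using Γ.mul_mem (hφ f) (Γ.inv_mem h) : (1, φ f * g⁻¹) ∈ Γ)
    rwa [mul_inv_eq_one] at this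
  let Φ : FreeProP p n →* G :=
    { toFun := φ
      map_one' := huniq _ _ Γ.one_mem
      map_mul' := fun f f' => huniq _ _ (Γ.mul_mem (hφ f) (hφ f')) }
  refine ⟨⟨Φ, ?_⟩, fun i => huniq _ _ (hmem i)⟩
  refine continuous_of_continuousAt_one Φ ?_
  rw [ContinuousAt, map_one]
  intro W hW
  obtain ⟨V, hVW, hV, h1⟩ := mem_nhds_iff.mp hW
  obtain ⟨U, hU⟩ := hG.exists_openNormalSubgroup_subset hV h1
  obtain ⟨ψ, hψo, hψ⟩ := hquot U
  rw [Filter.mem_map]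
  refine Filter.mem_of_superset (hψo.mem_nhds ψ.ker.one_mem) fun f hf => hVW (hU ?_)
  have h2 := hψ f _ (hφ f)
  rw [MonoidHom.mem_ker.mp hf, eq_comm, QuotientGroup.eq_one_iff] at h2
  exact h2

/-- A maximal subgroup of a finite `p`-group is normal by the normalizer condition. Its quotient
contains an element of order `p`, which by maximality generates it. -/
theorem exists_addHom_of_isCoatom {P : Type*} [Group P] [Finite P] (hP : IsPGroup p P)
    {M : Subgroup P} (hM : IsCoatom M) :
    ∃ f : P → ZMod p, (∀ a b, f (a * b) = f a + f b) ∧ (∀ a, f a = 0 ↔ a ∈ M) := by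
  have := hP.isNilpotent
  have hn : M.Normal := Subgroup.NormalizerCondition.normal_of_coatom M
    Group.normalizerCondition_of_isNilpotent hM
  have hnt : Nontrivial (P ⧸ M) := by
    rw [QuotientGroup.nontrivial_iff]
    exact hM.1
  obtain ⟨k, hk, hcard⟩ := (hP.to_quotient M).nontrivial_iff_card.mp hnt
  obtain ⟨z, hz⟩ := exists_prime_orderOf_dvd_card' (G := P ⧸ M) p
    (hcard ▸ dvd_pow_self p hk.ne')
  have htop : Subgroup.zpowers z = ⊤ := by
    have h1 : (Subgroup.zpowers z).comap (QuotientGroup.mk' M) = ⊤ := by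
      refine hM.2 _ (lt_of_le_of_ne ?_ ?_)
      · intro a ha
        rw [Subgroup.mem_comap, QuotientGroup.mk'_apply, (QuotientGroup.eq_one_iff a).mpr ha]
        exact Subgroup.one_mem _
      · obtain ⟨a, rfl⟩ := QuotientGroup.mk_surjective z
        intro h
        have ha : a ∈ M := by
          rw [h]; exact Subgroup.mem_zpowers _
        rw [(QuotientGroup.eq_one_iff a).mpr ha, orderOf_one] at hz
        exact hp.out.one_lt.ne hz
    rw [eq_top_iff]
    rintro q -
    obtain ⟨a, rfl⟩ := QuotientGroup.mk_surjective q
    exact (h1 ▸ Subgroup.mem_top a : a ∈ (Subgroup.zpowers z).comap (QuotientGroup.mk' M))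
  have hc : Nat.card (P ⧸ M) = p := by
    rw [← hz, ← Nat.card_zpowers, htop, Subgroup.card_top]
  have hc' : Nat.card (Multiplicative (ZMod p)) = p := Nat.card_zmod p
  let e : P ⧸ M ≃* Multiplicative (ZMod p) := mulEquivOfPrimeCardEq (p := p) hc hc'
  refine ⟨fun a => (e (QuotientGroup.mk a)).toAdd, fun a b => ?_, fun a => ?_⟩
  · beta_reduce; rw [QuotientGroup.mk_mul, map_mul, toAdd_mul]
  · rw [toAdd_eq_zero, EmbeddingLike.map_eq_one_iff, QuotientGroup.eq_one_iff]

theorem IsProP.exists_openNormalSubgroup_notMem_sup (hG : IsProP p G) {S : Subgroup G}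
    (hS : IsClosed (S : Set G)) {g : G} (hg : g ∉ S) :
    ∃ U : OpenNormalSubgroup G, g ∉ S ⊔ U.toSubgroup := by
  have := hG.isTopologicalGroup
  have hV : IsOpen {u : G | g * u⁻¹ ∉ S} :=
    (hS.preimage (by fun_prop : Continuous fun u : G => g * u⁻¹)).isOpen_compl
  obtain ⟨U, hU⟩ := hG.exists_openNormalSubgroup_subset hV (by simpa using hg)
  have : U.toSubgroup.Normal := U.isNormal'
  refine ⟨U, fun h => ?_⟩
  obtain ⟨s, hs, u, hu, rfl⟩ := Subgroup.mem_sup_of_normal_right.mp h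
  exact hU hu (by simpa using hs)

/-- The Frattini argument for pro-`p`-groups. -/
theorem IsProP.eq_top_of_forall_Z1 (hG : IsProP p G) {S : Subgroup G}
    (hS : IsClosed (S : Set G)) (h : ∀ f ∈ Z1 p G, (∀ s ∈ S, f s = 0) → f = 0) : S = ⊤ := by
  by_contra hne
  obtain ⟨g, hg⟩ : ∃ g, g ∉ S := by
    by_contra! h; exact hne (eq_top_iff.mpr fun g _ => h g)
  obtain ⟨U, hU⟩ := hG.exists_openNormalSubgroup_notMem_sup hS hg
  have := hG.isTopologicalGroup
  have : U.toSubgroup.Normal := U.isNormal'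
  have := hG.finite_quotient U
  have hd : DiscreteTopology (G ⧸ U.toSubgroup) := QuotientGroup.discreteTopology U.isOpen'
  have hne' : S.map (QuotientGroup.mk' U.toSubgroup) ≠ ⊤ := by
    intro htop
    obtain ⟨s, hs, hsg⟩ :=
      (htop ▸ Subgroup.mem_top _ : (QuotientGroup.mk' U.toSubgroup) g ∈ S.map _)
    rw [QuotientGroup.mk'_eq_mk'] at hsg
    obtain ⟨u, hu, rfl⟩ := hsg
    exact hU (Subgroup.mul_mem_sup hs hu)
  -- A proper subgroup of a finite `p`-group lies in the kernel of a nonzero homomorphism to `𝔽_p`;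
  -- pulled back to `G`, this homomorphism kills `S` and contradicts `h`.
  obtain ⟨M, hM, hSM⟩ := (eq_top_or_exists_le_coatom _).resolve_left hne'
  obtain ⟨f, hf, hf0⟩ := exists_addHom_of_isCoatom (hG.isPGroup_quotient U) hM
  have hz : (fun a => f (QuotientGroup.mk a)) = (0 : G → ZMod p) := by
    refine h _ ⟨(continuous_of_discreteTopology).comp QuotientGroup.continuous_mk,
      fun a b => ?_⟩ fun s hs => ?_
    · exact hf (QuotientGroup.mk a) (QuotientGroup.mk b)
    · exact (hf0 _).mpr (hSM ⟨s, hs, rfl⟩)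
  refine hM.1 (eq_top_iff.mpr fun q _ => ?_)
  obtain ⟨a, rfl⟩ := QuotientGroup.mk_surjective q
  exact (hf0 _).mp (congrFun hz a)

end ProP

end SchurSigma

namespace SchurSigma

open scoped commutatorElement

/-! ### The truncated Magnus group -/

/-- The group of units `1 + c₁ + c₂ + c₃` of the free associative algebra over `𝔽_3` on two
generators modulo its elements of degree at least `4`, where `cᵢ` is homogeneous of
degree `i`. -/
@[ext] structure Magnus where
  /-- the coefficients in degree one -/
  c1 : Fin 2 → ZMod 3
  /-- the coefficients in degree two -/
  c2 : Fin 2 → Fin 2 → ZMod 3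
  /-- the coefficients in degree three -/
  c3 : Fin 2 → Fin 2 → Fin 2 → ZMod 3

namespace Magnus

instance : Mul Magnus := ⟨fun a b =>
  ⟨fun i => a.c1 i + b.c1 i, fun i j => a.c2 i j + b.c2 i j + a.c1 i * b.c1 j,
    fun i j k => a.c3 i j k + b.c3 i j k + a.c1 i * b.c2 j k + a.c2 i j * b.c1 k⟩⟩

instance : One Magnus := ⟨⟨fun _ => 0, fun _ _ => 0, fun _ _ _ => 0⟩⟩

instance : Inv Magnus := ⟨fun a =>
  ⟨fun i => -a.c1 i, fun i j => -a.c2 i j + a.c1 i * a.c1 j,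
    fun i j k => -a.c3 i j k + a.c1 i * a.c2 j k + a.c2 i j * a.c1 k
      - a.c1 i * a.c1 j * a.c1 k⟩⟩

@[simp] theorem one_c1 (i) : (1 : Magnus).c1 i = 0 := rfl
@[simp] theorem one_c2 (i j) : (1 : Magnus).c2 i j = 0 := rfl
@[simp] theorem one_c3 (i j k) : (1 : Magnus).c3 i j k = 0 := rfl
@[simp] theorem mul_c1 (a b : Magnus) (i) : (a * b).c1 i = a.c1 i + b.c1 i := rfl
@[simp] theorem mul_c2 (a b : Magnus) (i j) :
    (a * b).c2 i j = a.c2 i j + b.c2 i j + a.c1 i * b.c1 j := rfl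
@[simp] theorem mul_c3 (a b : Magnus) (i j k) : (a * b).c3 i j k =
    a.c3 i j k + b.c3 i j k + a.c1 i * b.c2 j k + a.c2 i j * b.c1 k := rfl
@[simp] theorem inv_c1 (a : Magnus) (i) : a⁻¹.c1 i = -a.c1 i := rfl
@[simp] theorem inv_c2 (a : Magnus) (i j) : a⁻¹.c2 i j = -a.c2 i j + a.c1 i * a.c1 j := rfl
@[simp] theorem inv_c3 (a : Magnus) (i j k) : a⁻¹.c3 i j k =
    -a.c3 i j k + a.c1 i * a.c2 j k + a.c2 i j * a.c1 k - a.c1 i * a.c1 j * a.c1 k := rfl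

instance : Group Magnus := Group.ofLeftAxioms
  (by intro a b c; ext <;> simp <;> ring)
  (by intro a; ext <;> simp)
  (by intro a; ext <;> simp <;> ring)

instance : TopologicalSpace Magnus := ⊥

instance : DiscreteTopology Magnus := ⟨rfl⟩

instance : Finite Magnus :=
  Finite.of_injective (fun a : Magnus => (a.c1, a.c2, a.c3)) fun a b h => by
    simp only [Prod.mk.injEq] at h
    exact Magnus.ext h.1 h.2.1 h.2.2

theorem three_eq_zero : (3 : ZMod 3) = 0 := rfl

/-- In characteristic three, `(1 + u)³ = 1 + u³`, and up to degree three `u³` only sees the linear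
part of `u`. -/
theorem cube_c1 (a : Magnus) (i) : (a ^ 3).c1 i = 0 := by
  simp only [pow_succ, pow_zero, one_mul, mul_c1]
  linear_combination a.c1 i * three_eq_zero

theorem cube_c2 (a : Magnus) (i j) : (a ^ 3).c2 i j = 0 := by
  simp only [pow_succ, pow_zero, one_mul, mul_c1, mul_c2]
  linear_combination (a.c2 i j + a.c1 i * a.c1 j) * three_eq_zero

theorem cube_c3 (a : Magnus) (i j k) : (a ^ 3).c3 i j k = a.c1 i * a.c1 j * a.c1 k := by
  simp only [pow_succ, pow_zero, one_mul, mul_c1, mul_c2, mul_c3]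
  linear_combination (a.c3 i j k + a.c1 i * a.c2 j k + a.c2 i j * a.c1 k) * three_eq_zero

theorem commutator_c1 (a b : Magnus) (i) : ⁅a, b⁆.c1 i = 0 := by
  simp [commutatorElement_def]

theorem commutator_c2 (a b : Magnus) (i j) :
    ⁅a, b⁆.c2 i j = a.c1 i * b.c1 j - b.c1 i * a.c1 j := by
  simp only [commutatorElement_def, mul_c1, mul_c2, inv_c1, inv_c2]; ring

/-- If one entry has no linear term, the cubic part of the commutator is the Lie bracket of a linear
and a quadratic part. -/
theorem commutator_c3_left (a b : Magnus) (h : ∀ i, b.c1 i = 0) (i j k) :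
    ⁅a, b⁆.c3 i j k = a.c1 i * b.c2 j k - b.c2 i j * a.c1 k := by
  simp only [commutatorElement_def, mul_c1, mul_c2, mul_c3, inv_c1, inv_c2, inv_c3, h]; ring

theorem commutator_c3_right (a b : Magnus) (h : ∀ i, a.c1 i = 0) (i j k) :
    ⁅a, b⁆.c3 i j k = a.c2 i j * b.c1 k - b.c1 i * a.c2 j k := by
  simp only [commutatorElement_def, mul_c1, mul_c2, mul_c3, inv_c1, inv_c2, inv_c3, h]; ring

theorem pow_c1 (a : Magnus) (n : ℕ) (i) : (a ^ n).c1 i = n * a.c1 i := by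
  induction n with
  | zero => simp
  | succ n ih => rw [pow_succ, mul_c1, ih]; push_cast; ring

theorem pow_c2 (a : Magnus) (h : ∀ i, a.c1 i = 0) (n : ℕ) (i j) :
    (a ^ n).c2 i j = n * a.c2 i j := by
  induction n with
  | zero => simp
  | succ n ih => rw [pow_succ, mul_c2, ih, h]; push_cast; ring

theorem pow_c3 (a : Magnus) (h : ∀ i, a.c1 i = 0) (h' : ∀ i j, a.c2 i j = 0) (n : ℕ) (i j k) :
    (a ^ n).c3 i j k = n * a.c3 i j k := by
  induction n with
  | zero => simp
  | succ n ih => rw [pow_succ, mul_c3, ih, h, h']; push_cast; ring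

theorem isPGroup : IsPGroup 3 Magnus := by
  intro a
  refine ⟨2, ?_⟩
  rw [show 3 ^ 2 = 3 * 3 by norm_num, pow_mul]
  ext <;> simp [cube_c1, cube_c2, cube_c3]

/-- The subgroup of elements without terms of degree one. -/
def fil2 : Subgroup Magnus where
  carrier := {a | ∀ i, a.c1 i = 0}
  one_mem' := fun _ => rfl
  mul_mem' := fun ha hb i => by simp [ha i, hb i]
  inv_mem' := fun ha i => by simp [ha i]

/-- The subgroup of elements without terms of degree one and two. -/
def fil3 : Subgroup Magnus where
  carrier := {a | (∀ i, a.c1 i = 0) ∧ ∀ i j, a.c2 i j = 0}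
  one_mem' := ⟨fun _ => rfl, fun _ _ => rfl⟩
  mul_mem' := fun ha hb => ⟨fun i => by simp [ha.1 i, hb.1 i],
    fun i j => by simp [ha.1 i, ha.2 i j, hb.2 i j]⟩
  inv_mem' := fun ha => ⟨fun i => by simp [ha.1 i], fun i j => by simp [ha.1 i, ha.2 i j]⟩

/-- This and the next two results bound `D_i` from above by the elements without terms of degree
below `i`. Together with the normal forms in the free group they give exact criteria for membership
in `D_2`, `D_3`, `D_4`. -/
theorem zassenhaus_two_le : zassenhaus 3 Magnus 2 ≤ fil2 :=
  zassenhaus_le (by norm_num) (isClosed_discrete _) (fun a _ => cube_c1 a)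
    fun _ _ _ _ _ a _ b _ => commutator_c1 a b

theorem zassenhaus_three_le : zassenhaus 3 Magnus 3 ≤ fil3 := by
  refine zassenhaus_le (by norm_num) (isClosed_discrete _)
    (fun a _ => ⟨cube_c1 a, cube_c2 a⟩) fun j k hj hk hjk a ha b hb =>
      ⟨commutator_c1 a b, fun i l => ?_⟩
  rw [commutator_c2]
  obtain ⟨rfl, rfl⟩ | ⟨rfl, rfl⟩ : (j = 1 ∧ k = 2) ∨ (j = 2 ∧ k = 1) := by omega
  · rw [zassenhaus_two_le hb, zassenhaus_two_le hb]; ring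
  · rw [zassenhaus_two_le ha, zassenhaus_two_le ha]; ring

theorem zassenhaus_four_eq_bot : zassenhaus 3 Magnus 4 = ⊥ := by
  rw [eq_bot_iff]
  refine zassenhaus_le (by norm_num) (isClosed_discrete _) (fun a ha => ?_)
    fun j k hj hk hjk a ha b hb => ?_
  · have ha' := zassenhaus_two_le (zassenhaus_antitone 3 Magnus (by decide) ha)
    rw [Subgroup.mem_bot]
    ext <;> simp [cube_c1, cube_c2, cube_c3, ha' _]
  · rw [Subgroup.mem_bot]
    obtain ⟨rfl, rfl⟩ | ⟨rfl, rfl⟩ | ⟨rfl, rfl⟩ :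
      (j = 1 ∧ k = 3) ∨ (j = 2 ∧ k = 2) ∨ (j = 3 ∧ k = 1) := by omega
    · have hb' := zassenhaus_three_le hb
      ext <;> simp [commutator_c1, commutator_c2, commutator_c3_left a b hb'.1, hb'.1 _, hb'.2 _]
    · have ha' := zassenhaus_two_le ha
      have hb' := zassenhaus_two_le hb
      ext <;> simp [commutator_c1, commutator_c2, commutator_c3_left a b hb', ha' _, hb' _]
    · have ha' := zassenhaus_three_le ha
      ext <;> simp [commutator_c1, commutator_c2, commutator_c3_right a b ha'.1, ha'.1 _, ha'.2 _]

end Magnus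

/-! ### Generation of the graded pieces of the free pro-`3`-group -/

section Generation

/-- An element `z` that is central with trivial cube modulo `D` can be adjoined to `D`: the result
is a union of three translates of `D`, hence closed. Iterating this produces the normal forms below;
once the subgroup reached contains the generators of `D_i`, the adjoined elements span `gr_i`. -/
theorem exists_extension_of_central {G : Type u} [Group G] [TopologicalSpace G]
    [IsTopologicalGroup G] {D : Subgroup G} [D.Normal] (hD : IsClosed (D : Set G)) {z : G}
    (hz3 : z ^ 3 ∈ D) (hz : ∀ g : G, ⁅g, z⁆ ∈ D) :
    ∃ E : Subgroup G, E.Normal ∧ IsClosed (E : Set G) ∧ D ≤ E ∧ z ∈ E ∧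
      ∀ e ∈ E, ∃ k < 3, ∃ d ∈ D, e = z ^ k * d := by
  have hcen : (QuotientGroup.mk z : G ⧸ D) ∈ Subgroup.center (G ⧸ D) := by
    rw [Subgroup.mem_center_iff]
    intro q
    obtain ⟨g, rfl⟩ := QuotientGroup.mk_surjective q
    rw [← commutatorElement_eq_one_iff_mul_comm]
    exact (QuotientGroup.eq_one_iff _).mpr (hz g)
  have hn : (Subgroup.zpowers (QuotientGroup.mk z : G ⧸ D)).Normal := by
    refine ⟨fun x hx g => ?_⟩
    have : x ∈ Subgroup.center (G ⧸ D) := (Subgroup.zpowers_le.mpr hcen) hx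
    rw [Subgroup.mem_center_iff] at this
    rwa [this g, mul_inv_cancel_right]
  let E := (Subgroup.zpowers (QuotientGroup.mk z : G ⧸ D)).comap (QuotientGroup.mk' D)
  have hE : ∀ e ∈ E, ∃ k < 3, ∃ d ∈ D, e = z ^ k * d := by
    rintro e ⟨k, hk⟩
    refine ⟨(k % 3).toNat, by omega, (z ^ (k % 3).toNat)⁻¹ * e, ?_, by group⟩
    rw [← QuotientGroup.eq_one_iff, QuotientGroup.mk_mul, QuotientGroup.mk_inv,
      QuotientGroup.mk_pow]
    have h3 : (QuotientGroup.mk z : G ⧸ D) ^ (3 : ℤ) = 1 := by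
      have := (QuotientGroup.eq_one_iff (z ^ 3)).mpr hz3
      exact_mod_cast this
    have h4 : (QuotientGroup.mk z : G ⧸ D) ^ (k % 3).toNat = (QuotientGroup.mk z : G ⧸ D) ^ k := by
      rw [← zpow_natCast, Int.toNat_of_nonneg (by omega)]
      conv_rhs => rw [← Int.emod_add_mul_ediv k 3, zpow_add, zpow_mul, h3, one_zpow, mul_one]
    rw [h4]
    exact inv_mul_eq_one.mpr hk
  have hzE : z ∈ E := Subgroup.mem_zpowers _
  have hDE : D ≤ E := fun d hd => by
    rw [Subgroup.mem_comap, QuotientGroup.mk'_apply, (QuotientGroup.eq_one_iff d).mpr hd]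
    exact Subgroup.one_mem _
  refine ⟨E, inferInstance, ?_, hDE, hzE, hE⟩
  have : (E : Set G) = ⋃ k : Fin 3, {e | (z ^ (k : ℕ))⁻¹ * e ∈ D} := by
    ext e
    simp only [SetLike.mem_coe, Set.mem_iUnion, Set.mem_ofPred_eq]
    constructor
    · intro he
      obtain ⟨k, hk, d, hd, rfl⟩ := hE e he
      exact ⟨⟨k, hk⟩, by simpa using hd⟩
    · rintro ⟨k, hk⟩
      have := E.mul_mem (E.pow_mem hzE k) (hDE hk)
      rwa [mul_inv_cancel_left] at this
  rw [this]
  exact isClosed_iUnion_of_finite fun k => hD.preimage (by fun_prop)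

/-- The elements that commute with `a` modulo `E` form a closed subgroup, so the two free generators
suffice. -/
theorem commutator_mem_of_gen {E : Subgroup (FreeProP 3 2)} [E.Normal]
    (hE : IsClosed (E : Set (FreeProP 3 2))) {a : FreeProP 3 2}
    (h : ∀ i : Fin 2, ⁅FreeProP.gen 3 i, a⁆ ∈ E) (g : FreeProP 3 2) : ⁅g, a⁆ ∈ E := by
  let S : Subgroup (FreeProP 3 2) :=
    (Subgroup.centralizer {(QuotientGroup.mk a : FreeProP 3 2 ⧸ E)}).comap (QuotientGroup.mk' E)
  have hS : ∀ g, g ∈ S ↔ ⁅g, a⁆ ∈ E := by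
    intro g
    rw [Subgroup.mem_comap, Subgroup.mem_centralizer_singleton_iff, QuotientGroup.mk'_apply,
      ← commutatorElement_eq_one_iff_mul_comm, ← QuotientGroup.eq_one_iff]
    rfl
  have hcl : IsClosed (S : Set (FreeProP 3 2)) := by
    have : (S : Set (FreeProP 3 2)) = (fun g => g * a * g⁻¹ * a⁻¹) ⁻¹' E := Set.ext hS
    rw [this]
    exact hE.preimage (by fun_prop)
  have htop : S = ⊤ := FreeProP.eq_top_of_gen_mem hcl fun i => (hS _).mpr (h i)
  exact (hS g).mp (htop ▸ Subgroup.mem_top g)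

/-- Collecting `(gh)³` moves `h` past `g` three times. As this exponent is again 3, cubing is
multiplicative whenever commutators are central with trivial cube; `cube_mem_of_gen` rests on this.
-/
theorem mul_pow_three_of_central {Q : Type*} [Group Q] {g h : Q}
    (hc : ∀ k, k * ⁅h, g⁆ = ⁅h, g⁆ * k) : (g * h) ^ 3 = ⁅h, g⁆ ^ 3 * g ^ 3 * h ^ 3 := by
  have h1 : h * g = ⁅h, g⁆ * (g * h) := by rw [commutatorElement_def]; group
  generalize ⁅h, g⁆ = c at *
  calc (g * h) ^ 3 = g * (h * g) * (h * g) * h := by simp only [pow_succ, pow_zero]; group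
    _ = g * c * (g * h) * (c * (g * h)) * h := by rw [h1]; group
    _ = c * g * (g * h) * (c * (g * h)) * h := by rw [hc g]
    _ = c * g * (g * h * c) * (g * h) * h := by group
    _ = c * g * (c * (g * h)) * (g * h) * h := by rw [hc (g * h)]
    _ = c * (g * c) * g * (h * g) * h * h := by group
    _ = c * (c * g) * g * (c * (g * h)) * h * h := by rw [hc g, h1]
    _ = c * c * (g * g * c) * g * h * h * h := by group
    _ = c * c * (c * (g * g)) * g * h * h * h := by rw [hc (g * g)]
    _ = c ^ 3 * g ^ 3 * h ^ 3 := by simp only [pow_succ, pow_zero]; group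

theorem cube_mem_of_gen {E : Subgroup (FreeProP 3 2)} [hn : E.Normal]
    (hE : IsClosed (E : Set (FreeProP 3 2)))
    (hc : ∀ k g h : FreeProP 3 2, ⁅k, ⁅h, g⁆⁆ ∈ E) (hc3 : ∀ g h : FreeProP 3 2, ⁅h, g⁆ ^ 3 ∈ E)
    (h : ∀ i, FreeProP.gen 3 i ^ 3 ∈ E) (g : FreeProP 3 2) : g ^ 3 ∈ E := by
  let S : Subgroup (FreeProP 3 2) :=
    { carrier := {g | g ^ 3 ∈ E}
      one_mem' := by simp
      mul_mem' := by
        intro a b ha hb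
        have h1 : (QuotientGroup.mk a * QuotientGroup.mk b : FreeProP 3 2 ⧸ E) ^ 3 =
            ⁅(QuotientGroup.mk b : FreeProP 3 2 ⧸ E), QuotientGroup.mk a⁆ ^ 3 *
              QuotientGroup.mk a ^ 3 * QuotientGroup.mk b ^ 3 := by
          refine mul_pow_three_of_central fun q => ?_
          obtain ⟨k, rfl⟩ := QuotientGroup.mk_surjective q
          rw [← commutatorElement_eq_one_iff_mul_comm]
          exact (QuotientGroup.eq_one_iff _).mpr (hc k a b)
        have h2 : ⁅(QuotientGroup.mk b : FreeProP 3 2 ⧸ E), (QuotientGroup.mk a : FreeProP 3 2 ⧸ E)⁆ ^ 3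
            = 1 := (QuotientGroup.eq_one_iff _).mpr (hc3 a b)
        have h3 : (QuotientGroup.mk a : FreeProP 3 2 ⧸ E) ^ 3 = 1 :=
          (QuotientGroup.eq_one_iff _).mpr ha
        have h4 : (QuotientGroup.mk b : FreeProP 3 2 ⧸ E) ^ 3 = 1 :=
          (QuotientGroup.eq_one_iff _).mpr hb
        rw [h2, h3, h4, one_mul, one_mul] at h1
        exact (QuotientGroup.eq_one_iff _).mp h1
      inv_mem' := by
        intro a ha
        change a⁻¹ ^ 3 ∈ E
        rw [inv_pow]
        exact E.inv_mem ha }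
  have hcl : IsClosed (S : Set (FreeProP 3 2)) := hE.preimage (by fun_prop)
  have htop : S = ⊤ := FreeProP.eq_top_of_gen_mem hcl h
  exact (htop ▸ Subgroup.mem_top g : g ∈ S)

local notation "x" => FreeProP.gen 3 (0 : Fin 2)
local notation "y" => FreeProP.gen 3 (1 : Fin 2)

theorem exists_eq_mod_zassenhaus_two (f : FreeProP 3 2) :
    ∃ a < 3, ∃ b < 3, ∃ d ∈ zassenhaus 3 (FreeProP 3 2) 2, f = x ^ a * (y ^ b * d) := by
  have hcomm : ∀ g h : FreeProP 3 2, ⁅g, h⁆ ∈ zassenhaus 3 (FreeProP 3 2) 2 := fun g h =>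
    commutator_mem_zassenhaus (j := 1) (k := 1) one_pos one_pos (mem_zassenhaus_one _)
      (mem_zassenhaus_one _)
  have hcube : ∀ g : FreeProP 3 2, g ^ 3 ∈ zassenhaus 3 (FreeProP 3 2) 2 := fun g =>
    pow_mem_zassenhaus 3 _ one_lt_two (mem_zassenhaus_one _)
  obtain ⟨E, hEn, hEc, hDE, hyE, hE⟩ := exists_extension_of_central
    (isClosed_zassenhaus 3 (FreeProP 3 2) 2) (hcube y) fun g => hcomm g y
  obtain ⟨E', hEn', hEc', hDE', hxE', hE'⟩ := exists_extension_of_central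
    hEc (hDE (hcube x)) fun g => hDE (hcomm g x)
  have htop : E' = ⊤ := FreeProP.eq_top_of_gen_mem hEc' fun i => by
    fin_cases i
    · exact hxE'
    · exact hDE' hyE
  obtain ⟨a, ha, e, he, rfl⟩ := hE' f (htop ▸ Subgroup.mem_top f)
  obtain ⟨b, hb, d, hd, rfl⟩ := hE e he
  exact ⟨a, ha, b, hb, d, hd, rfl⟩

theorem commutator_gen_mem : ⁅x, y⁆ ∈ zassenhaus 3 (FreeProP 3 2) 2 :=
  commutator_mem_zassenhaus (j := 1) (k := 1) one_pos one_pos (mem_zassenhaus_one _)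
      (mem_zassenhaus_one _)

theorem exists_eq_mod_zassenhaus_three {f : FreeProP 3 2}
    (hf : f ∈ zassenhaus 3 (FreeProP 3 2) 2) :
    ∃ a < 3, ∃ d ∈ zassenhaus 3 (FreeProP 3 2) 3, f = ⁅x, y⁆ ^ a * d := by
  have hcube : ∀ g : FreeProP 3 2, g ^ 3 ∈ zassenhaus 3 (FreeProP 3 2) 3 := fun g =>
    pow_mem_zassenhaus 3 _ (by norm_num) (mem_zassenhaus_one _)
  obtain ⟨E, hEn, hEc, hDE, hzE, hE⟩ := exists_extension_of_central
    (isClosed_zassenhaus 3 (FreeProP 3 2) 3) (hcube ⁅x, y⁆) fun g =>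
      commutator_mem_zassenhaus (j := 1) (k := 2) one_pos two_pos (mem_zassenhaus_one _)
        commutator_gen_mem
  have hy : ∀ g : FreeProP 3 2, ⁅g, y⁆ ∈ E := commutator_mem_of_gen hEc fun i => by
    fin_cases i
    · exact hzE
    · simp
  have hall : ∀ g h : FreeProP 3 2, ⁅g, h⁆ ∈ E := fun g => by
    intro h
    rw [← commutatorElement_inv]
    refine E.inv_mem (commutator_mem_of_gen hEc (fun i => ?_) h)
    rw [← commutatorElement_inv]
    refine E.inv_mem (commutator_mem_of_gen hEc (fun j => ?_) g)
    fin_cases i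
    · fin_cases j
      · simp
      · change ⁅y, x⁆ ∈ E
        rw [← commutatorElement_inv]; exact E.inv_mem hzE
    · exact hy _
  refine hE f (zassenhaus_le one_lt_two hEc (fun a _ => hDE (hcube a)) ?_ hf)
  exact fun _ _ _ _ _ a _ b _ => hall a b

theorem exists_eq_mod_zassenhaus_four {f : FreeProP 3 2}
    (hf : f ∈ zassenhaus 3 (FreeProP 3 2) 3) :
    ∃ a < 3, ∃ b < 3, ∃ c < 3, ∃ d < 3, ∃ e ∈ zassenhaus 3 (FreeProP 3 2) 4,
      f = (x ^ 3) ^ a * ((y ^ 3) ^ b * (⁅x, ⁅x, y⁆⁆ ^ c * (⁅y, ⁅x, y⁆⁆ ^ d * e))) := by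
  have hcube : ∀ g : FreeProP 3 2, g ^ 3 ∈ zassenhaus 3 (FreeProP 3 2) 3 := fun g =>
    pow_mem_zassenhaus 3 _ (by norm_num) (mem_zassenhaus_one _)
  have hcube2 : ∀ g ∈ zassenhaus 3 (FreeProP 3 2) 2, g ^ 3 ∈ zassenhaus 3 (FreeProP 3 2) 4 :=
    fun g hg => pow_mem_zassenhaus 3 _ (by norm_num) hg
  have hcube3 : ∀ g ∈ zassenhaus 3 (FreeProP 3 2) 3, g ^ 3 ∈ zassenhaus 3 (FreeProP 3 2) 4 :=
    fun g hg => hcube2 g (zassenhaus_succ_le 3 _ 2 hg)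
  have hcen : ∀ w ∈ zassenhaus 3 (FreeProP 3 2) 3, ∀ g : FreeProP 3 2, ⁅g, w⁆ ∈ zassenhaus 3 (FreeProP 3 2) 4 :=
    fun w hw g => commutator_mem_zassenhaus (j := 1) (k := 3) one_pos (by norm_num)
      (mem_zassenhaus_one _) hw
  have hcom : ∀ g : FreeProP 3 2, ⁅g, ⁅x, y⁆⁆ ∈ zassenhaus 3 (FreeProP 3 2) 3 := fun g =>
    commutator_mem_zassenhaus (j := 1) (k := 2) one_pos two_pos (mem_zassenhaus_one _)
      commutator_gen_mem
  -- The four expected generators of `gr_3` are adjoined to `D_4` in the reverse order of the normal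
  -- form. What remains is that the final group `E` contains `D_3`.
  obtain ⟨E₁, hn₁, hc₁, hD₁, hz₁, hE₁⟩ := exists_extension_of_central
    (isClosed_zassenhaus 3 (FreeProP 3 2) 4) (hcube3 _ (hcom y)) (hcen _ (hcom y))
  obtain ⟨E₂, hn₂, hc₂, hD₂, hz₂, hE₂⟩ := exists_extension_of_central hc₁
    (hD₁ (hcube3 _ (hcom x))) fun g => hD₁ (hcen _ (hcom x) g)
  obtain ⟨E₃, hn₃, hc₃, hD₃, hz₃, hE₃⟩ := exists_extension_of_central hc₂
    (hD₂ (hD₁ (hcube3 _ (hcube y)))) fun g => hD₂ (hD₁ (hcen _ (hcube y) g))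
  obtain ⟨E, hn, hc, hD, hz, hE⟩ := exists_extension_of_central hc₃
    (hD₃ (hD₂ (hD₁ (hcube3 _ (hcube x))))) fun g => hD₃ (hD₂ (hD₁ (hcen _ (hcube x) g)))
  have h4 : zassenhaus 3 (FreeProP 3 2) 4 ≤ E := hD₁.trans (hD₂.trans (hD₃.trans hD))
  have hz' : ∀ g : FreeProP 3 2, ⁅g, ⁅x, y⁆⁆ ∈ E := commutator_mem_of_gen hc fun i => by
    fin_cases i
    · exact hD (hD₃ hz₂)
    · exact hD (hD₃ (hD₂ hz₁))
  have hcenE : ∀ (w : FreeProP 3 2), (∀ g : FreeProP 3 2, ⁅g, w⁆ ∈ E) ↔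
      (QuotientGroup.mk w : FreeProP 3 2 ⧸ E) ∈ Subgroup.center _ := by
    intro w
    rw [Subgroup.mem_center_iff, QuotientGroup.forall_mk]
    refine forall_congr' fun g => ?_
    rw [← commutatorElement_eq_one_iff_mul_comm, ← QuotientGroup.eq_one_iff]
    rfl
  -- `D_2` is generated by `[x,y]` and `D_3`, and both are central modulo `E`.
  have h2cen : ∀ g : FreeProP 3 2, ∀ h ∈ zassenhaus 3 (FreeProP 3 2) 2, ⁅g, h⁆ ∈ E := by
    intro g h hh
    obtain ⟨a, -, d, hd, rfl⟩ := exists_eq_mod_zassenhaus_three hh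
    refine (hcenE _).mpr ?_ g
    rw [QuotientGroup.mk_mul, QuotientGroup.mk_pow]
    exact Subgroup.mul_mem _ (Subgroup.pow_mem _ ((hcenE _).mp hz') _)
      ((hcenE _).mp fun g => h4 (hcen d hd g))
  have hcomm2 : ∀ g h : FreeProP 3 2, ⁅g, h⁆ ∈ zassenhaus 3 (FreeProP 3 2) 2 := fun g h =>
    commutator_mem_zassenhaus (j := 1) (k := 1) one_pos one_pos (mem_zassenhaus_one _)
      (mem_zassenhaus_one _)
  have hcubeE : ∀ g : FreeProP 3 2, g ^ 3 ∈ E := cube_mem_of_gen hc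
    (fun k g h => h2cen k _ (hcomm2 h g)) (fun g h => h4 (hcube2 _ (hcomm2 h g))) fun i => by
      fin_cases i
      · exact hz
      · exact hD hz₃
  have hfE : f ∈ E := by
    refine zassenhaus_le (by norm_num) hc (fun a _ => hcubeE a) ?_ hf
    intro j k hj hk hjk a ha b hb
    obtain ⟨rfl, rfl⟩ | ⟨rfl, rfl⟩ : (j = 1 ∧ k = 2) ∨ (j = 2 ∧ k = 1) := by omega
    · exact h2cen a b hb
    · rw [← commutatorElement_inv]; exact E.inv_mem (h2cen b a ha)
  obtain ⟨a, ha, f₃, hf₃, rfl⟩ := hE f hfE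
  obtain ⟨b, hb, f₂, hf₂, rfl⟩ := hE₃ f₃ hf₃
  obtain ⟨c, hc, f₁, hf₁, rfl⟩ := hE₂ f₂ hf₂
  obtain ⟨d, hd, e, he, rfl⟩ := hE₁ f₁ hf₁
  exact ⟨a, ha, b, hb, c, hc, d, hd, e, he, rfl⟩

end Generation

end SchurSigma

namespace SchurSigma

open scoped commutatorElement

/-! ### The Magnus embedding and the dimension subgroups of the free pro-`3`-group -/

theorem exists_magnus : ∃ ψ : FreeProP 3 2 →ₜ* Magnus, ∀ i, ψ (FreeProP.gen 3 i) =
    ⟨fun j => if j = i then 1 else 0, fun _ _ => 0, fun _ _ _ => 0⟩ :=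
  FreeProP.exists_hom_of_finite Magnus.isPGroup _

/-- The Magnus map, which sends the free generators `x`, `y` to `1 + X`, `1 + Y`. -/
noncomputable def magnus : FreeProP 3 2 →ₜ* Magnus := exists_magnus.choose

theorem magnus_gen (i : Fin 2) : magnus (FreeProP.gen 3 i) =
    ⟨fun j => if j = i then 1 else 0, fun _ _ => 0, fun _ _ _ => 0⟩ :=
  exists_magnus.choose_spec i

local notation "x" => FreeProP.gen 3 (0 : Fin 2)
local notation "y" => FreeProP.gen 3 (1 : Fin 2)

theorem c1_eq_zero {f : FreeProP 3 2} (hf : f ∈ zassenhaus 3 (FreeProP 3 2) 2) (i) :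
    (magnus f).c1 i = 0 :=
  Magnus.zassenhaus_two_le (map_mem_zassenhaus magnus hf) i

theorem c2_eq_zero {f : FreeProP 3 2} (hf : f ∈ zassenhaus 3 (FreeProP 3 2) 3) (i j) :
    (magnus f).c2 i j = 0 :=
  (Magnus.zassenhaus_three_le (map_mem_zassenhaus magnus hf)).2 i j

theorem magnus_eq_one {f : FreeProP 3 2} (hf : f ∈ zassenhaus 3 (FreeProP 3 2) 4) :
    magnus f = 1 := by
  have := map_mem_zassenhaus magnus hf
  rwa [Magnus.zassenhaus_four_eq_bot, Subgroup.mem_bot] at this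

theorem natCast_zmod_three_eq_zero {a : ℕ} (ha : a < 3) (h : (a : ZMod 3) = 0) : a = 0 :=
  Nat.eq_zero_of_dvd_of_lt ((ZMod.natCast_eq_zero_iff a 3).mp h) ha

theorem zassenhaus_three_le_two : zassenhaus 3 (FreeProP 3 2) 3 ≤ zassenhaus 3 (FreeProP 3 2) 2 :=
  zassenhaus_succ_le 3 _ 2

/-- The Magnus coefficients read off the exponents of the normal form modulo 3, and the exponents
are below 3, so vanishing coefficients force trivial exponents. The criteria for `D_3` and `D_4`
follow the same pattern. -/
theorem mem_zassenhaus_two_iff {f : FreeProP 3 2} :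
    f ∈ zassenhaus 3 (FreeProP 3 2) 2 ↔ ∀ i, (magnus f).c1 i = 0 := by
  refine ⟨c1_eq_zero, fun h => ?_⟩
  obtain ⟨a, ha, b, hb, d, hd, rfl⟩ := exists_eq_mod_zassenhaus_two f
  have h0 := h 0
  have h1 := h 1
  simp only [map_mul, map_pow, Magnus.mul_c1, Magnus.pow_c1, magnus_gen, c1_eq_zero hd] at h0 h1
  simp only [if_true, zero_ne_one, one_ne_zero, if_false, mul_zero, mul_one, add_zero,
    zero_add] at h0 h1
  rw [natCast_zmod_three_eq_zero ha h0, natCast_zmod_three_eq_zero hb h1]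
  simpa using hd

theorem magnus_commutator_c2 (i j) : (magnus ⁅x, y⁆).c2 i j =
    (if i = 0 then 1 else 0) * (if j = 1 then 1 else 0) -
      (if i = 1 then 1 else 0) * (if j = 0 then 1 else 0) := by
  rw [map_commutatorElement, Magnus.commutator_c2, magnus_gen, magnus_gen]

theorem c2_pow_mul {u w : FreeProP 3 2} (hu : u ∈ zassenhaus 3 (FreeProP 3 2) 2) (n : ℕ) (i j) :
    (magnus (u ^ n * w)).c2 i j = n * (magnus u).c2 i j + (magnus w).c2 i j := by
  rw [map_mul, map_pow, Magnus.mul_c2, Magnus.pow_c2 _ (c1_eq_zero hu), Magnus.pow_c1,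
    c1_eq_zero hu]
  ring

theorem c3_pow_mul {u w : FreeProP 3 2} (hu : u ∈ zassenhaus 3 (FreeProP 3 2) 3) (n : ℕ)
    (i j k) : (magnus (u ^ n * w)).c3 i j k = n * (magnus u).c3 i j k + (magnus w).c3 i j k := by
  have h2 := zassenhaus_three_le_two hu
  rw [map_mul, map_pow, Magnus.mul_c3, Magnus.pow_c3 _ (c1_eq_zero h2) (c2_eq_zero hu),
    Magnus.pow_c1, c1_eq_zero h2, Magnus.pow_c2 _ (c1_eq_zero h2), c2_eq_zero hu]
  ring

theorem mem_zassenhaus_three_iff {f : FreeProP 3 2} :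
    f ∈ zassenhaus 3 (FreeProP 3 2) 3 ↔
      f ∈ zassenhaus 3 (FreeProP 3 2) 2 ∧ (magnus f).c2 0 1 = 0 := by
  refine ⟨fun h => ⟨zassenhaus_three_le_two h, c2_eq_zero h _ _⟩, fun ⟨hf, h⟩ => ?_⟩
  obtain ⟨a, ha, d, hd, rfl⟩ := exists_eq_mod_zassenhaus_three hf
  rw [c2_pow_mul commutator_gen_mem, magnus_commutator_c2, c2_eq_zero hd] at h
  rw [natCast_zmod_three_eq_zero ha (by simpa using h)]
  simpa using hd

theorem cube_mem_zassenhaus_three (f : FreeProP 3 2) : f ^ 3 ∈ zassenhaus 3 (FreeProP 3 2) 3 :=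
  pow_mem_zassenhaus 3 _ (by norm_num) (mem_zassenhaus_one _)

theorem commutator_mem_zassenhaus_three (f : FreeProP 3 2) {g : FreeProP 3 2}
    (hg : g ∈ zassenhaus 3 (FreeProP 3 2) 2) : ⁅f, g⁆ ∈ zassenhaus 3 (FreeProP 3 2) 3 :=
  commutator_mem_zassenhaus (j := 1) (k := 2) one_pos two_pos (mem_zassenhaus_one _) hg

/-- An arbitrary endomorphism `θ` is carried along so that one computation serves both for the
coordinates on `gr_3` (`θ` the identity) and for the action on them in `cub_endo`. -/
theorem magnus_decomposition {a b c d : ℕ} {e : FreeProP 3 2}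
    (he : e ∈ zassenhaus 3 (FreeProP 3 2) 4) (θ : FreeProP 3 2 →ₜ* FreeProP 3 2) (i j k) :
    (magnus (θ ((x ^ 3) ^ a * ((y ^ 3) ^ b * (⁅x, ⁅x, y⁆⁆ ^ c * (⁅y, ⁅x, y⁆⁆ ^ d * e)))))).c3 i j k =
      a * ((magnus (θ x)).c1 i * (magnus (θ x)).c1 j * (magnus (θ x)).c1 k) +
      b * ((magnus (θ y)).c1 i * (magnus (θ y)).c1 j * (magnus (θ y)).c1 k) +
      c * ((magnus (θ x)).c1 i * (magnus (θ ⁅x, y⁆)).c2 j k -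
        (magnus (θ ⁅x, y⁆)).c2 i j * (magnus (θ x)).c1 k) +
      d * ((magnus (θ y)).c1 i * (magnus (θ ⁅x, y⁆)).c2 j k -
        (magnus (θ ⁅x, y⁆)).c2 i j * (magnus (θ y)).c1 k) := by
  have hz : θ ⁅x, y⁆ ∈ zassenhaus 3 (FreeProP 3 2) 2 := map_mem_zassenhaus θ commutator_gen_mem
  have hθ : θ ((x ^ 3) ^ a * ((y ^ 3) ^ b * (⁅x, ⁅x, y⁆⁆ ^ c * (⁅y, ⁅x, y⁆⁆ ^ d * e)))) =
      (θ x ^ 3) ^ a * ((θ y ^ 3) ^ b * (⁅θ x, θ ⁅x, y⁆⁆ ^ c * (⁅θ y, θ ⁅x, y⁆⁆ ^ d * θ e))) := by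
    rw [← map_commutatorElement θ x ⁅x, y⁆, ← map_commutatorElement θ y ⁅x, y⁆]
    simp only [map_mul, map_pow]
  rw [hθ, c3_pow_mul (cube_mem_zassenhaus_three _), c3_pow_mul (cube_mem_zassenhaus_three _),
    c3_pow_mul (commutator_mem_zassenhaus_three _ hz),
    c3_pow_mul (commutator_mem_zassenhaus_three _ hz), magnus_eq_one (map_mem_zassenhaus θ he),
    map_pow, map_pow, Magnus.cube_c3, Magnus.cube_c3, map_commutatorElement magnus,
    map_commutatorElement magnus (θ y), Magnus.commutator_c3_left _ _ (c1_eq_zero hz),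
    Magnus.commutator_c3_left _ _ (c1_eq_zero hz), Magnus.one_c3]
  ring

theorem magnus_decomposition_id {a b c d : ℕ} {e : FreeProP 3 2}
    (he : e ∈ zassenhaus 3 (FreeProP 3 2) 4) (i j k) :
    (magnus ((x ^ 3) ^ a * ((y ^ 3) ^ b * (⁅x, ⁅x, y⁆⁆ ^ c * (⁅y, ⁅x, y⁆⁆ ^ d * e))))).c3 i j k =
      a * ((magnus x).c1 i * (magnus x).c1 j * (magnus x).c1 k) +
      b * ((magnus y).c1 i * (magnus y).c1 j * (magnus y).c1 k) +
      c * ((magnus x).c1 i * (magnus ⁅x, y⁆).c2 j k -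
        (magnus ⁅x, y⁆).c2 i j * (magnus x).c1 k) +
      d * ((magnus y).c1 i * (magnus ⁅x, y⁆).c2 j k -
        (magnus ⁅x, y⁆).c2 i j * (magnus y).c1 k) :=
  magnus_decomposition he (ContinuousMonoidHom.id _) i j k

/-- The coordinates of the symmetric tensor of degree three of an element of `D_3`. -/
noncomputable def cub (f : FreeProP 3 2) : Fin 4 → ZMod 3 :=
  ![(magnus f).c3 0 0 0, (magnus f).c3 0 0 1, (magnus f).c3 0 1 1, (magnus f).c3 1 1 1]

/-- The cubic part of `[x,[x,y]]` is `XXY - 2XYX + YXX`, a symmetric tensor because `-2 = 1` in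
`𝔽_3`; that of `[y,[x,y]]` is minus the symmetrisation of `XYY`, whence the sign. So the four
coefficients at nondecreasing indices suffice. -/
theorem cub_decomposition {a b c d : ℕ} {e : FreeProP 3 2}
    (he : e ∈ zassenhaus 3 (FreeProP 3 2) 4) :
    cub ((x ^ 3) ^ a * ((y ^ 3) ^ b * (⁅x, ⁅x, y⁆⁆ ^ c * (⁅y, ⁅x, y⁆⁆ ^ d * e)))) =
      ![(a : ZMod 3), c, -d, b] := by
  simp only [cub, magnus_decomposition_id he, magnus_gen, magnus_commutator_c2]
  simp

theorem mem_zassenhaus_four_iff {f : FreeProP 3 2} :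
    f ∈ zassenhaus 3 (FreeProP 3 2) 4 ↔ f ∈ zassenhaus 3 (FreeProP 3 2) 3 ∧ cub f = 0 := by
  refine ⟨fun h => ⟨zassenhaus_succ_le 3 _ 3 h, ?_⟩, fun ⟨hf, h⟩ => ?_⟩
  · ext i; fin_cases i <;> simp [cub, magnus_eq_one h]
  · obtain ⟨a, ha, b, hb, c, hc, d, hd, e, he, rfl⟩ := exists_eq_mod_zassenhaus_four hf
    rw [cub_decomposition he] at h
    have h0 := congrFun h 0
    have h1 := congrFun h 1
    have h2 := congrFun h 2
    have h3 := congrFun h 3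
    simp at h0 h1 h2 h3
    rw [natCast_zmod_three_eq_zero ha h0, natCast_zmod_three_eq_zero hb h3,
      natCast_zmod_three_eq_zero hc h1, natCast_zmod_three_eq_zero hd h2]
    simpa using he

theorem exists_cub_eq (v : Fin 4 → ZMod 3) : ∃ f ∈ zassenhaus 3 (FreeProP 3 2) 3, cub f = v := by
  have hz := commutator_gen_mem
  refine ⟨(x ^ 3) ^ (v 0).val * ((y ^ 3) ^ (v 3).val * (⁅x, ⁅x, y⁆⁆ ^ (v 1).val *
    (⁅y, ⁅x, y⁆⁆ ^ (-v 2).val * 1))), ?_, ?_⟩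
  · exact mul_mem (pow_mem (cube_mem_zassenhaus_three _) _) (mul_mem
      (pow_mem (cube_mem_zassenhaus_three _) _) (mul_mem
        (pow_mem (commutator_mem_zassenhaus_three _ hz) _) (mul_mem
          (pow_mem (commutator_mem_zassenhaus_three _ hz) _) (one_mem _))))
  · rw [cub_decomposition (one_mem _)]
    ext i
    fin_cases i <;> simp

theorem exists_c1_eq (v : Fin 2 → ZMod 3) : ∃ f : FreeProP 3 2, (magnus f).c1 = v := by
  refine ⟨x ^ (v 0).val * y ^ (v 1).val, ?_⟩
  ext i
  rw [map_mul, map_pow, map_pow, Magnus.mul_c1, Magnus.pow_c1, Magnus.pow_c1, magnus_gen,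
    magnus_gen]
  fin_cases i <;> simp

theorem cub_mul {f : FreeProP 3 2} (hf : f ∈ zassenhaus 3 (FreeProP 3 2) 3) (g : FreeProP 3 2) :
    cub (f * g) = cub f + cub g := by
  have := fun i j k => c3_pow_mul (w := g) hf 1 i j k
  simp only [pow_one, Nat.cast_one, one_mul] at this
  ext i
  fin_cases i <;> exact this _ _ _

theorem cub_mul_right (g : FreeProP 3 2) {f : FreeProP 3 2}
    (hf : f ∈ zassenhaus 3 (FreeProP 3 2) 3) : cub (g * f) = cub g + cub f := by
  have h1 := c1_eq_zero (zassenhaus_three_le_two hf)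
  have h2 := c2_eq_zero hf
  simp [cub, h1, h2]

theorem cub_one : cub 1 = 0 := by
  ext i; fin_cases i <;> simp [cub]

theorem cub_inv {f : FreeProP 3 2} (hf : f ∈ zassenhaus 3 (FreeProP 3 2) 3) :
    cub f⁻¹ = -cub f := by
  rw [eq_neg_iff_add_eq_zero, ← cub_mul_right _ hf, inv_mul_cancel, cub_one]

theorem cub_conj {f : FreeProP 3 2} (hf : f ∈ zassenhaus 3 (FreeProP 3 2) 3) (g : FreeProP 3 2) :
    cub (g * f * g⁻¹) = cub f := by
  have h := cub_mul ((zassenhaus_normal 3 _ 3).conj_mem f hf g) g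
  rw [inv_mul_cancel_right, cub_mul_right g hf, add_comm] at h
  exact (add_right_cancel h).symm

theorem continuous_cub : Continuous cub :=
  (continuous_of_discreteTopology (f := fun m : Magnus =>
    ![m.c3 0 0 0, m.c3 0 0 1, m.c3 0 1 1, m.c3 1 1 1])).comp magnus.continuous_toFun

/-! ### Endomorphisms of the free pro-`3`-group -/

/-- The action on symmetric tensors of degree three of the linear map
`X ↦ aX + bY`, `Y ↦ cX + dY`. -/
def cubMatrix (g : Matrix (Fin 2) (Fin 2) (ZMod 3)) : Matrix (Fin 4) (Fin 4) (ZMod 3) :=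
  let a := g 0 0
  let b := g 1 0
  let c := g 0 1
  let d := g 1 1
  !![a ^ 3, 0, 0, c ^ 3;
    a ^ 2 * b, a ^ 2 * d + 2 * a * b * c, 2 * a * c * d + b * c ^ 2, c ^ 2 * d;
    a * b ^ 2, 2 * a * b * d + b ^ 2 * c, a * d ^ 2 + 2 * b * c * d, c * d ^ 2;
    b ^ 3, 0, 0, d ^ 3]

/-- The matrix of the action of an endomorphism on `gr_1`. -/
noncomputable def endoMatrix (θ : FreeProP 3 2 →ₜ* FreeProP 3 2) :
    Matrix (Fin 2) (Fin 2) (ZMod 3) :=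
  Matrix.of fun i j => (magnus (θ (FreeProP.gen 3 j))).c1 i

theorem c1_endo (θ : FreeProP 3 2 →ₜ* FreeProP 3 2) (f : FreeProP 3 2) :
    (magnus (θ f)).c1 = (endoMatrix θ).mulVec (magnus f).c1 := by
  obtain ⟨a, ha, b, hb, d, hd, rfl⟩ := exists_eq_mod_zassenhaus_two f
  ext i
  have h1 : ∀ j, (magnus (x ^ a * (y ^ b * d))).c1 j =
      a * (if j = 0 then 1 else 0) + b * (if j = 1 then 1 else 0) := by
    intro j
    simp only [map_mul, map_pow, Magnus.mul_c1, Magnus.pow_c1, c1_eq_zero hd, magnus_gen, add_zero]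
  simp only [Matrix.mulVec, dotProduct, Fin.sum_univ_two, h1]
  simp only [map_mul, map_pow, Magnus.mul_c1,
    Magnus.pow_c1, c1_eq_zero (map_mem_zassenhaus θ hd)]
  simp [endoMatrix, mul_comm]

/-- `gr_2` is the exterior square of `gr_1`, on which a linear map acts by its determinant. -/
theorem c2_endo (θ : FreeProP 3 2 →ₜ* FreeProP 3 2) {f : FreeProP 3 2}
    (hf : f ∈ zassenhaus 3 (FreeProP 3 2) 2) :
    (magnus (θ f)).c2 0 1 = (endoMatrix θ).det * (magnus f).c2 0 1 := by
  obtain ⟨a, ha, d, hd, rfl⟩ := exists_eq_mod_zassenhaus_three hf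
  rw [map_mul, map_pow, c2_pow_mul commutator_gen_mem,
    c2_pow_mul (map_mem_zassenhaus θ commutator_gen_mem), c2_eq_zero hd,
    c2_eq_zero (map_mem_zassenhaus θ hd), map_commutatorElement, map_commutatorElement,
    Magnus.commutator_c2, magnus_commutator_c2, Matrix.det_fin_two]
  simp [endoMatrix]
  ring

theorem cub_endo (θ : FreeProP 3 2 →ₜ* FreeProP 3 2) {f : FreeProP 3 2}
    (hf : f ∈ zassenhaus 3 (FreeProP 3 2) 3) :
    cub (θ f) = (cubMatrix (endoMatrix θ)).mulVec (cub f) := by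
  obtain ⟨a, ha, b, hb, c, hc, d, hd, e, he, rfl⟩ := exists_eq_mod_zassenhaus_four hf
  rw [cub_decomposition he]
  simp only [cub, magnus_decomposition he, map_commutatorElement, Magnus.commutator_c2]
  ext i
  generalize hX0 : (magnus (θ x)).c1 0 = X₀
  generalize hX1 : (magnus (θ x)).c1 1 = X₁
  generalize hY0 : (magnus (θ y)).c1 0 = Y₀
  generalize hY1 : (magnus (θ y)).c1 1 = Y₁
  fin_cases i <;>
    simp only [Matrix.mulVec, dotProduct, Fin.sum_univ_four, cubMatrix, endoMatrix, Matrix.of_apply,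
      Matrix.cons_val, hX0, hX1, hY0, hY1, Fin.mk_zero, Fin.mk_one, Fin.reduceFinMk]
  · ring
  -- The brackets agree with the symmetric tensors in `cubMatrix` only modulo 3.
  · linear_combination (-c * X₀ * X₁ * Y₀ + d * X₀ * Y₀ * Y₁) * Magnus.three_eq_zero
  · linear_combination (-c * X₀ * X₁ * Y₁ + d * X₁ * Y₀ * Y₁) * Magnus.three_eq_zero
  · ring

end SchurSigma

namespace SchurSigma

open scoped commutatorElement

local notation "x" => FreeProP.gen 3 (0 : Fin 2)
local notation "y" => FreeProP.gen 3 (1 : Fin 2)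

/-! ### Endomorphisms with invertible linear part -/

theorem apply_eq_zero_of_mem_zassenhaus_two {p : ℕ} [Fact p.Prime] {G : Type u} [Group G]
    [TopologicalSpace G] [IsTopologicalGroup G] {f : G → ZMod p} (hf : f ∈ Z1 p G) {a : G}
    (ha : a ∈ zassenhaus p G 2) : f a = 0 := by
  let φ : G →* Multiplicative (ZMod p) :=
    { toFun := fun a => Multiplicative.ofAdd (f a)
      map_one' := by
        have := hf.2 1 1
        rw [mul_one, left_eq_add] at this
        rw [this]; rfl
      map_mul' := fun a b => by rw [hf.2]; rfl }
  have hker : ∀ a, a ∈ φ.ker ↔ f a = 0 := fun a => Iff.rfl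
  have hcl : IsClosed (φ.ker : Set G) := isClosed_singleton.preimage hf.1
  refine (hker a).mp (zassenhaus_le one_lt_two hcl (fun b _ => ?_) (fun _ _ _ _ _ b _ c _ => ?_) ha)
  · rw [MonoidHom.mem_ker, map_pow, ← ofAdd_toAdd (φ b), ← ofAdd_nsmul]
    simp
  · rw [MonoidHom.mem_ker, map_commutatorElement, commutatorElement_eq_one_iff_mul_comm, mul_comm]

theorem exists_endo (a b : FreeProP 3 2) :
    ∃ θ : FreeProP 3 2 →ₜ* FreeProP 3 2, θ x = a ∧ θ y = b := by
  obtain ⟨θ, hθ⟩ := FreeProP.exists_hom (FreeProP.isProP (p := 3) (n := 2)) ![a, b]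
  exact ⟨θ, hθ 0, hθ 1⟩

theorem exists_mulVec_eq {g : Matrix (Fin 2) (Fin 2) (ZMod 3)} (hg : g.det ≠ 0)
    (v : Fin 2 → ZMod 3) : ∃ w, g.mulVec w = v :=
  ⟨g⁻¹.mulVec v, by
    rw [Matrix.mulVec_mulVec, Matrix.mul_nonsing_inv _ (isUnit_iff_ne_zero.mpr hg),
      Matrix.one_mulVec]⟩

/-- Every element is congruent modulo `D_2` to one in the image, and homomorphisms to `𝔽_3` kill
`D_2`; the Frattini argument concludes. -/
theorem endo_surjective {θ : FreeProP 3 2 →ₜ* FreeProP 3 2} (h : (endoMatrix θ).det ≠ 0) :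
    Function.Surjective θ := by
  have hcl : IsClosed (θ.toMonoidHom.range : Set (FreeProP 3 2)) :=
    (isCompact_range θ.continuous_toFun).isClosed
  have htop : θ.toMonoidHom.range = ⊤ := by
    refine FreeProP.isProP.eq_top_of_forall_Z1 hcl fun f hf h0 => funext fun u => ?_
    obtain ⟨v, hv⟩ := exists_mulVec_eq h (magnus u).c1
    obtain ⟨w, hw⟩ := exists_c1_eq v
    have h1 : (θ w)⁻¹ * u ∈ zassenhaus 3 (FreeProP 3 2) 2 := by
      rw [mem_zassenhaus_two_iff]
      intro i
      rw [map_mul, map_inv, Magnus.mul_c1, Magnus.inv_c1, c1_endo, hw, hv, neg_add_cancel]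
    have h2 := hf.2 (θ w) ((θ w)⁻¹ * u)
    rw [mul_inv_cancel_left, h0 (θ w) ⟨w, rfl⟩, apply_eq_zero_of_mem_zassenhaus_two hf h1] at h2
    simpa using h2
  exact MonoidHom.range_eq_top.mp htop

theorem mem_zassenhaus_two_endo_iff {θ : FreeProP 3 2 →ₜ* FreeProP 3 2}
    (h : (endoMatrix θ).det ≠ 0) {f : FreeProP 3 2} :
    θ f ∈ zassenhaus 3 (FreeProP 3 2) 2 ↔ f ∈ zassenhaus 3 (FreeProP 3 2) 2 := by
  refine ⟨fun hf => ?_, map_mem_zassenhaus θ⟩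
  rw [mem_zassenhaus_two_iff] at hf ⊢
  have h0 : (endoMatrix θ).mulVec (magnus f).c1 = 0 := by
    rw [← c1_endo]; exact funext hf
  exact congrFun (Matrix.eq_zero_of_mulVec_eq_zero h h0)

theorem mem_zassenhaus_three_endo_iff {θ : FreeProP 3 2 →ₜ* FreeProP 3 2}
    (h : (endoMatrix θ).det ≠ 0) {f : FreeProP 3 2} :
    θ f ∈ zassenhaus 3 (FreeProP 3 2) 3 ↔ f ∈ zassenhaus 3 (FreeProP 3 2) 3 := by
  refine ⟨fun hf => ?_, map_mem_zassenhaus θ⟩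
  rw [mem_zassenhaus_three_iff] at hf ⊢
  have h2 := (mem_zassenhaus_two_endo_iff h).mp hf.1
  refine ⟨h2, ?_⟩
  have h3 := hf.2
  rw [c2_endo θ h2] at h3
  exact (mul_eq_zero.mp h3).resolve_left h

/-! ### The involution of the free pro-`3`-group -/

theorem exists_flip : ∃ θ : FreeProP 3 2 →ₜ* FreeProP 3 2,
    ∀ i, θ (FreeProP.gen 3 i) = (FreeProP.gen 3 i)⁻¹ :=
  FreeProP.exists_hom FreeProP.isProP _

/-- The automorphism of the free pro-`3`-group which inverts the free generators. -/
noncomputable def flip : FreeProP 3 2 →ₜ* FreeProP 3 2 := exists_flip.choose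

theorem flip_gen (i : Fin 2) : flip (FreeProP.gen 3 i) = (FreeProP.gen 3 i)⁻¹ :=
  exists_flip.choose_spec i

theorem flip_flip (f : FreeProP 3 2) : flip (flip f) = f :=
  FreeProP.hom_ext (φ := flip.comp flip) (ψ := ContinuousMonoidHom.id _)
    (fun i => by simp [flip_gen]) f

theorem endoMatrix_flip : endoMatrix flip = -1 := by
  ext i j
  rw [endoMatrix, Matrix.of_apply, flip_gen, map_inv, magnus_gen, Magnus.inv_c1]
  simp [Matrix.one_apply]

theorem cubMatrix_one : cubMatrix 1 = 1 := by decide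

theorem cubMatrix_neg_one : cubMatrix (-1) = -1 := by decide

theorem c1_flip (f : FreeProP 3 2) : (magnus (flip f)).c1 = -(magnus f).c1 := by
  rw [c1_endo, endoMatrix_flip, Matrix.neg_mulVec, Matrix.one_mulVec]

theorem cub_flip {f : FreeProP 3 2} (hf : f ∈ zassenhaus 3 (FreeProP 3 2) 3) :
    cub (flip f) = -cub f := by
  rw [cub_endo flip hf, endoMatrix_flip, cubMatrix_neg_one, Matrix.neg_mulVec, Matrix.one_mulVec]

theorem neg_sub_self_zmod_three {ι : Type*} (v : ι → ZMod 3) : -v - v = v := by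
  ext i
  simp only [Pi.sub_apply, Pi.neg_apply]
  linear_combination -v i * Magnus.three_eq_zero

/-- A source of odd elements. Where `flip` acts by `-1`, the class of `u * (flip u)⁻¹` is twice that
of `u`, that is, its negative. Hence all classes in `gr_1` and `gr_3` have odd representatives. -/
theorem flip_mul_flip_inv (u : FreeProP 3 2) :
    flip (u * (flip u)⁻¹) = (u * (flip u)⁻¹)⁻¹ := by
  rw [map_mul, map_inv, flip_flip, mul_inv_rev, inv_inv]

theorem exists_odd_c1_eq (v : Fin 2 → ZMod 3) :
    ∃ f, flip f = f⁻¹ ∧ (magnus f).c1 = v := by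
  obtain ⟨u, hu⟩ := exists_c1_eq (-v)
  refine ⟨u * (flip u)⁻¹, flip_mul_flip_inv u, ?_⟩
  rw [← neg_sub_self_zmod_three v]
  ext i
  rw [map_mul, map_inv, Magnus.mul_c1, Magnus.inv_c1, c1_flip, hu, neg_neg, sub_eq_add_neg]
  rfl

theorem exists_odd_cub_eq (v : Fin 4 → ZMod 3) :
    ∃ f ∈ zassenhaus 3 (FreeProP 3 2) 3, flip f = f⁻¹ ∧ cub f = v := by
  obtain ⟨u, hu, huv⟩ := exists_cub_eq (-v)
  have hu' := map_mem_zassenhaus flip hu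
  refine ⟨u * (flip u)⁻¹, mul_mem hu (inv_mem hu'), flip_mul_flip_inv u, ?_⟩
  rw [cub_mul hu, cub_inv hu', cub_flip hu, huv, neg_neg, ← sub_eq_add_neg,
    neg_sub_self_zmod_three]

/-! ### Presentations -/

/-- `φ` presents `H` as the quotient of the free pro-`3`-group by the subgroup between `D_3`
and `D_4` that corresponds to the subspace `W` of `gr_3`. -/
structure IsPresentation {H : Type u} [Group H] [TopologicalSpace H]
    (φ : FreeProP 3 2 →ₜ* H) (W : Submodule (ZMod 3) (Fin 4 → ZMod 3)) : Prop where
  surjective : Function.Surjective φ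
  map_eq_one_iff : ∀ f, φ f = 1 ↔ f ∈ zassenhaus 3 (FreeProP 3 2) 3 ∧ cub f ∈ W

section Presentation

variable {H : Type u} [Group H] [TopologicalSpace H] {φ : FreeProP 3 2 →ₜ* H}
  {W : Submodule (ZMod 3) (Fin 4 → ZMod 3)}
variable {H' : Type v} [Group H'] [TopologicalSpace H'] {φ' : FreeProP 3 2 →ₜ* H'}
  {W' : Submodule (ZMod 3) (Fin 4 → ZMod 3)}

theorem isClosedMap_of_freeProP [T2Space H] (φ : FreeProP 3 2 →ₜ* H) : IsClosedMap φ :=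
  φ.continuous_toFun.isClosedMap

theorem isQuotientMap_of_freeProP [T2Space H] {φ : FreeProP 3 2 →ₜ* H}
    (hφ : Function.Surjective φ) : Topology.IsQuotientMap φ :=
  (isClosedMap_of_freeProP φ).isQuotientMap φ.continuous_toFun hφ

theorem div_mem_of_map_eq (hφ : IsPresentation φ W) {f g : FreeProP 3 2} (h : φ f = φ g) :
    f * g⁻¹ ∈ zassenhaus 3 (FreeProP 3 2) 3 ∧ cub (f * g⁻¹) ∈ W := by
  rw [← hφ.map_eq_one_iff, map_mul, map_inv, h, mul_inv_cancel]

theorem c1_eq_of_map_eq (hφ : IsPresentation φ W) {f g : FreeProP 3 2} (h : φ f = φ g) :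
    (magnus f).c1 = (magnus g).c1 := by
  have h1 := c1_eq_zero (zassenhaus_three_le_two (div_mem_of_map_eq hφ h).1)
  ext i
  have := h1 i
  rwa [map_mul, map_inv, Magnus.mul_c1, Magnus.inv_c1, ← sub_eq_add_neg, sub_eq_zero] at this

theorem c2_eq_of_map_eq (hφ : IsPresentation φ W) {f g : FreeProP 3 2} (h : φ f = φ g) (i j) :
    (magnus f).c2 i j = (magnus g).c2 i j := by
  have h3 := (div_mem_of_map_eq hφ h).1
  have h2 := c2_pow_mul (w := g) (zassenhaus_three_le_two h3) 1 i j
  rwa [pow_one, inv_mul_cancel_right, c2_eq_zero h3, mul_zero, zero_add] at h2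

theorem exists_lift (hφ' : IsPresentation φ' W') [T2Space H'] (α : H →* H')
    (hα : Continuous α) (φ : FreeProP 3 2 →ₜ* H) :
    ∃ θ : FreeProP 3 2 →ₜ* FreeProP 3 2, ∀ f, φ' (θ f) = α (φ f) := by
  choose s hs using hφ'.surjective
  obtain ⟨θ, hθ⟩ := FreeProP.exists_hom (FreeProP.isProP (p := 3) (n := 2))
    fun i => s (α (φ (FreeProP.gen 3 i)))
  refine ⟨θ, FreeProP.hom_ext (φ := φ'.comp θ) (ψ := ⟨α.comp φ.toMonoidHom,
    hα.comp φ.continuous_toFun⟩) fun i => ?_⟩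
  change φ' (θ _) = α (φ _)
  rw [hθ, hs]

theorem det_ne_zero_of_lift (hφ : IsPresentation φ W) (hφ' : IsPresentation φ' W')
    {α : H →* H'} {θ : FreeProP 3 2 →ₜ* FreeProP 3 2} (hθ : ∀ f, φ' (θ f) = α (φ f))
    (hsurj : Function.Surjective α) : (endoMatrix θ).det ≠ 0 := by
  intro h0
  have hsu : ∀ v : Fin 2 → ZMod 3, ∃ w, (endoMatrix θ).mulVec w = v := by
    intro v
    obtain ⟨f, rfl⟩ := exists_c1_eq v
    obtain ⟨a, ha⟩ := hsurj (φ' f)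
    obtain ⟨g, rfl⟩ := hφ.surjective a
    refine ⟨(magnus g).c1, ?_⟩
    rw [← c1_endo]
    exact c1_eq_of_map_eq hφ' (by rw [hθ, ha])
  have := (Matrix.mulVec_surjective_iff_isUnit (A := endoMatrix θ)).mp hsu
  rw [Matrix.isUnit_iff_isUnit_det, h0] at this
  exact not_isUnit_zero this

theorem mem_iff_of_lift (hφ : IsPresentation φ W) (hφ' : IsPresentation φ' W')
    {α : H →* H'} (hα : Function.Injective α)
    {θ : FreeProP 3 2 →ₜ* FreeProP 3 2} (hθ : ∀ f, φ' (θ f) = α (φ f))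
    (w : Fin 4 → ZMod 3) : w ∈ W ↔ (cubMatrix (endoMatrix θ)).mulVec w ∈ W' := by
  obtain ⟨f, hf, rfl⟩ := exists_cub_eq w
  have hf' := map_mem_zassenhaus θ hf
  have h1 := hφ.map_eq_one_iff f
  have h2 := hφ'.map_eq_one_iff (θ f)
  rw [hθ, map_eq_one_iff α hα] at h2
  rw [← cub_endo θ hf]
  tauto

/-- Isomorphic groups have subspaces in the same orbit. -/
theorem exists_matrix_of_mulEquiv (hφ : IsPresentation φ W) (hφ' : IsPresentation φ' W')
    [T2Space H'] (e : H ≃* H') (he : Continuous e) :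
    ∃ g : Matrix (Fin 2) (Fin 2) (ZMod 3), g.det ≠ 0 ∧
      ∀ w, w ∈ W ↔ (cubMatrix g).mulVec w ∈ W' := by
  obtain ⟨θ, hθ⟩ := exists_lift hφ' e.toMonoidHom he φ
  exact ⟨endoMatrix θ, det_ne_zero_of_lift hφ hφ' hθ e.surjective,
    mem_iff_of_lift hφ hφ' e.injective hθ⟩

theorem IsPresentation.comp (hφ' : IsPresentation φ' W') {θ : FreeProP 3 2 →ₜ* FreeProP 3 2}
    (h : (endoMatrix θ).det ≠ 0) (hW : ∀ w, w ∈ W ↔ (cubMatrix (endoMatrix θ)).mulVec w ∈ W') :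
    IsPresentation (φ'.comp θ) W where
  surjective := hφ'.surjective.comp (endo_surjective h)
  map_eq_one_iff f := by
    change φ' (θ f) = 1 ↔ _
    rw [hφ'.map_eq_one_iff, mem_zassenhaus_three_endo_iff h]
    refine and_congr_right fun hf => ?_
    rw [hW, cub_endo θ hf]

/-- An endomorphism that matches the subspaces induces an isomorphism. -/
theorem exists_mulEquiv_of_endo (hφ : IsPresentation φ W) (hφ' : IsPresentation φ' W')
    [T2Space H] [T2Space H'] {θ : FreeProP 3 2 →ₜ* FreeProP 3 2} (h : (endoMatrix θ).det ≠ 0)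
    (hW : ∀ w, w ∈ W ↔ (cubMatrix (endoMatrix θ)).mulVec w ∈ W') :
    ∃ e : H ≃ₜ* H', ∀ f, e (φ f) = φ' (θ f) := by
  have hc := hφ'.comp h hW
  exact exists_equiv_of_ker_eq φ (isQuotientMap_of_freeProP hφ.surjective) (φ'.comp θ)
    (isQuotientMap_of_freeProP hc.surjective)
    fun a => (hφ.map_eq_one_iff a).trans (hc.map_eq_one_iff a).symm

/-- The columns of the matrix are realised by odd elements, which makes the endomorphism commute
with `flip`. This is why isomorphisms of the quotients can be chosen equivariant. -/
theorem exists_endo_of_matrix (g : Matrix (Fin 2) (Fin 2) (ZMod 3)) :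
    ∃ θ : FreeProP 3 2 →ₜ* FreeProP 3 2, endoMatrix θ = g ∧ ∀ f, θ (flip f) = flip (θ f) := by
  obtain ⟨a, ha, hag⟩ := exists_odd_c1_eq fun i => g i 0
  obtain ⟨b, hb, hbg⟩ := exists_odd_c1_eq fun i => g i 1
  obtain ⟨θ, hθx, hθy⟩ := exists_endo a b
  refine ⟨θ, ?_, FreeProP.hom_ext (φ := θ.comp flip) (ψ := flip.comp θ) fun i => ?_⟩
  · ext i j
    rw [endoMatrix, Matrix.of_apply]
    fin_cases j
    · exact (congrArg (fun a => (magnus a).c1 i) hθx).trans (congrFun hag i)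
    · exact (congrArg (fun a => (magnus a).c1 i) hθy).trans (congrFun hbg i)
  · change θ (flip _) = flip (θ _)
    rw [flip_gen, map_inv]
    fin_cases i
    · exact (congrArg _ hθx).trans (ha.symm.trans (congrArg _ hθx.symm))
    · exact (congrArg _ hθy).trans (hb.symm.trans (congrArg _ hθy.symm))

theorem IsPresentation.closure_eq_top (hφ : IsPresentation φ W) [DiscreteTopology H]
    {S : Subgroup H} (h : ∀ i, φ (FreeProP.gen 3 i) ∈ S) : S = ⊤ := by
  have h1 : S.comap φ.toMonoidHom = ⊤ := FreeProP.eq_top_of_gen_mem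
    ((isClosed_discrete (S : Set H)).preimage φ.continuous_toFun) h
  rw [eq_top_iff]
  rintro a -
  obtain ⟨f, rfl⟩ := hφ.surjective a
  exact (h1 ▸ Subgroup.mem_top f : f ∈ S.comap φ.toMonoidHom)

/-! ### Odd generation -/

theorem IsPresentation.exists_isOddlyGenerated (hφ : IsPresentation φ W) [DiscreteTopology H] :
    ∃ σ : MulAut H, IsOddlyGenerated σ := by
  obtain ⟨e, he⟩ := exists_mulEquiv_of_endo hφ hφ (θ := flip)
    (by rw [endoMatrix_flip]; decide) fun w => by
      rw [endoMatrix_flip, cubMatrix_neg_one, Matrix.neg_mulVec, Matrix.one_mulVec, neg_mem_iff]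
  refine ⟨e.toMulEquiv, fun a => ?_, hφ.closure_eq_top fun i => Subgroup.subset_closure ?_⟩
  · obtain ⟨f, rfl⟩ := hφ.surjective a
    change e (e (φ f)) = φ f
    rw [he, he, flip_flip]
  · change e (φ _) = (φ _)⁻¹
    rw [he, flip_gen, map_inv]

/-- Since odd elements generate `H`, their classes cannot all lie in the kernel of a nonzero
functional on `gr_1`. -/
theorem exists_odd_functional_ne_zero (hφ : IsPresentation φ W) {τ : MulAut H}
    (hτ : IsOddlyGenerated τ) {a b : ZMod 3} (hab : ¬ (a = 0 ∧ b = 0)) :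
    ∃ s, τ (φ s) = (φ s)⁻¹ ∧ a * (magnus s).c1 0 + b * (magnus s).c1 1 ≠ 0 := by
  by_contra! hcon
  let S : Subgroup (FreeProP 3 2) :=
    { carrier := {f | a * (magnus f).c1 0 + b * (magnus f).c1 1 = 0}
      one_mem' := by simp
      mul_mem' := fun {f g} hf hg => by
        simp only [Set.mem_ofPred_eq, map_mul, Magnus.mul_c1] at *
        linear_combination hf + hg
      inv_mem' := fun {f} hf => by
        simp only [Set.mem_ofPred_eq, map_inv, Magnus.inv_c1] at *
        linear_combination -hf }
  have htop : S.map φ.toMonoidHom = ⊤ := by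
    rw [eq_top_iff, ← hτ.2, Subgroup.closure_le]
    intro h hh
    obtain ⟨s, rfl⟩ := hφ.surjective h
    exact ⟨s, hcon s hh, rfl⟩
  have hall : ∀ f : FreeProP 3 2, a * (magnus f).c1 0 + b * (magnus f).c1 1 = 0 := by
    intro f
    obtain ⟨s, hs, hsf⟩ := (htop ▸ Subgroup.mem_top (φ f) : φ f ∈ S.map φ.toMonoidHom)
    have := c1_eq_of_map_eq hφ (f := s) (g := f) hsf
    rw [← this]
    exact hs
  refine hab ⟨?_, ?_⟩
  · simpa [magnus_gen] using hall x
  · simpa [magnus_gen] using hall y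

/-- After a change of generators every oddly generating involution is induced by `flip`, so all of
them can be compared inside the free group. -/
theorem exists_odd_presentation (hφ : IsPresentation φ W) [T2Space H] {τ : MulAut H}
    (hc : Continuous τ) (hτ : IsOddlyGenerated τ) :
    ∃ (ψ : FreeProP 3 2 →ₜ* H) (V : Submodule (ZMod 3) (Fin 4 → ZMod 3)),
      IsPresentation ψ V ∧ ∀ f, ψ (flip f) = τ (ψ f) := by
  obtain ⟨s, hs, hs0⟩ : ∃ s, τ (φ s) = (φ s)⁻¹ ∧ (magnus s).c1 0 ≠ 0 := by
    simpa using exists_odd_functional_ne_zero hφ hτ (a := 1) (b := 0) (by simp)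
  -- This functional is the determinant with first column the class of `s`; not vanishing at `t`
  -- means that `s` and `t` are independent in `gr_1`.
  obtain ⟨t, ht, ht0⟩ := exists_odd_functional_ne_zero hφ hτ (a := -(magnus s).c1 1)
    (b := (magnus s).c1 0) (by simp [hs0])
  obtain ⟨θ, hθx, hθy⟩ := exists_endo s t
  have hdet : (endoMatrix θ).det ≠ 0 := by
    rw [Matrix.det_fin_two]
    simp only [endoMatrix, Matrix.of_apply, hθx, hθy]
    convert ht0 using 1
    ring
  refine ⟨φ.comp θ, W.comap (cubMatrix (endoMatrix θ)).mulVecLin,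
    hφ.comp hdet fun w => Iff.rfl, ?_⟩
  refine FreeProP.hom_ext (φ := (φ.comp θ).comp flip) (ψ := ⟨τ.toMonoidHom.comp
    (φ.comp θ).toMonoidHom, hc.comp (φ.comp θ).continuous_toFun⟩) fun i => ?_
  change φ (θ (flip _)) = τ (φ (θ _))
  rw [flip_gen, map_inv, map_inv]
  fin_cases i
  · exact (congrArg (fun a => (φ a)⁻¹) hθx).trans
      (hs.symm.trans (congrArg (fun a => τ (φ a)) hθx.symm))
  · exact (congrArg (fun a => (φ a)⁻¹) hθy).trans
      (ht.symm.trans (congrArg (fun a => τ (φ a)) hθy.symm))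

/-- The oddly generating involution is unique up to isomorphism. -/
theorem exists_equivariant_mulEquiv [DiscreteTopology H] [DiscreteTopology H']
    (hφ : IsPresentation φ W) (hφ' : IsPresentation φ' W') (e : H ≃* H')
    {τ : MulAut H} {σ : MulAut H'} (hτ : IsOddlyGenerated τ) (hσ : IsOddlyGenerated σ) :
    ∃ e : H ≃* H', ∀ a, e (τ a) = σ (e a) := by
  obtain ⟨ψ, V, hψ, hψτ⟩ := exists_odd_presentation hφ continuous_of_discreteTopology hτ
  obtain ⟨ψ', V', hψ', hψσ⟩ := exists_odd_presentation hφ' continuous_of_discreteTopology hσ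
  obtain ⟨g, hg, hgV⟩ := exists_matrix_of_mulEquiv hψ hψ' e continuous_of_discreteTopology
  obtain ⟨θ, rfl, hθ⟩ := exists_endo_of_matrix g
  obtain ⟨d, hd⟩ := exists_mulEquiv_of_endo hψ hψ' hg hgV
  refine ⟨d.toMulEquiv, fun a => ?_⟩
  obtain ⟨f, rfl⟩ := hψ.surjective a
  change d (τ (ψ f)) = σ (d (ψ f))
  rw [← hψτ, hd, hd, hθ, hψσ]

/-! ### The index of the equivariant automorphisms -/

theorem index_eq_card_of_surjective {A X : Type*} [Group A] {S : Subgroup A} (δ : A → X)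
    (hδ : Function.Surjective δ) (h : ∀ a b, δ a = δ b ↔ a⁻¹ * b ∈ S) : S.index = Nat.card X := by
  refine Nat.card_eq_of_bijective
    (Quotient.lift δ fun a b hab => (h a b).mpr (QuotientGroup.leftRel_apply.mp hab)) ⟨?_, ?_⟩
  · intro q q' hqq
    induction q using Quotient.inductionOn with | _ a
    induction q' using Quotient.inductionOn with | _ b
    exact Quotient.sound (QuotientGroup.leftRel_apply.mpr ((h a b).mp hqq))
  · intro t
    obtain ⟨a, rfl⟩ := hδ t
    exact ⟨Quotient.mk _ a, rfl⟩

theorem inv_mul_mem_sigmaAut_iff {σ α β : MulAut H} :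
    α⁻¹ * β ∈ sigmaAut σ ↔ α * σ * α⁻¹ = β * σ * β⁻¹ := by
  have : α⁻¹ * β ∈ sigmaAut σ ↔ α⁻¹ * β * σ = σ * (α⁻¹ * β) :=
    ⟨fun h => MulEquiv.ext h, fun h a => DFunLike.congr_fun h a⟩
  rw [this]
  constructor
  · intro h
    calc α * σ * α⁻¹ = α * (σ * (α⁻¹ * β)) * β⁻¹ := by group
      _ = β * σ * β⁻¹ := by rw [← h]; group
  · intro h
    calc α⁻¹ * β * σ = α⁻¹ * (β * σ * β⁻¹) * β := by group
      _ = σ * (α⁻¹ * β) := by rw [← h]; group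

/-- For an involution `τ` acting by `-1` on `gr_1`, with lift `T`, an element whose defect
vanishes in `gr_2` is odd. -/
theorem odd_of_c2_eq_zero (hφ : IsPresentation φ W) {τ : MulAut H} (hτ : ∀ a, τ (τ a) = a)
    {T : FreeProP 3 2 →ₜ* FreeProP 3 2} (hT : ∀ f, φ (T f) = τ (φ f))
    (hT1 : endoMatrix T = -1) {f : FreeProP 3 2} (hf : (magnus (T f * f)).c2 0 1 = 0) :
    τ (φ f) = (φ f)⁻¹ := by
  have h3 : T f * f ∈ zassenhaus 3 (FreeProP 3 2) 3 := by
    rw [mem_zassenhaus_three_iff, mem_zassenhaus_two_iff]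
    refine ⟨fun i => ?_, hf⟩
    rw [map_mul, Magnus.mul_c1, c1_endo, hT1, Matrix.neg_mulVec, Matrix.one_mulVec, Pi.neg_apply,
      neg_add_cancel]
  -- Let `d = T f * f`. Since `T` acts by `-1` on `gr_3`, the element `T d * d` lies in `D_4`. Since
  -- `τ` is an involution, `T d * d` and `f d f⁻¹ d` have the same image in `H`. The latter has
  -- class `2 cub d`, so `cub d` lies in `W`, because 2 is invertible.
  have h4 : T (T f * f) * (T f * f) ∈ zassenhaus 3 (FreeProP 3 2) 4 := by
    rw [mem_zassenhaus_four_iff]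
    refine ⟨mul_mem (map_mem_zassenhaus T h3) h3, ?_⟩
    rw [cub_mul (map_mem_zassenhaus T h3), cub_endo T h3, hT1, cubMatrix_neg_one,
      Matrix.neg_mulVec, Matrix.one_mulVec, neg_add_cancel]
  have h5 : φ (T (T f * f) * (T f * f)) = 1 := by
    rw [hφ.map_eq_one_iff]
    exact ⟨zassenhaus_succ_le 3 _ 3 h4, by rw [(mem_zassenhaus_four_iff.mp h4).2]; exact W.zero_mem⟩
  have h6 : φ (f * (T f * f) * f⁻¹ * (T f * f)) = 1 := by
    rw [← h5]
    simp only [map_mul, map_inv, hT, hτ]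
    group
  rw [hφ.map_eq_one_iff, cub_mul ((zassenhaus_normal 3 _ 3).conj_mem _ h3 f), cub_conj h3] at h6
  have h7 : cub (T f * f) ∈ W := by
    have h8 := W.neg_mem h6.2
    rwa [neg_add, ← sub_eq_add_neg, sub_eq_add_neg, ← neg_add, neg_add',
      neg_sub_self_zmod_three] at h8
  rw [← mul_eq_one_iff_eq_inv, ← hT, ← map_mul]
  exact (hφ.map_eq_one_iff _).mpr ⟨h3, h7⟩

/-- `T` fixes the class of `[x,y]`, the determinant of `-1` being 1. So multiplying a generator by
`[x,y]ⁿ` changes its defect by `2n = -n`, and a suitable `n` makes the defect vanish. -/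
theorem magnus_gen_mul_c2 (i : Fin 2) {T : FreeProP 3 2 →ₜ* FreeProP 3 2}
    (hT1 : endoMatrix T = -1) (n : ℕ) :
    (magnus (T (FreeProP.gen 3 i * ⁅x, y⁆ ^ n) * (FreeProP.gen 3 i * ⁅x, y⁆ ^ n))).c2 0 1 =
      (magnus (T (FreeProP.gen 3 i) * FreeProP.gen 3 i)).c2 0 1 - n := by
  have hz := commutator_gen_mem
  have hTz := map_mem_zassenhaus T hz
  have h2 : (magnus (T ⁅x, y⁆)).c2 0 1 = 1 := by
    rw [c2_endo T hz, hT1, magnus_commutator_c2]; decide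
  have h1 : (magnus ⁅x, y⁆).c2 0 1 = 1 := by
    rw [magnus_commutator_c2]; decide
  rw [map_mul T, map_pow T]
  rw [map_mul magnus, map_mul magnus, map_mul magnus, map_pow magnus, map_pow magnus]
  rw [map_mul magnus]
  simp only [Magnus.mul_c2, Magnus.mul_c1, Magnus.pow_c1, Magnus.pow_c2 _ (c1_eq_zero hz),
    Magnus.pow_c2 _ (c1_eq_zero hTz), c1_eq_zero hz, c1_eq_zero hTz, h1, h2]
  linear_combination (n : ZMod 3) * Magnus.three_eq_zero

theorem exists_shift (s t : ZMod 3) : ∃ θ : FreeProP 3 2 →ₜ* FreeProP 3 2,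
    θ x = x * ⁅x, y⁆ ^ s.val ∧ θ y = y * ⁅x, y⁆ ^ t.val ∧ endoMatrix θ = 1 := by
  obtain ⟨θ, hθx, hθy⟩ := exists_endo (x * ⁅x, y⁆ ^ s.val) (y * ⁅x, y⁆ ^ t.val)
  refine ⟨θ, hθx, hθy, ?_⟩
  have hgen : ∀ (i j : Fin 2) (n : ℕ),
      (magnus (FreeProP.gen 3 j * ⁅x, y⁆ ^ n)).c1 i = if i = j then 1 else 0 := by
    intro i j n
    rw [map_mul, map_pow, Magnus.mul_c1, Magnus.pow_c1, c1_eq_zero commutator_gen_mem, magnus_gen]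
    simp
  ext i j
  rw [endoMatrix, Matrix.of_apply, Matrix.one_apply]
  fin_cases j
  · exact (congrArg (fun a => (magnus a).c1 i) hθx).trans (hgen i 0 _)
  · exact (congrArg (fun a => (magnus a).c1 i) hθy).trans (hgen i 1 _)

/-- The matrix `-1` is central, so all conjugates of `σ` act by `-1` on `gr_1`. -/
theorem endoMatrix_of_conj (hφ : IsPresentation φ W) [DiscreteTopology H] {σ : MulAut H}
    (hσ : ∀ f, φ (flip f) = σ (φ f)) (α : MulAut H) {T : FreeProP 3 2 →ₜ* FreeProP 3 2}
    (hT : ∀ f, φ (T f) = (α * σ * α⁻¹) (φ f)) : endoMatrix T = -1 := by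
  obtain ⟨θ, hθ⟩ := exists_lift hφ α.toMonoidHom continuous_of_discreteTopology φ
  have hdet := det_ne_zero_of_lift hφ hφ hθ α.surjective
  have hθ' : ∀ f, φ (θ f) = α (φ f) := hθ
  have key : ∀ v, (endoMatrix T).mulVec v = (-1 : Matrix (Fin 2) (Fin 2) (ZMod 3)).mulVec v := by
    intro v
    obtain ⟨w, rfl⟩ := exists_mulVec_eq hdet v
    obtain ⟨f, rfl⟩ := exists_c1_eq w
    rw [← c1_endo, ← c1_endo, Matrix.neg_mulVec, Matrix.one_mulVec, ← neg_eq_iff_eq_neg]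
    have h1 : φ (T (θ f)) = φ (θ (flip f)) := by
      rw [hT, hθ', hθ', hσ]
      simp [MulAut.mul_apply]
    rw [c1_eq_of_map_eq hφ h1, c1_endo, c1_flip, Matrix.mulVec_neg, neg_neg, c1_endo]
  exact Matrix.mulVec_injective (funext key)

/-- The automorphisms that commute with an oddly generating involution have index `9`. -/
theorem index_sigmaAut (hφ₀ : IsPresentation φ W) [DiscreteTopology H] {σ : MulAut H}
    (hσ₀ : IsOddlyGenerated σ) : (sigmaAut σ).index = 3 ^ 2 := by
  obtain ⟨φ, W, hφ, hσ⟩ := exists_odd_presentation hφ₀ continuous_of_discreteTopology hσ₀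
  have hlift : ∀ τ : MulAut H, ∃ T : FreeProP 3 2 →ₜ* FreeProP 3 2, ∀ f, φ (T f) = τ (φ f) :=
    fun τ => exists_lift hφ τ.toMonoidHom continuous_of_discreteTopology φ
  choose T hT using hlift
  -- `D τ` records the classes in `gr_2` of `τ(x)x` and `τ(y)y`. Cosets of the centralizer of `σ`
  -- correspond to conjugates of `σ`; on these, `D` is shown to be injective with all nine values.
  let D : MulAut H → ZMod 3 × ZMod 3 := fun τ =>
    ((magnus (T τ x * x)).c2 0 1, (magnus (T τ y * y)).c2 0 1)
  have hinv : ∀ α a, (α * σ * α⁻¹ : MulAut H) ((α * σ * α⁻¹ : MulAut H) a) = a := by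
    intro α a
    simp [MulAut.mul_apply, hσ₀.1]
  have hmat : ∀ α : MulAut H, endoMatrix (T (α * σ * α⁻¹)) = -1 := fun α =>
    endoMatrix_of_conj hφ hσ α (hT _)
  have hodd : ∀ (α : MulAut H) (i : Fin 2),
      (α * σ * α⁻¹) (φ (FreeProP.gen 3 i * ⁅x, y⁆ ^
        ((magnus (T (α * σ * α⁻¹) (FreeProP.gen 3 i) * FreeProP.gen 3 i)).c2 0 1).val)) =
      (φ (FreeProP.gen 3 i * ⁅x, y⁆ ^
        ((magnus (T (α * σ * α⁻¹) (FreeProP.gen 3 i) * FreeProP.gen 3 i)).c2 0 1).val))⁻¹ := by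
    intro α i
    refine odd_of_c2_eq_zero hφ (hinv α) (hT _) (hmat α) ?_
    rw [magnus_gen_mul_c2 i (hmat α), ZMod.natCast_zmod_val, sub_self]
  have hcard : Nat.card (ZMod 3 × ZMod 3) = 3 ^ 2 := by rw [Nat.card_prod, Nat.card_zmod]; rfl
  rw [← hcard]
  refine index_eq_card_of_surjective (fun α => D (α * σ * α⁻¹)) ?_ ?_
  · rintro ⟨s, t⟩
    -- Conjugation by the automorphism induced by `x ↦ x[x,y]^s`, `y ↦ y[x,y]^t` makes these two
    -- images odd, so the defects of `x` and `y` become `s` and `t`.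
    obtain ⟨θ, hθx, hθy, hθ⟩ := exists_shift s t
    obtain ⟨e, he⟩ := exists_mulEquiv_of_endo hφ hφ (θ := θ) (by rw [hθ]; decide) fun w => by
      rw [hθ, cubMatrix_one, Matrix.one_mulVec]
    let α : MulAut H := e.toMulEquiv
    have hval : ∀ (i : Fin 2) (n : ℕ), θ (FreeProP.gen 3 i) = FreeProP.gen 3 i * ⁅x, y⁆ ^ n →
        (magnus (T (α * σ * α⁻¹) (FreeProP.gen 3 i) * FreeProP.gen 3 i)).c2 0 1 = n := by
      intro i n hn
      rw [← sub_eq_zero, ← magnus_gen_mul_c2 i (hmat α)]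
      have h1 : φ (T (α * σ * α⁻¹) (FreeProP.gen 3 i * ⁅x, y⁆ ^ n) *
          (FreeProP.gen 3 i * ⁅x, y⁆ ^ n)) = φ 1 := by
        rw [map_mul, hT, ← hn, ← he, map_one]
        change α (σ (α⁻¹ (α _))) * _ = 1
        rw [MulAut.inv_apply_self, ← hσ, flip_gen, map_inv, map_inv]
        exact inv_mul_cancel _
      rw [c2_eq_of_map_eq hφ h1, map_one, Magnus.one_c2]
    refine ⟨α, Prod.ext ?_ ?_⟩
    · exact (hval 0 _ hθx).trans (ZMod.natCast_zmod_val s)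
    · exact (hval 1 _ hθy).trans (ZMod.natCast_zmod_val t)
  · intro α β
    rw [inv_mul_mem_sigmaAut_iff]
    refine ⟨fun h => ?_, fun h => by rw [h]⟩
    -- If the defects agree, the same corrected generators are odd for both conjugates, which
    -- therefore coincide.
    obtain ⟨θ, hθx, hθy, hθ⟩ := exists_shift (D (α * σ * α⁻¹)).1 (D (α * σ * α⁻¹)).2
    have hc := hφ.comp (W := W) (θ := θ) (by rw [hθ]; decide) fun w => by
      rw [hθ, cubMatrix_one, Matrix.one_mulVec]
    have hgen : ∀ i, (α * σ * α⁻¹) (φ (θ (FreeProP.gen 3 i))) =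
        (β * σ * β⁻¹) (φ (θ (FreeProP.gen 3 i))) := by
      intro i
      fin_cases i
      · have h1 := hodd α 0
        have h2 := hodd β 0
        have h3 : (magnus (T (α * σ * α⁻¹) x * x)).c2 0 1 =
          (magnus (T (β * σ * β⁻¹) x * x)).c2 0 1 := congrArg Prod.fst h
        rw [← h3] at h2
        rw [← hθx] at h1 h2
        exact h1.trans h2.symm
      · have h1 := hodd α 1
        have h2 := hodd β 1
        have h3 : (magnus (T (α * σ * α⁻¹) y * y)).c2 0 1 =
          (magnus (T (β * σ * β⁻¹) y * y)).c2 0 1 := congrArg Prod.snd h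
        rw [← h3] at h2
        rw [← hθy] at h1 h2
        exact h1.trans h2.symm
    ext a
    obtain ⟨f, rfl⟩ := hc.surjective a
    let A : H →ₜ* H := ⟨(α * σ * α⁻¹).toMonoidHom, continuous_of_discreteTopology⟩
    let B : H →ₜ* H := ⟨(β * σ * β⁻¹).toMonoidHom, continuous_of_discreteTopology⟩
    exact FreeProP.hom_ext (φ := A.comp (φ.comp θ)) (ψ := B.comp (φ.comp θ)) hgen f

end Presentation

end SchurSigma

namespace SchurSigma

open scoped commutatorElement

local notation "x" => FreeProP.gen 3 (0 : Fin 2)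
local notation "y" => FreeProP.gen 3 (1 : Fin 2)

/-! ### Dimensions of the graded pieces -/

theorem relIndex_eq_card {G A : Type*} [Group G] [AddGroup A] {D' D : Subgroup G} (f : G → A)
    (hmul : ∀ a ∈ D, ∀ b ∈ D, f (a * b) = f a + f b) (hsurj : ∀ t, ∃ a ∈ D, f a = t)
    (hker : ∀ a ∈ D, f a = 0 ↔ a ∈ D') : D'.relIndex D = Nat.card A := by
  refine index_eq_card_of_surjective (fun a : D => f a) (fun t => ?_) fun a b => ?_
  · obtain ⟨a, ha, rfl⟩ := hsurj t
    exact ⟨⟨a, ha⟩, rfl⟩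
  · rw [Subgroup.mem_subgroupOf, ← hker _ (a⁻¹ * b).2]
    have h := hmul a a.2 _ (a⁻¹ * b).2
    rw [← Subgroup.coe_mul, mul_inv_cancel_left] at h
    rw [h, left_eq_add]

theorem natCard_quotient (W : Submodule (ZMod 3) (Fin 4 → ZMod 3)) :
    Nat.card ((Fin 4 → ZMod 3) ⧸ W) = 3 ^ (4 - Module.finrank (ZMod 3) W) := by
  have h := W.finrank_quotient_add_finrank
  rw [Module.finrank_fin_fun] at h
  rw [Module.natCard_eq_pow_finrank (K := ZMod 3), Nat.card_zmod]
  congr 1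
  omega

theorem relIndex_two_one {D : Subgroup (FreeProP 3 2)}
    (hD : ∀ f, f ∈ D ↔ f ∈ zassenhaus 3 (FreeProP 3 2) 2) :
    D.relIndex (zassenhaus 3 (FreeProP 3 2) 1) = 3 ^ 2 := by
  rw [relIndex_eq_card (fun f => (magnus f).c1) (fun a _ b _ => by rw [map_mul]; rfl)
    (fun t => ?_) fun a _ => ?_]
  · simp
  · obtain ⟨f, hf⟩ := exists_c1_eq t
    exact ⟨f, mem_zassenhaus_one _, hf⟩
  · rw [hD, mem_zassenhaus_two_iff]
    exact funext_iff

theorem relIndex_three_two {D : Subgroup (FreeProP 3 2)}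
    (hD : ∀ f, f ∈ D ↔ f ∈ zassenhaus 3 (FreeProP 3 2) 3) :
    D.relIndex (zassenhaus 3 (FreeProP 3 2) 2) = 3 ^ 1 := by
  rw [relIndex_eq_card (fun f => (magnus f).c2 0 1) (fun a ha b _ => ?_)
    (fun t => ?_) fun a ha => ?_]
  · simp
  · have := c2_pow_mul (w := b) ha 1 0 1
    simpa using this
  · refine ⟨⁅x, y⁆ ^ t.val, pow_mem commutator_gen_mem _, ?_⟩
    have := c2_pow_mul (w := 1) commutator_gen_mem t.val 0 1
    rw [mul_one, magnus_commutator_c2] at this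
    simpa using this
  · rw [hD, mem_zassenhaus_three_iff, and_iff_right ha]

section

variable {H : Type u} [Group H] [TopologicalSpace H] [IsTopologicalGroup H] [T2Space H]
  {φ : FreeProP 3 2 →ₜ* H} {W : Submodule (ZMod 3) (Fin 4 → ZMod 3)}

theorem IsPresentation.mem_zassenhaus_iff (hφ : IsPresentation φ W) {i : ℕ} (hi : i ≤ 3)
    {f : FreeProP 3 2} :
    φ f ∈ zassenhaus 3 H i ↔ f ∈ zassenhaus 3 (FreeProP 3 2) i := by
  refine ⟨fun h => ?_, map_mem_zassenhaus φ⟩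
  obtain ⟨g, hg, hgf⟩ := exists_mem_zassenhaus_map_eq φ hφ.surjective (isClosedMap_of_freeProP φ) h
  have h1 := zassenhaus_antitone 3 _ hi (div_mem_of_map_eq hφ hgf.symm).1
  simpa using mul_mem h1 hg

theorem IsPresentation.zassenhaus_four (hφ : IsPresentation φ W) : zassenhaus 3 H 4 = ⊥ := by
  rw [eq_bot_iff]
  intro h hh
  obtain ⟨g, hg, rfl⟩ :=
    exists_mem_zassenhaus_map_eq φ hφ.surjective (isClosedMap_of_freeProP φ) hh
  rw [mem_zassenhaus_four_iff] at hg
  exact (hφ.map_eq_one_iff g).mpr ⟨hg.1, by rw [hg.2]; exact W.zero_mem⟩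

theorem IsPresentation.grDim_one (hφ : IsPresentation φ W) : grDim 3 H 1 = 2 := by
  apply grDim_eq_of_relIndex
  rw [← relIndex_comap_zassenhaus φ hφ.surjective (isClosedMap_of_freeProP φ)]
  exact relIndex_two_one fun f => hφ.mem_zassenhaus_iff (i := 2) (by norm_num)

theorem IsPresentation.grDim_two (hφ : IsPresentation φ W) : grDim 3 H 2 = 1 := by
  apply grDim_eq_of_relIndex
  rw [← relIndex_comap_zassenhaus φ hφ.surjective (isClosedMap_of_freeProP φ)]
  exact relIndex_three_two fun f => hφ.mem_zassenhaus_iff (i := 3) (by norm_num)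

theorem IsPresentation.grDim_three (hφ : IsPresentation φ W) :
    grDim 3 H 3 = 4 - Module.finrank (ZMod 3) W := by
  apply grDim_eq_of_relIndex
  rw [← relIndex_comap_zassenhaus φ hφ.surjective (isClosedMap_of_freeProP φ),
    ← natCard_quotient]
  refine relIndex_eq_card (fun f => Submodule.Quotient.mk (p := W) (cub f)) (fun a ha b _ => ?_)
    (fun t => ?_) fun a ha => ?_
  · rw [cub_mul ha]; rfl
  · obtain ⟨w, rfl⟩ := Submodule.Quotient.mk_surjective W t
    obtain ⟨f, hf, rfl⟩ := exists_cub_eq w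
    exact ⟨f, hf, rfl⟩
  · rw [Submodule.Quotient.mk_eq_zero]
    change _ ↔ φ a ∈ zassenhaus 3 H 4
    rw [hφ.zassenhaus_four, Subgroup.mem_bot, hφ.map_eq_one_iff, and_iff_right ha]

end

/-! ### Generators -/

section Generators

variable {p : ℕ} [Fact p.Prime] {G : Type u} [Group G] [TopologicalSpace G] [IsTopologicalGroup G]

theorem exists_linearMap_gr_one {f : G → ZMod p} (hf : f ∈ Z1 p G) :
    ∃ l : Gr p G 1 →ₗ[ZMod p] ZMod p, ∀ a, l (Gr.mk p G a (mem_zassenhaus_one a)) = f a := by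
  let φ : zassenhaus p G 1 →* Multiplicative (ZMod p) :=
    MonoidHom.mk' (fun a => Multiplicative.ofAdd (f a)) fun a b => by
      rw [Subgroup.coe_mul, hf.2]; rfl
  have hn : ((zassenhaus p G (1 + 1)).subgroupOf (zassenhaus p G 1)).Normal :=
    (zassenhaus_normal p G (1 + 1)).subgroupOf _
  let ψ : Gr p G 1 →+ ZMod p := MonoidHom.toAdditiveLeft
    (QuotientGroup.lift ((zassenhaus p G (1 + 1)).subgroupOf (zassenhaus p G 1)) φ fun a ha =>
      apply_eq_zero_of_mem_zassenhaus_two hf (Subgroup.mem_subgroupOf.mp ha))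
  exact ⟨ψ.toZModLinearMap p, fun a => rfl⟩

theorem Gr.exists_mk (t : Gr p G 1) : ∃ a, Gr.mk p G a (mem_zassenhaus_one a) = t := by
  induction t using Additive.rec with | _ t
  induction t using QuotientGroup.induction_on with | _ a
  exact ⟨a, rfl⟩

/-- Homomorphisms to `𝔽_p` factor through `gr_1`, so lifts of a basis of `gr_1` detect them and
generate by the Frattini argument. -/
theorem exists_generators {n : ℕ} (h : Module.finrank (ZMod p) (Gr p G 1) = n) (hn : n ≠ 0) :
    ∃ a : Fin n → G, ∀ f ∈ Z1 p G, (∀ i, f (a i) = 0) → f = 0 := by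
  have : Module.Finite (ZMod p) (Gr p G 1) := Module.finite_of_finrank_pos (by omega)
  let b := Module.finBasisOfFinrankEq (ZMod p) (Gr p G 1) h
  choose a ha using fun i => Gr.exists_mk (b i)
  refine ⟨a, fun f hf h0 => ?_⟩
  obtain ⟨l, hl⟩ := exists_linearMap_gr_one hf
  have : l = 0 := b.ext fun i => by rw [← ha, hl, h0, LinearMap.zero_apply]
  funext g
  rw [← hl, this]
  rfl

theorem exists_surjective_of_generators {n : ℕ} (hG : IsProP p G) (a : Fin n → G)
    (ha : ∀ f ∈ Z1 p G, (∀ i, f (a i) = 0) → f = 0) :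
    ∃ φ : FreeProP p n →ₜ* G, (∀ i, φ (FreeProP.gen p i) = a i) ∧ Function.Surjective φ := by
  have := hG.t2Space
  obtain ⟨φ, hφ⟩ := FreeProP.exists_hom hG a
  refine ⟨φ, hφ, ?_⟩
  refine (MonoidHom.range_eq_top (f := φ.toMonoidHom)).mp ?_
  refine hG.eq_top_of_forall_Z1 (isCompact_range φ.continuous_toFun).isClosed fun f hf h0 =>
    ha f hf fun i => h0 _ ⟨_, hφ i⟩

end Generators

/-! ### Relation spaces -/

section Relations

variable {G : Type u} [Group G] [TopologicalSpace G]

/-- The image in `gr_3` of the kernel of a homomorphism with kernel in `D_3`. -/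
noncomputable def relationSpace (φ : FreeProP 3 2 →ₜ* G) :
    Submodule (ZMod 3) (Fin 4 → ZMod 3) :=
  Submodule.span (ZMod 3) (cub '' {f | φ f = 1})

/-- The span adds nothing, because an additive subgroup of an `𝔽_3`-space is a subspace. -/
theorem mem_relationSpace_iff {φ : FreeProP 3 2 →ₜ* G}
    (hφ : ∀ f, φ f = 1 → f ∈ zassenhaus 3 (FreeProP 3 2) 3) {w : Fin 4 → ZMod 3} :
    w ∈ relationSpace φ ↔ ∃ f, φ f = 1 ∧ cub f = w := by
  let A : AddSubgroup (Fin 4 → ZMod 3) :=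
    { carrier := {w | ∃ f, φ f = 1 ∧ cub f = w}
      zero_mem' := ⟨1, map_one φ, cub_one⟩
      add_mem' := by
        rintro _ _ ⟨f, hf, rfl⟩ ⟨g, hg, rfl⟩
        exact ⟨f * g, by rw [map_mul, hf, hg, one_mul], cub_mul (hφ f hf) g⟩
      neg_mem' := by
        rintro _ ⟨f, hf, rfl⟩
        exact ⟨f⁻¹, by rw [map_inv, hf, inv_one], cub_inv (hφ f hf)⟩ }
  refine ⟨fun h => ?_, fun ⟨f, hf, hw⟩ => Submodule.subset_span ⟨f, hf, hw⟩⟩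
  have h1 : relationSpace φ ≤ AddSubgroup.toZModSubmodule 3 A := by
    rw [relationSpace, Submodule.span_le]
    rintro _ ⟨f, hf, rfl⟩
    exact ⟨f, hf, rfl⟩
  exact h1 h

/-- The preimage of `D_4(G)` is the product of the kernel with `D_4` of the free group. So
`G/D_4(G)` depends only on the relation space. -/
theorem map_mem_zassenhaus_four_iff [IsTopologicalGroup G] [T2Space G] {φ : FreeProP 3 2 →ₜ* G}
    (hs : Function.Surjective φ)
    (hφ : ∀ f, φ f = 1 → f ∈ zassenhaus 3 (FreeProP 3 2) 3) {f : FreeProP 3 2} :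
    φ f ∈ zassenhaus 3 G 4 ↔ f ∈ zassenhaus 3 (FreeProP 3 2) 3 ∧ cub f ∈ relationSpace φ := by
  constructor
  · intro h
    obtain ⟨g, hg, hgf⟩ := exists_mem_zassenhaus_map_eq φ hs (isClosedMap_of_freeProP φ) h
    have h1 : φ (g⁻¹ * f) = 1 := by rw [map_mul, map_inv, hgf, inv_mul_cancel]
    rw [mem_zassenhaus_four_iff] at hg
    have h2 := hφ _ h1
    have h3 : f = g * (g⁻¹ * f) := by group
    refine ⟨h3 ▸ mul_mem hg.1 h2, (mem_relationSpace_iff hφ).mpr ⟨_, h1, ?_⟩⟩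
    conv_rhs => rw [h3, cub_mul hg.1, hg.2, zero_add]
  · rintro ⟨h, hw⟩
    obtain ⟨g, hg, hgf⟩ := (mem_relationSpace_iff hφ).mp hw
    have h1 : f * g⁻¹ ∈ zassenhaus 3 (FreeProP 3 2) 4 := by
      rw [mem_zassenhaus_four_iff]
      refine ⟨mul_mem h (inv_mem (hφ g hg)), ?_⟩
      rw [cub_mul h, cub_inv (hφ g hg), hgf, add_neg_cancel]
    have h2 := map_mem_zassenhaus φ h1
    rwa [map_mul, map_inv, hg, inv_one, mul_one] at h2

theorem isPresentation_relationSpace [IsTopologicalGroup G] [T2Space G] {φ : FreeProP 3 2 →ₜ* G}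
    (hs : Function.Surjective φ) (hφ : ∀ f, φ f = 1 → f ∈ zassenhaus 3 (FreeProP 3 2) 3)
    (h4 : zassenhaus 3 G 4 = ⊥) : IsPresentation φ (relationSpace φ) where
  surjective := hs
  map_eq_one_iff f := by
    rw [← map_mem_zassenhaus_four_iff hs hφ, h4, Subgroup.mem_bot]

/-- The quotient map `G → G / D_4(G)`. -/
def mkFour (G : Type u) [Group G] [TopologicalSpace G] [IsTopologicalGroup G] :
    G →ₜ* G ⧸ zassenhaus 3 G 4 :=
  ⟨QuotientGroup.mk' _, QuotientGroup.continuous_mk⟩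

variable {H : Type v} [Group H] [TopologicalSpace H] [DiscreteTopology H]

theorem IsPresentation.nonempty_equiv_quotient [IsTopologicalGroup G] [T2Space G]
    {φ : FreeProP 3 2 →ₜ* G}
    (hs : Function.Surjective φ) (hφ : ∀ f, φ f = 1 → f ∈ zassenhaus 3 (FreeProP 3 2) 3)
    {ψ : FreeProP 3 2 →ₜ* H} (hψ : IsPresentation ψ (relationSpace φ)) :
    Nonempty (H ≃ₜ* G ⧸ zassenhaus 3 G 4) := by
  obtain ⟨e, -⟩ := exists_equiv_of_ker_eq ψ (isQuotientMap_of_freeProP hψ.surjective)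
    ((mkFour G).comp φ)
    ((QuotientGroup.isQuotientMap_mk (N := zassenhaus 3 G 4)).comp
      (isQuotientMap_of_freeProP hs)) fun a => by
      rw [hψ.map_eq_one_iff, ← map_mem_zassenhaus_four_iff hs hφ]
      exact (QuotientGroup.eq_one_iff _).symm
  exact ⟨e⟩

theorem exists_isPresentation_of_equiv_quotient [IsTopologicalGroup G] [T2Space G]
    {φ : FreeProP 3 2 →ₜ* G}
    (hs : Function.Surjective φ) (hφ : ∀ f, φ f = 1 → f ∈ zassenhaus 3 (FreeProP 3 2) 3)
    (e : H ≃ₜ* G ⧸ zassenhaus 3 G 4) :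
    ∃ ψ : FreeProP 3 2 →ₜ* H, IsPresentation ψ (relationSpace φ) := by
  let E : G ⧸ zassenhaus 3 G 4 →ₜ* H := ⟨e.symm.toMulEquiv.toMonoidHom, e.symm.continuous⟩
  refine ⟨(E.comp (mkFour G)).comp φ, ?_, fun f => ?_⟩
  · exact e.symm.surjective.comp ((QuotientGroup.mk_surjective (s := zassenhaus 3 G 4)).comp hs)
  · rw [← map_mem_zassenhaus_four_iff hs hφ]
    change e.symm (QuotientGroup.mk (φ f)) = 1 ↔ _
    rw [EmbeddingLike.map_eq_one_iff, QuotientGroup.eq_one_iff]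

theorem isProP_of_finite {p : ℕ} [Fact p.Prime] [Finite H] (hH : IsPGroup p H) : IsProP p H where
  isTopologicalGroup := inferInstance
  compact := inferInstance
  totallyDisconnected := inferInstance
  isPGroup_quotient _ := hH.to_quotient _

theorem le_of_relIndex_eq {A : Type*} [Group A] {D' Q D : Subgroup A} (h₁ : D' ≤ Q) (h₂ : Q ≤ D)
    (h : D'.relIndex D = Q.relIndex D) (h0 : Q.relIndex D ≠ 0) : Q ≤ D' := by
  have := Subgroup.relIndex_mul_relIndex D' Q D h₁ h₂
  rw [h] at this
  exact Subgroup.relIndex_eq_one.mp (Nat.eq_of_mul_eq_mul_right (Nat.pos_of_ne_zero h0)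
    (by rw [this, one_mul]))

/-- The preimages of `D_2(H)` and `D_3(H)` contain the corresponding terms of the free group and
have the same indices by the hypotheses on dimensions; so they are equal, and the kernel lies in
`D_3`. -/
theorem exists_isPresentation_of_grDim [Finite H] (hH : IsPGroup 3 H) (h1 : grDim 3 H 1 = 2)
    (h2 : grDim 3 H 2 = 1) (h4 : zassenhaus 3 H 4 = ⊥) :
    ∃ (φ : FreeProP 3 2 →ₜ* H) (W : Submodule (ZMod 3) (Fin 4 → ZMod 3)), IsPresentation φ W := by
  obtain ⟨a, ha⟩ := exists_generators h1 two_ne_zero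
  obtain ⟨φ, -, hs⟩ := exists_surjective_of_generators (isProP_of_finite hH) a ha
  have hle : ∀ i, zassenhaus 3 (FreeProP 3 2) i ≤ (zassenhaus 3 H i).comap φ.toMonoidHom :=
    fun i f hf => map_mem_zassenhaus φ hf
  have hidx1 := relIndex_of_grDim two_ne_zero h1
  rw [← relIndex_comap_zassenhaus φ hs (isClosedMap_of_freeProP φ)] at hidx1
  have hidx2 := relIndex_of_grDim one_ne_zero h2
  rw [← relIndex_comap_zassenhaus φ hs (isClosedMap_of_freeProP φ)] at hidx2
  have hle2 : (zassenhaus 3 H 2).comap φ.toMonoidHom ≤ zassenhaus 3 (FreeProP 3 2) 2 := by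
    refine le_of_relIndex_eq (hle 2) (fun f _ => mem_zassenhaus_one f) ?_ (by rw [hidx1]; norm_num)
    rw [hidx1, relIndex_two_one fun f => Iff.rfl]
  have hle3 : (zassenhaus 3 H 3).comap φ.toMonoidHom ≤ zassenhaus 3 (FreeProP 3 2) 3 := by
    refine le_of_relIndex_eq (hle 3) (le_trans (Subgroup.comap_mono (zassenhaus_succ_le 3 H 2))
      hle2) ?_ (by rw [hidx2]; norm_num)
    rw [hidx2, relIndex_three_two fun f => Iff.rfl]
  refine ⟨φ, relationSpace φ, isPresentation_relationSpace hs (fun f hf => hle3 ?_) h4⟩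
  rw [Subgroup.mem_comap]
  exact hf ▸ Subgroup.one_mem _

end Relations

/-! ### The groups attached to subspaces of `gr_3` -/

section Quot

variable (W : Submodule (ZMod 3) (Fin 4 → ZMod 3))

/-- The subgroup between `D_3` and `D_4` attached to a subspace of `gr_3`. -/
noncomputable def cubSubgroup : Subgroup (FreeProP 3 2) where
  carrier := {f | f ∈ zassenhaus 3 (FreeProP 3 2) 3 ∧ cub f ∈ W}
  one_mem' := ⟨one_mem _, by rw [cub_one]; exact W.zero_mem⟩
  mul_mem' := fun ha hb => ⟨mul_mem ha.1 hb.1, by rw [cub_mul ha.1]; exact W.add_mem ha.2 hb.2⟩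
  inv_mem' := fun ha => ⟨inv_mem ha.1, by rw [cub_inv ha.1]; exact W.neg_mem ha.2⟩

theorem mem_cubSubgroup {f : FreeProP 3 2} :
    f ∈ cubSubgroup W ↔ f ∈ zassenhaus 3 (FreeProP 3 2) 3 ∧ cub f ∈ W := Iff.rfl

instance cubSubgroup_normal : (cubSubgroup W).Normal :=
  ⟨fun f hf g => ⟨(zassenhaus_normal 3 _ 3).conj_mem f hf.1 g, by
    rw [cub_conj hf.1]; exact hf.2⟩⟩

theorem isOpen_cubSubgroup : IsOpen (cubSubgroup W : Set (FreeProP 3 2)) := by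
  refine Subgroup.isOpen_mono (H₁ := magnus.toMonoidHom.ker) (fun f hf => ?_)
    ((isOpen_discrete {1}).preimage magnus.continuous_toFun)
  have h : magnus f = 1 := hf
  have h2 : f ∈ zassenhaus 3 (FreeProP 3 2) 3 := by
    rw [mem_zassenhaus_three_iff, mem_zassenhaus_two_iff, h]
    exact ⟨fun _ => rfl, rfl⟩
  refine ⟨h2, ?_⟩
  have h3 : cub f = 0 := by ext i; fin_cases i <;> simp [cub, h]
  rw [h3]
  exact W.zero_mem

theorem isClosed_cubSubgroup : IsClosed (cubSubgroup W : Set (FreeProP 3 2)) :=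
  Subgroup.isClosed_of_isOpen _ (isOpen_cubSubgroup W)

/-- The quotient of the free pro-`3`-group attached to a subspace of `gr_3`. -/
def CubQuotient : Type u := ULift.{u} (FreeProP 3 2 ⧸ cubSubgroup W)

noncomputable instance : Group (CubQuotient.{u} W) :=
  inferInstanceAs (Group (ULift.{u} (FreeProP 3 2 ⧸ cubSubgroup W)))

instance : TopologicalSpace (CubQuotient.{u} W) := ⊥

instance : DiscreteTopology (CubQuotient.{u} W) := ⟨rfl⟩

instance : Finite (CubQuotient.{u} W) :=
  have := Subgroup.quotient_finite_of_isOpen _ (isOpen_cubSubgroup W)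
  inferInstanceAs (Finite (ULift.{u} (FreeProP 3 2 ⧸ cubSubgroup W)))

/-- The canonical presentation of the quotient attached to a subspace of `gr_3`. -/
noncomputable def cubPresentation : FreeProP 3 2 →ₜ* CubQuotient.{u} W where
  toFun f := ULift.up (QuotientGroup.mk f)
  map_one' := rfl
  map_mul' _ _ := rfl
  continuous_toFun := by
    have := QuotientGroup.discreteTopology (isOpen_cubSubgroup W)
    let up : FreeProP 3 2 ⧸ cubSubgroup W → CubQuotient.{u} W := ULift.up
    have hup : Continuous up := continuous_of_discreteTopology
    exact hup.comp QuotientGroup.continuous_mk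

theorem isPresentation_cubPresentation : IsPresentation (cubPresentation.{u} W) W where
  surjective := by
    rintro ⟨q⟩
    obtain ⟨f, rfl⟩ := QuotientGroup.mk_surjective q
    exact ⟨f, rfl⟩
  map_eq_one_iff f := by
    rw [← mem_cubSubgroup, ← QuotientGroup.eq_one_iff]
    exact ULift.up_inj

theorem isPGroup_cubQuotient : IsPGroup 3 (CubQuotient.{u} W) := by
  have h := (FreeProP.isProP (p := 3) (n := 2)).isPGroup_quotient
    ⟨⟨cubSubgroup W, isOpen_cubSubgroup W⟩, cubSubgroup_normal W⟩
  exact h.of_equiv (MulEquiv.ulift.symm : FreeProP 3 2 ⧸ cubSubgroup W ≃*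
    ULift.{u} (FreeProP 3 2 ⧸ cubSubgroup W))

end Quot

end SchurSigma

namespace SchurSigma

open scoped commutatorElement

/-! ### Vanishing of `H^2` of free pro-`p`-groups -/

section CocycleGroup

variable {p : ℕ} {Q : Type u} [Group Q]

/-- The central extension of `Q` by `𝔽_p` attached to a `2`-cocycle. -/
def CocycleGroup (_c : {c : Q → Q → ZMod p //
    ∀ g h k, c h k - c (g * h) k + c g (h * k) - c g h = 0}) : Type u := ZMod p × Q

variable (c : {c : Q → Q → ZMod p // ∀ g h k, c h k - c (g * h) k + c g (h * k) - c g h = 0})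

instance : Mul (CocycleGroup c) := ⟨fun a b => (a.1 + b.1 + c.1 a.2 b.2, a.2 * b.2)⟩
-- The correction `-c(1,1)` is needed because cocycles are not assumed to be normalised.
instance : One (CocycleGroup c) := ⟨(-c.1 1 1, 1)⟩
instance : Inv (CocycleGroup c) := ⟨fun a => (-a.1 - c.1 a.2⁻¹ a.2 - c.1 1 1, a.2⁻¹)⟩

theorem CocycleGroup.mul_fst (a b : CocycleGroup c) : (a * b).1 = a.1 + b.1 + c.1 a.2 b.2 := rfl
theorem CocycleGroup.mul_snd (a b : CocycleGroup c) : (a * b).2 = a.2 * b.2 := rfl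
theorem CocycleGroup.one_fst : (1 : CocycleGroup c).1 = -c.1 1 1 := rfl
theorem CocycleGroup.one_snd : (1 : CocycleGroup c).2 = 1 := rfl
theorem CocycleGroup.inv_fst (a : CocycleGroup c) :
    (a⁻¹).1 = -a.1 - c.1 a.2⁻¹ a.2 - c.1 1 1 := rfl
theorem CocycleGroup.inv_snd (a : CocycleGroup c) : (a⁻¹).2 = a.2⁻¹ := rfl

instance : Group (CocycleGroup c) := Group.ofLeftAxioms
  (by
    intro a b d
    refine Prod.ext ?_ (mul_assoc a.2 b.2 d.2)
    simp only [CocycleGroup.mul_fst, CocycleGroup.mul_snd]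
    linear_combination -c.2 a.2 b.2 d.2)
  (by
    intro a
    refine Prod.ext ?_ (one_mul a.2)
    simp only [CocycleGroup.mul_fst, CocycleGroup.one_fst, CocycleGroup.one_snd]
    have := c.2 1 1 a.2
    simp only [one_mul] at this
    linear_combination this)
  (by
    intro a
    refine Prod.ext ?_ (inv_mul_cancel a.2)
    simp only [CocycleGroup.mul_fst, CocycleGroup.inv_fst, CocycleGroup.one_fst,
      CocycleGroup.inv_snd]
    ring)

instance : TopologicalSpace (CocycleGroup c) := ⊥

instance : DiscreteTopology (CocycleGroup c) := ⟨rfl⟩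

instance [NeZero p] [Finite Q] : Finite (CocycleGroup c) :=
  inferInstanceAs (Finite (ZMod p × Q))

theorem CocycleGroup.isPGroup [Fact p.Prime] [Finite Q] (hQ : IsPGroup p Q) :
    IsPGroup p (CocycleGroup c) := by
  obtain ⟨k, hk⟩ := IsPGroup.iff_card.mp hQ
  refine IsPGroup.of_card (n := k + 1) ?_
  rw [pow_succ', ← hk]
  exact (Nat.card_prod (ZMod p) Q).trans (by rw [Nat.card_zmod])

end CocycleGroup

/-- By the tube lemma, a locally constant function on the compact group `G × G` is uniformly so.
Continuous cocycles therefore come from finite quotients. -/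
theorem exists_openNormalSubgroup_invariant {p : ℕ} [Fact p.Prime] {G : Type u} [Group G] [TopologicalSpace G]
    (hG : IsProP p G) {X : Type*} [TopologicalSpace X] [DiscreteTopology X] {c : G × G → X}
    (hc : Continuous c) : ∃ U : OpenNormalSubgroup G,
      ∀ a b u v, u ∈ U.toSubgroup → v ∈ U.toSubgroup → c (a * u, b * v) = c (a, b) := by
  have := hG.isTopologicalGroup
  have := hG.compact
  have hopen : IsOpen {q : (G × G) × (G × G) | c (q.1 * q.2) = c q.1} := by
    have : {q : (G × G) × (G × G) | c (q.1 * q.2) = c q.1} =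
        (fun q : (G × G) × (G × G) => (c (q.1 * q.2), c q.1)) ⁻¹' {r | r.1 = r.2} := rfl
    rw [this]
    exact (isOpen_discrete _).preimage (by fun_prop)
  obtain ⟨V₁, V, -, hV, h₁, h1, hVV⟩ := generalized_tube_lemma (isCompact_univ (X := G × G))
    (isCompact_singleton (x := (1 : G × G))) hopen (by
      rintro ⟨q, r⟩ ⟨-, hr⟩
      have hr' : r = 1 := hr
      change c (q * r) = c q
      rw [hr', mul_one])
  obtain ⟨u₁, u₂, hu₁, hu₂, h1₁, h1₂, hsub⟩ := isOpen_prod_iff.mp hV 1 1 (h1 rfl)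
  obtain ⟨U, hU⟩ := hG.exists_openNormalSubgroup_subset (hu₁.inter hu₂) ⟨h1₁, h1₂⟩
  refine ⟨U, fun a b u v hu hv => ?_⟩
  exact hVV (a := ((a, b), (u, v))) ⟨h₁ trivial, hsub ⟨(hU hu).1, (hU hv).2⟩⟩

/-- `H^2` of a free pro-`p`-group vanishes. -/
theorem FreeProP.exists_cochain {p n : ℕ} [Fact p.Prime] {c : FreeProP p n × FreeProP p n → ZMod p}
    (hc : c ∈ Z2 p (FreeProP p n)) :
    ∃ b : FreeProP p n → ZMod p, Continuous b ∧ ∀ g h, c (g, h) = b h - b (g * h) + b g := by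
  obtain ⟨U, hU⟩ := exists_openNormalSubgroup_invariant (FreeProP.isProP (p := p) (n := n)) hc.1
  have : U.toSubgroup.Normal := U.isNormal'
  have := (FreeProP.isProP (p := p) (n := n)).finite_quotient U
  let Q := FreeProP p n ⧸ U.toSubgroup
  let d : Q → Q → ZMod p := fun q r => c (q.out, r.out)
  have hd : ∀ a b : FreeProP p n, d (QuotientGroup.mk a) (QuotientGroup.mk b) = c (a, b) := by
    intro a b
    obtain ⟨u, hu⟩ := QuotientGroup.mk_out_eq_mul U.toSubgroup a
    obtain ⟨v, hv⟩ := QuotientGroup.mk_out_eq_mul U.toSubgroup b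
    change c ((QuotientGroup.mk a : Q).out, (QuotientGroup.mk b : Q).out) = _
    rw [hu, hv]
    exact hU a b u v u.2 v.2
  let e : {c : Q → Q → ZMod p // ∀ g h k, c h k - c (g * h) k + c g (h * k) - c g h = 0} :=
    ⟨d, fun g h k => by
      obtain ⟨g, rfl⟩ := QuotientGroup.mk_surjective g
      obtain ⟨h, rfl⟩ := QuotientGroup.mk_surjective h
      obtain ⟨k, rfl⟩ := QuotientGroup.mk_surjective k
      rw [← QuotientGroup.mk_mul, ← QuotientGroup.mk_mul, hd, hd, hd, hd]
      exact hc.2 g h k⟩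
  -- Freeness lifts the projection to `Q` to the central extension of `Q` defined by the cocycle;
  -- the first component of the lift, negated, is the cochain sought.
  obtain ⟨ψ, hψ⟩ := FreeProP.exists_hom_of_finite
    (CocycleGroup.isPGroup e (FreeProP.isProP.isPGroup_quotient U))
    fun i => ((0, QuotientGroup.mk (gen p i)) : ZMod p × Q)
  have hdQ : DiscreteTopology Q := QuotientGroup.discreteTopology U.isOpen'
  let snd : CocycleGroup e →ₜ* Q :=
    ⟨⟨⟨fun a => a.2, rfl⟩, fun _ _ => rfl⟩, continuous_of_discreteTopology⟩
  have hsnd : ∀ f, (ψ f).2 = QuotientGroup.mk f := FreeProP.hom_ext (φ := snd.comp ψ)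
    (ψ := ⟨QuotientGroup.mk' U.toSubgroup, QuotientGroup.continuous_mk⟩) fun i => by
      change (ψ (gen p i)).2 = _
      rw [hψ]; rfl
  refine ⟨fun f => -(ψ f).1, ?_, fun g h => ?_⟩
  · exact (continuous_of_discreteTopology (f := fun a : CocycleGroup e => -a.1)).comp
      ψ.continuous_toFun
  · have h1 := CocycleGroup.mul_fst e (ψ g) (ψ h)
    rw [← map_mul, hsnd, hsnd] at h1
    have h2 : e.1 (QuotientGroup.mk g) (QuotientGroup.mk h) = c (g, h) := hd g h
    rw [h2] at h1
    linear_combination -h1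

/-! ### The transgression -/

section Transgression

variable {G : Type u} [Group G] [TopologicalSpace G]

/-- Continuous functions on the free pro-`3`-group which are additive with respect to the
kernel of `φ`. They restrict to the invariant homomorphisms from the kernel to `𝔽_3`. -/
def ExtCochain (φ : FreeProP 3 2 →ₜ* G) : Submodule (ZMod 3) (FreeProP 3 2 → ZMod 3) where
  carrier := {f | Continuous f ∧ (∀ n, φ n = 1 → ∀ a, f (n * a) = f n + f a) ∧
    ∀ n, φ n = 1 → ∀ a, f (a * n) = f a + f n}
  zero_mem' := ⟨continuous_const, by simp, by simp⟩
  add_mem' := fun {f g} hf hg => ⟨hf.1.add hg.1,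
    fun n hn a => by simp only [Pi.add_apply, hf.2.1 n hn, hg.2.1 n hn]; ring,
    fun n hn a => by simp only [Pi.add_apply, hf.2.2 n hn, hg.2.2 n hn]; ring⟩
  smul_mem' := fun r f hf => ⟨hf.1.const_smul r,
    fun n hn a => by simp only [Pi.smul_apply, hf.2.1 n hn, smul_add],
    fun n hn a => by simp only [Pi.smul_apply, hf.2.2 n hn, smul_add]⟩

variable {φ : FreeProP 3 2 →ₜ* G}

theorem ExtCochain.map_one {f : FreeProP 3 2 → ZMod 3} (hf : f ∈ ExtCochain φ) : f 1 = 0 := by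
  have := hf.2.1 1 (_root_.map_one φ) 1
  rw [mul_one, left_eq_add] at this
  exact this

/-- The coboundary of `f` depends only on images under `φ`, hence is a cocycle on `G`. Additivity on
both sides makes `f` invariant under conjugation on the kernel, which allows kernel elements to be
moved to the left. -/
theorem ExtCochain.defect {f : FreeProP 3 2 → ZMod 3} (hf : f ∈ ExtCochain φ)
    {a a' b b' : FreeProP 3 2} (ha : φ a' = φ a) (hb : φ b' = φ b) :
    f a' + f b' - f (a' * b') = f a + f b - f (a * b) := by
  have hn : φ (a' * a⁻¹) = 1 := by rw [map_mul, map_inv, ha, mul_inv_cancel]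
  have hm : φ (b' * b⁻¹) = 1 := by rw [map_mul, map_inv, hb, mul_inv_cancel]
  have hm' : φ (a * (b' * b⁻¹) * a⁻¹) = 1 := by
    rw [map_mul, map_mul, hm, map_inv, mul_one, mul_inv_cancel]
  have h1 := hf.2.1 _ hn a
  have h2 := hf.2.1 _ hm b
  have h3 := hf.2.1 _ hn (a * (b' * b⁻¹) * a⁻¹ * (a * b))
  have h4 := hf.2.1 _ hm' (a * b)
  have h5 := hf.2.1 _ hm' a
  have h6 := hf.2.2 _ hm a
  rw [show a * (b' * b⁻¹) * a⁻¹ * a = a * (b' * b⁻¹) by group] at h5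
  rw [show a' * a⁻¹ * (a * (b' * b⁻¹) * a⁻¹ * (a * b)) = a' * b' by group] at h3
  rw [inv_mul_cancel_right] at h1 h2
  linear_combination h1 + h2 - h3 - h4 + h5 - h6

section

variable [IsTopologicalGroup G] [T2Space G] (hs : Function.Surjective φ)

/-- The `2`-cocycle on the quotient attached to a cochain that is additive with respect to the
kernel. -/
noncomputable def transgressionCocycle : ExtCochain φ →ₗ[ZMod 3] Z2 3 G where
  toFun f := ⟨fun q => f.1 (Function.surjInv hs q.1) + f.1 (Function.surjInv hs q.2) -
      f.1 (Function.surjInv hs q.1 * Function.surjInv hs q.2), by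
    have key : ∀ a b, f.1 (Function.surjInv hs (φ a)) + f.1 (Function.surjInv hs (φ b)) -
      f.1 (Function.surjInv hs (φ a) * Function.surjInv hs (φ b)) =
        f.1 a + f.1 b - f.1 (a * b) := fun a b =>
      ExtCochain.defect f.2 (Function.surjInv_eq hs _) (Function.surjInv_eq hs _)
    refine ⟨?_, fun g h k => ?_⟩
    · have hq : Topology.IsQuotientMap (Prod.map φ φ) :=
        (φ.continuous_toFun.prodMap φ.continuous_toFun).isClosedMap.isQuotientMap
          (φ.continuous_toFun.prodMap φ.continuous_toFun) (hs.prodMap hs)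
      refine hq.continuous_iff.mpr ?_
      have hcf := f.2.1
      have : Continuous fun q : FreeProP 3 2 × FreeProP 3 2 =>
        f.1 q.1 + f.1 q.2 - f.1 (q.1 * q.2) := by fun_prop
      exact this.congr fun q => (key q.1 q.2).symm
    · obtain ⟨a, rfl⟩ := hs g
      obtain ⟨b, rfl⟩ := hs h
      obtain ⟨d, rfl⟩ := hs k
      rw [← map_mul, ← map_mul]
      simp only [key, mul_assoc]
      ring⟩
  map_add' f g := by
    ext q
    simp only [Submodule.coe_add, Pi.add_apply]
    ring
  map_smul' r f := by
    ext q
    simp only [Submodule.coe_smul, Pi.smul_apply, smul_eq_mul, RingHom.id_apply]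
    ring

theorem transgressionCocycle_apply (f : ExtCochain φ) (a b : FreeProP 3 2) :
    (transgressionCocycle hs f).1 (φ a, φ b) = f.1 a + f.1 b - f.1 (a * b) :=
  ExtCochain.defect f.2 (Function.surjInv_eq hs _) (Function.surjInv_eq hs _)

/-- The transgression, as a map on cochains. -/
noncomputable def transgression : ExtCochain φ →ₗ[ZMod 3] H2 3 G :=
  (Submodule.mkQ _).comp (transgressionCocycle hs)

theorem transgression_eq_zero_iff (f : ExtCochain φ) : transgression hs f = 0 ↔
    ∃ c : G → ZMod 3, Continuous c ∧
      ∀ a b, f.1 a + f.1 b - f.1 (a * b) = c (φ b) - c (φ (a * b)) + c (φ a) := by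
  rw [transgression, LinearMap.comp_apply, Submodule.mkQ_apply, Submodule.Quotient.mk_eq_zero]
  constructor
  · rintro ⟨c, hc, h⟩
    refine ⟨c, hc, fun a b => ?_⟩
    rw [← transgressionCocycle_apply hs, map_mul]
    exact h _ _
  · rintro ⟨c, hc, h⟩
    refine ⟨c, hc, fun g g' => ?_⟩
    obtain ⟨a, rfl⟩ := hs g
    obtain ⟨b, rfl⟩ := hs g'
    rw [← map_mul, ← h]
    exact transgressionCocycle_apply hs f a b

/-- If the kernel lies in `D_2`, the transgression is injective on restrictions to the kernel. -/
theorem eq_zero_of_transgression_eq_zero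
    (hφ : ∀ f, φ f = 1 → f ∈ zassenhaus 3 (FreeProP 3 2) 2) {f : ExtCochain φ}
    (hf : transgression hs f = 0) {n : FreeProP 3 2} (hn : φ n = 1) : f.1 n = 0 := by
  obtain ⟨c, hc, h⟩ := (transgression_eq_zero_iff hs f).mp hf
  -- Two cochains with the same coboundary differ by a homomorphism, which vanishes on `D_2` and so
  -- on the kernel; there `c ∘ φ` is constant.
  have hZ : (fun a => f.1 a - c (φ a)) ∈ Z1 3 (FreeProP 3 2) := by
    refine ⟨f.2.1.sub (hc.comp φ.continuous_toFun), fun a b => ?_⟩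
    linear_combination -h a b
  have h1 : f.1 n - c (φ n) = 0 := apply_eq_zero_of_mem_zassenhaus_two hZ (hφ n hn)
  have h2 : f.1 1 - c (φ 1) = 0 := apply_eq_zero_of_mem_zassenhaus_two hZ (one_mem _)
  rw [ExtCochain.map_one f.2, map_one] at h2
  rw [hn] at h1
  linear_combination h1 - h2

/-- Such an `f` factors through `G`, so its coboundary is already a coboundary there. -/
theorem transgression_eq_zero_of_forall {f : ExtCochain φ} (h : ∀ n, φ n = 1 → f.1 n = 0) :
    transgression hs f = 0 := by
  rw [transgression_eq_zero_iff]
  have key : ∀ a, f.1 (Function.surjInv hs (φ a)) = f.1 a := by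
    intro a
    have hn : φ (Function.surjInv hs (φ a) * a⁻¹) = 1 := by
      rw [map_mul, Function.surjInv_eq hs, map_inv, mul_inv_cancel]
    have := f.2.2.1 _ hn a
    rwa [inv_mul_cancel_right, h _ hn, zero_add] at this
  refine ⟨fun g => f.1 (Function.surjInv hs g), ?_, fun a b => ?_⟩
  · refine (isQuotientMap_of_freeProP hs).continuous_iff.mpr ?_
    exact f.2.1.congr fun a => (key a).symm
  · beta_reduce
    rw [key, key, key]
    ring

/-- A cocycle on `G`, inflated to the free group, is the coboundary of some `b`; the cochain sought
is `b - b 1`. -/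
theorem transgression_surjective : Function.Surjective (transgression hs) := by
  intro q
  obtain ⟨c, rfl⟩ := Submodule.Quotient.mk_surjective _ q
  have hpull : (fun q : FreeProP 3 2 × FreeProP 3 2 => c.1 (φ q.1, φ q.2)) ∈
      Z2 3 (FreeProP 3 2) := by
    refine ⟨c.2.1.comp (φ.continuous_toFun.prodMap φ.continuous_toFun), fun g h k => ?_⟩
    simp only [map_mul]
    exact c.2.2 _ _ _
  obtain ⟨b, hb, hcb⟩ := FreeProP.exists_cochain hpull
  have h11 : c.1 (1, 1) = b 1 := by
    have := hcb 1 1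
    simp only [map_one, mul_one] at this
    linear_combination this
  -- The cocycle identity makes `c(1,·)` and `c(·,1)` constant, so subtracting `b 1` makes `b`
  -- additive with respect to the kernel.
  have hl : ∀ g, c.1 (1, g) = b 1 := by
    intro g
    have := c.2.2 1 1 g
    simp only [one_mul] at this
    linear_combination this + h11
  have hr : ∀ g, c.1 (g, 1) = b 1 := by
    intro g
    have := c.2.2 g 1 1
    simp only [mul_one] at this
    linear_combination h11 - this
  let f : ExtCochain φ := ⟨fun a => b a - b 1, hb.sub continuous_const, fun n hn a => by
      have h1 := hcb n a
      simp only [hn, hl] at h1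
      linear_combination h1, fun n hn a => by
      have h1 := hcb a n
      simp only [hn, hr] at h1
      linear_combination h1⟩
  refine ⟨f, ?_⟩
  rw [transgression, LinearMap.comp_apply, Submodule.mkQ_apply, Submodule.Quotient.eq]
  refine ⟨fun _ => -b 1, continuous_const, fun g g' => ?_⟩
  obtain ⟨a, rfl⟩ := hs g
  obtain ⟨a', rfl⟩ := hs g'
  have h1 := transgressionCocycle_apply hs f a a'
  have h2 : c.1 (φ a, φ a') = b a' - b (a * a') + b a := hcb a a'
  change (transgressionCocycle hs f).1 (φ a, φ a') - c.1 (φ a, φ a') = _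
  rw [h1, h2]
  change b a - b 1 + (b a' - b 1) - (b (a * a') - b 1) - _ = _
  ring

/-- The composition of a cochain with an automorphism compatible with `φ`. -/
theorem comp_mem_extCochain {σ : G ≃ₜ* G} {θ : FreeProP 3 2 →ₜ* FreeProP 3 2}
    (hθ : ∀ a, φ (θ a) = σ (φ a)) {f : FreeProP 3 2 → ZMod 3} (hf : f ∈ ExtCochain φ) :
    (fun a => f (θ a)) ∈ ExtCochain φ := by
  have h1 : ∀ n, φ n = 1 → φ (θ n) = 1 := fun n hn => by rw [hθ, hn, map_one]
  refine ⟨hf.1.comp θ.continuous_toFun, fun n hn a => ?_, fun n hn a => ?_⟩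
  · beta_reduce; rw [map_mul]; exact hf.2.1 _ (h1 n hn) _
  · beta_reduce; rw [map_mul]; exact hf.2.2 _ (h1 n hn) _

theorem transgression_comp {σ : G ≃ₜ* G} {θ : FreeProP 3 2 →ₜ* FreeProP 3 2}
    (hθ : ∀ a, φ (θ a) = σ (φ a)) (f : ExtCochain φ) :
    transgression hs ⟨_, comp_mem_extCochain hθ f.2⟩ = H2.map 3 σ (transgression hs f) := by
  change Submodule.Quotient.mk _ = Submodule.Quotient.mk (Z2.map 3 σ (transgressionCocycle hs f))
  congr 1
  ext ⟨g, g'⟩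
  obtain ⟨a, rfl⟩ := hs g
  obtain ⟨b, rfl⟩ := hs g'
  rw [transgressionCocycle_apply hs]
  change _ = (transgressionCocycle hs f).1 (σ (φ a), σ (φ b))
  rw [← hθ, ← hθ, transgressionCocycle_apply hs]
  change f.1 (θ a) + f.1 (θ b) - f.1 (θ (a * b)) = _
  rw [map_mul]

end

/-! ### Separating cochains -/

/-- A set-theoretic section of `P → P/N` assigns to each `q` its component in `N ≅ 𝔽_p`, additive in
`N` by centrality. Subtracting the value at `1` normalises it. -/
theorem exists_cochain_of_central {P : Type*} [Group P] {p : ℕ} [Fact p.Prime] {N : Subgroup P}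
    (hN : N ≤ Subgroup.center P) (hcard : Nat.card N = p) :
    ∃ f : P → ZMod p, (∀ n ∈ N, ∀ q, f (n * q) = f n + f q) ∧ ∀ n ∈ N, f n = 0 → n = 1 := by
  let e : N ≃* Multiplicative (ZMod p) := mulEquivOfPrimeCardEq (p := p) hcard (Nat.card_zmod p)
  have hmem : ∀ q : P, (QuotientGroup.mk q : P ⧸ N).out⁻¹ * q ∈ N := fun q =>
    QuotientGroup.eq.mp (QuotientGroup.out_eq' _)
  let f : P → ZMod p := fun q => (e ⟨_, hmem q⟩).toAdd
  have hf : ∀ n (hn : n ∈ N) q, f (n * q) = (e ⟨n, hn⟩).toAdd + f q := by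
    intro n hn q
    have h1 : (QuotientGroup.mk (n * q) : P ⧸ N) = QuotientGroup.mk q := by
      rw [QuotientGroup.eq, mul_inv_rev, mul_assoc,
        ← Subgroup.mem_center_iff.mp ((Subgroup.center P).inv_mem (hN hn)), ← mul_assoc,
        inv_mul_cancel, one_mul]
      exact N.inv_mem hn
    change (e _).toAdd = (e _).toAdd + (e _).toAdd
    rw [← toAdd_mul, ← map_mul]
    congr 2
    ext
    change _ = n * ((QuotientGroup.mk q : P ⧸ N).out⁻¹ * q)
    change (QuotientGroup.mk (n * q) : P ⧸ N).out⁻¹ * (n * q) = _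
    rw [h1, ← mul_assoc, Subgroup.mem_center_iff.mp (hN hn), mul_assoc]
  have h1 : ∀ n (hn : n ∈ N), f n = (e ⟨n, hn⟩).toAdd + f 1 := fun n hn => by
    rw [← hf n hn 1, mul_one]
  refine ⟨fun q => f q - f 1, fun n hn q => ?_, fun n hn h => ?_⟩
  · beta_reduce
    rw [hf n hn, h1 n hn]
    ring
  · beta_reduce at h
    rw [h1 n hn, add_sub_cancel_right, toAdd_eq_zero, EmbeddingLike.map_eq_one_iff] at h
    exact congrArg Subtype.val h

/-- A closed normal subgroup properly contained in the kernel is separated from it by a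
cochain. -/
theorem exists_extCochain_separating [T2Space G] {N' : Subgroup (FreeProP 3 2)} [N'.Normal]
    (hc : IsClosed (N' : Set (FreeProP 3 2))) {n₀ : FreeProP 3 2}
    (hn₀ : φ n₀ = 1) (hn₀' : n₀ ∉ N') :
    ∃ f ∈ ExtCochain φ, (∀ n ∈ N', φ n = 1 → f n = 0) ∧ ∃ n, φ n = 1 ∧ f n ≠ 0 := by
  have hF := FreeProP.isProP (p := 3) (n := 2)
  -- Among the open normal subgroups that contain `N'` but not the kernel, one of least index is
  -- taken.
  have hex : ∃ m, ∃ U : OpenNormalSubgroup (FreeProP 3 2), N' ≤ U.toSubgroup ∧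
      ¬ φ.toMonoidHom.ker ≤ U.toSubgroup ∧ U.toSubgroup.index = m := by
    obtain ⟨U, hU⟩ := hF.exists_openNormalSubgroup_notMem_sup hc hn₀'
    have : U.toSubgroup.Normal := U.isNormal'
    refine ⟨_, ⟨⟨N' ⊔ U.toSubgroup, Subgroup.isOpen_mono le_sup_right U.isOpen'⟩,
      Subgroup.sup_normal N' U.toSubgroup⟩, le_sup_left, fun h => hU (h hn₀), rfl⟩
  classical
  obtain ⟨U, hN'U, hNU, hidx⟩ := Nat.find_spec hex
  have hmin := fun m => Nat.find_min hex (m := m)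
  rw [← hidx] at hmin
  have hUn : U.toSubgroup.Normal := U.isNormal'
  have := hF.finite_quotient U
  have hUfin : U.toSubgroup.FiniteIndex := Subgroup.finiteIndex_of_finite_quotient
  have hP := hF.isPGroup_quotient U
  let π := QuotientGroup.mk' U.toSubgroup
  let Nb : Subgroup (FreeProP 3 2 ⧸ U.toSubgroup) := φ.toMonoidHom.ker.map π
  -- By minimality, the image `Nb` of the kernel lies in every nontrivial normal subgroup. Applied
  -- to the centre, and then to a central subgroup of order 3, this makes `Nb` central of order 3.
  have hle : ∀ M : Subgroup (FreeProP 3 2 ⧸ U.toSubgroup), M.Normal → M ≠ ⊥ → Nb ≤ M := by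
    intro M hM hM1
    by_contra hcon
    have hUM : U.toSubgroup ≤ M.comap π := fun u hu => by
      rw [Subgroup.mem_comap, QuotientGroup.mk'_apply, (QuotientGroup.eq_one_iff u).mpr hu]
      exact M.one_mem
    have hlt : U.toSubgroup < M.comap π := by
      refine lt_of_le_of_ne hUM fun heq => hM1 ?_
      rw [eq_bot_iff]
      intro q hq
      obtain ⟨a, rfl⟩ := QuotientGroup.mk_surjective q
      have ha : a ∈ M.comap π := hq
      rw [← heq] at ha
      exact (QuotientGroup.eq_one_iff a).mpr ha
    refine hmin _ (Subgroup.index_strictAnti hlt) ⟨⟨⟨M.comap π, Subgroup.isOpen_mono hUM U.isOpen'⟩,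
      hM.comap π⟩, hN'U.trans hUM, fun h => hcon ?_, rfl⟩
    rw [Subgroup.map_le_iff_le_comap]
    exact h
  obtain ⟨n₁, hn₁, hn₁U⟩ := Set.not_subset.mp hNU
  have hn₁b : π n₁ ≠ 1 := fun h => hn₁U ((QuotientGroup.eq_one_iff n₁).mp h)
  have hnt : Nontrivial (FreeProP 3 2 ⧸ U.toSubgroup) := ⟨⟨_, _, hn₁b⟩⟩
  have hcen : Nb ≤ Subgroup.center _ := hle _ inferInstance (hP.bot_lt_center).ne'
  have hcard : Nat.card Nb = 3 := by
    have hNbP : IsPGroup 3 Nb := hP.to_subgroup Nb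
    have hNbnt : Nontrivial Nb := ⟨⟨⟨π n₁, n₁, hn₁, rfl⟩, 1, fun h => hn₁b (congrArg Subtype.val h)⟩⟩
    obtain ⟨k, hk, hkc⟩ := hNbP.nontrivial_iff_card.mp hNbnt
    obtain ⟨z, hz⟩ := exists_prime_orderOf_dvd_card' (G := Nb) 3 (hkc ▸ dvd_pow_self 3 hk.ne')
    have hz' : orderOf (z : FreeProP 3 2 ⧸ U.toSubgroup) = 3 := by
      rw [Subgroup.orderOf_coe, hz]
    have hnorm : (Subgroup.zpowers (z : FreeProP 3 2 ⧸ U.toSubgroup)).Normal := by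
      refine ⟨fun a ha g => ?_⟩
      have : a ∈ Subgroup.center _ := Subgroup.zpowers_le.mpr (hcen z.2) ha
      rwa [Subgroup.mem_center_iff.mp this g, mul_inv_cancel_right]
    have h1 : Nb ≤ Subgroup.zpowers (z : FreeProP 3 2 ⧸ U.toSubgroup) := by
      refine hle _ hnorm fun h => ?_
      rw [Subgroup.zpowers_eq_bot] at h
      rw [h, orderOf_one] at hz'
      norm_num at hz'
    rw [le_antisymm h1 (Subgroup.zpowers_le.mpr z.2), Nat.card_zpowers, hz']
  obtain ⟨f, hf, hf0⟩ := exists_cochain_of_central hcen hcard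
  have hd : DiscreteTopology (FreeProP 3 2 ⧸ U.toSubgroup) :=
    QuotientGroup.discreteTopology U.isOpen'
  have hmemNb : ∀ n, φ n = 1 → π n ∈ Nb := fun n hn => ⟨n, hn, rfl⟩
  have hf1 : f 1 = 0 := by
    have := hf 1 Nb.one_mem 1
    rwa [mul_one, left_eq_add] at this
  refine ⟨fun a => f (π a), ⟨(continuous_of_discreteTopology).comp QuotientGroup.continuous_mk,
    fun n hn a => ?_, fun n hn a => ?_⟩, fun n hn _ => ?_, n₁, hn₁, fun h => ?_⟩
  · beta_reduce; rw [map_mul, hf _ (hmemNb n hn)]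
  · beta_reduce; rw [map_mul, Subgroup.mem_center_iff.mp (hcen (hmemNb n hn)), hf _ (hmemNb n hn), add_comm]
  · have : π n = 1 := (QuotientGroup.eq_one_iff n).mpr (hN'U hn)
    beta_reduce; rw [this, hf1]
  · exact hn₁b (hf0 _ (hmemNb n₁ hn₁) h)

end Transgression

end SchurSigma

namespace SchurSigma

/-! ### Linear algebra -/

section LinearAlgebra

theorem exists_dual_family {K V ι : Type*} [Field K] [AddCommGroup V] [Module K V] [Fintype ι]
    [DecidableEq ι] {v : ι → V} (hv : LinearIndependent K v) :
    ∃ L : V →ₗ[K] ι → K, ∀ i, L (v i) = Pi.single i 1 := by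
  obtain ⟨L, hL⟩ := LinearMap.exists_leftInverse_of_injective (Fintype.linearCombination K v)
    (LinearMap.ker_eq_bot.mpr hv.fintypeLinearCombination_injective)
  refine ⟨L, fun i => ?_⟩
  have := LinearMap.congr_fun hL (Pi.single i 1)
  simpa using this

theorem exists_linearMap_gr_three :
    ∃ l : Gr 3 (FreeProP 3 2) 3 →ₗ[ZMod 3] Fin 4 → ZMod 3, Function.Injective l ∧
      ∀ a ha, l (Gr.mk 3 (FreeProP 3 2) (i := 3) a ha) = cub a := by
  let φ : zassenhaus 3 (FreeProP 3 2) 3 →* Multiplicative (Fin 4 → ZMod 3) :=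
    MonoidHom.mk' (fun a => Multiplicative.ofAdd (cub a)) fun a b => by
      rw [Subgroup.coe_mul, cub_mul a.2]; rfl
  have hn : ((zassenhaus 3 (FreeProP 3 2) (3 + 1)).subgroupOf
      (zassenhaus 3 (FreeProP 3 2) 3)).Normal := (zassenhaus_normal 3 _ (3 + 1)).subgroupOf _
  let ψ : Gr 3 (FreeProP 3 2) 3 →+ Fin 4 → ZMod 3 := MonoidHom.toAdditiveLeft
    (QuotientGroup.lift ((zassenhaus 3 (FreeProP 3 2) (3 + 1)).subgroupOf
      (zassenhaus 3 (FreeProP 3 2) 3)) φ fun a ha =>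
        (mem_zassenhaus_four_iff.mp (Subgroup.mem_subgroupOf.mp ha)).2)
  refine ⟨ψ.toZModLinearMap 3, ?_, fun a ha => rfl⟩
  rw [injective_iff_map_eq_zero]
  intro t ht
  induction t using Additive.rec with | _ t
  induction t using QuotientGroup.induction_on with | _ a
  refine congrArg Additive.ofMul ((QuotientGroup.eq_one_iff a).mpr ?_)
  exact Subgroup.mem_subgroupOf.mpr (mem_zassenhaus_four_iff.mpr ⟨a.2, ht⟩)

theorem finrank_span_gr_three {ι : Type*} (r : ι → FreeProP 3 2)
    (hr : ∀ i, r i ∈ zassenhaus 3 (FreeProP 3 2) 3) :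
    Module.finrank (ZMod 3)
      (Submodule.span (ZMod 3) (Set.range fun i => Gr.mk 3 (FreeProP 3 2) (r i) (hr i))) =
    Module.finrank (ZMod 3) (Submodule.span (ZMod 3) (Set.range fun i => cub (r i))) := by
  obtain ⟨l, hl, hlc⟩ := exists_linearMap_gr_three
  rw [(Submodule.equivMapOfInjective l hl _).finrank_eq, Submodule.map_span, ← Set.range_comp]
  exact congrArg (fun c : ι → Fin 4 → ZMod 3 =>
    Module.finrank (ZMod 3) (Submodule.span (ZMod 3) (Set.range c))) (funext fun i => hlc _ _)

end LinearAlgebra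

/-! ### Cohomological bounds on the relations -/

section Transgression

variable {G : Type u} [Group G] [TopologicalSpace G] [IsTopologicalGroup G] [T2Space G]
  {φ : FreeProP 3 2 →ₜ* G}

theorem c2_mem_extCochain (hφ : ∀ f, φ f = 1 → f ∈ zassenhaus 3 (FreeProP 3 2) 2) :
    (fun f => (magnus f).c2 0 1) ∈ ExtCochain φ := by
  refine ⟨(continuous_of_discreteTopology (f := fun m : Magnus => m.c2 0 1)).comp
    magnus.continuous_toFun, fun n hn a => ?_, fun n hn a => ?_⟩
  · simpa using c2_pow_mul (w := a) (hφ n hn) 1 0 1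
  · beta_reduce
    rw [map_mul, Magnus.mul_c2, c1_eq_zero (hφ n hn), mul_zero, add_zero]

theorem cub_mem_extCochain (hφ : ∀ f, φ f = 1 → f ∈ zassenhaus 3 (FreeProP 3 2) 3)
    (l : (Fin 4 → ZMod 3) →ₗ[ZMod 3] ZMod 3) : (fun f => l (cub f)) ∈ ExtCochain φ := by
  refine ⟨(continuous_of_discreteTopology (f := l)).comp continuous_cub,
    fun n hn a => ?_, fun n hn a => ?_⟩
  · beta_reduce
    rw [cub_mul (hφ n hn), map_add]
  · beta_reduce
    rw [cub_mul_right a (hφ n hn), map_add]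

/-- Evaluation of homomorphisms to `𝔽_3` at the generators. -/
def evalGen (φ : FreeProP 3 2 →ₜ* G) : H1 3 G →ₗ[ZMod 3] Fin 2 → ZMod 3 where
  toFun f i := f.1 (φ (FreeProP.gen 3 i))
  map_add' _ _ := rfl
  map_smul' _ _ := rfl

theorem eq_zero_of_gen {f : FreeProP 3 2 → ZMod 3} (hf : f ∈ Z1 3 (FreeProP 3 2))
    (h : ∀ i, f (FreeProP.gen 3 i) = 0) (a : FreeProP 3 2) : f a = 0 := by
  let S : Subgroup (FreeProP 3 2) :=
    { carrier := {a | f a = 0}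
      one_mem' := apply_eq_zero_of_mem_zassenhaus_two hf (one_mem _)
      mul_mem' := fun {a b} (ha : f a = 0) (hb : f b = 0) => by
        change f (a * b) = 0
        rw [hf.2, ha, hb, add_zero]
      inv_mem' := fun {a} (ha : f a = 0) => by
        change f a⁻¹ = 0
        have h1 := hf.2 a a⁻¹
        rw [mul_inv_cancel, ha, zero_add] at h1
        rw [← h1]
        exact apply_eq_zero_of_mem_zassenhaus_two hf (one_mem _) }
  have hS : IsClosed (S : Set (FreeProP 3 2)) := isClosed_singleton.preimage hf.1
  have : a ∈ S := by rw [FreeProP.eq_top_of_gen_mem hS h]; trivial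
  exact this

theorem comp_mem_Z1 {f : G → ZMod 3} (hf : f ∈ Z1 3 G) :
    (fun a => f (φ a)) ∈ Z1 3 (FreeProP 3 2) :=
  ⟨hf.1.comp φ.continuous_toFun, fun a b => by beta_reduce; rw [map_mul, hf.2]⟩

theorem evalGen_injective (hs : Function.Surjective φ) : Function.Injective (evalGen φ) := by
  rw [injective_iff_map_eq_zero]
  intro f hf
  ext g
  obtain ⟨a, rfl⟩ := hs g
  exact eq_zero_of_gen (comp_mem_Z1 f.2) (fun i => congrFun hf i) a

theorem finrank_H1_le_two (hs : Function.Surjective φ) :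
    Module.Finite (ZMod 3) (H1 3 G) ∧ Module.finrank (ZMod 3) (H1 3 G) ≤ 2 :=
  ⟨Module.Finite.of_injective _ (evalGen_injective hs),
    (LinearMap.finrank_le_finrank_of_injective (evalGen_injective hs)).trans_eq
      (Module.finrank_fin_fun _)⟩

/-- Three classes in a space of dimension at most 2 are dependent, and transgression is injective on
restrictions to the kernel. -/
theorem exists_sum_eq_zero [Module.Finite (ZMod 3) (H2 3 G)] (hs : Function.Surjective φ)
    (h2 : Module.finrank (ZMod 3) (H2 3 G) ≤ 2)
    (hφ : ∀ f, φ f = 1 → f ∈ zassenhaus 3 (FreeProP 3 2) 2) (f : Fin 3 → ExtCochain φ) :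
    ∃ a : Fin 3 → ZMod 3, a ≠ 0 ∧ ∀ n, φ n = 1 →
      a 0 * (f 0).1 n + a 1 * (f 1).1 n + a 2 * (f 2).1 n = 0 := by
  have hker := LinearMap.ker_ne_bot_of_finrank_lt
    (f := (transgression hs).comp (Fintype.linearCombination (ZMod 3) f)) (by
      rw [Module.finrank_fin_fun]; omega)
  obtain ⟨a, ha, ha0⟩ := Submodule.exists_mem_ne_zero_of_ne_bot hker
  refine ⟨a, ha0, fun n hn => ?_⟩
  have := eq_zero_of_transgression_eq_zero hs hφ (LinearMap.mem_ker.mp ha) hn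
  rw [Fintype.linearCombination_apply, Fin.sum_univ_three] at this
  exact this

/-- The coordinate on `gr_2` is a cochain fixed by `flip` on the kernel, since `-1` has determinant
1, while its transgression is negated by `σ`. As 2 is invertible, it vanishes on the kernel. -/
theorem ker_le_zassenhaus_three (hs : Function.Surjective φ) {σ : G ≃ₜ* G}
    (hσ : ∀ a, φ (flip a) = σ (φ a)) (hσ2 : ∀ t : H2 3 G, H2.map 3 σ t = -t)
    (hφ : ∀ f, φ f = 1 → f ∈ zassenhaus 3 (FreeProP 3 2) 2) {n : FreeProP 3 2} (hn : φ n = 1) :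
    n ∈ zassenhaus 3 (FreeProP 3 2) 3 := by
  let f : ExtCochain φ := ⟨_, c2_mem_extCochain hφ⟩
  have h1 := transgression_comp hs hσ f
  rw [hσ2, eq_neg_iff_add_eq_zero, ← map_add] at h1
  have h2 : (magnus (flip n)).c2 0 1 + (magnus n).c2 0 1 = 0 :=
    eq_zero_of_transgression_eq_zero hs hφ h1 hn
  rw [c2_endo _ (hφ n hn), endoMatrix_flip,
    show (-1 : Matrix (Fin 2) (Fin 2) (ZMod 3)).det = 1 by decide] at h2
  refine mem_zassenhaus_three_iff.mpr ⟨hφ n hn, ?_⟩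
  linear_combination -h2 + (magnus n).c2 0 1 * Magnus.three_eq_zero

/-- Functionals dual to three independent vectors of the relation space, composed with `cub`, would
be three cochains independent on the kernel. -/
theorem finrank_relationSpace_le [Module.Finite (ZMod 3) (H2 3 G)] (hs : Function.Surjective φ)
    (h2 : Module.finrank (ZMod 3) (H2 3 G) ≤ 2)
    (hφ : ∀ f, φ f = 1 → f ∈ zassenhaus 3 (FreeProP 3 2) 3) :
    Module.finrank (ZMod 3) (relationSpace φ) ≤ 2 := by
  by_contra! h3
  obtain ⟨v, hv⟩ := exists_linearIndependent_of_le_finrank (Nat.succ_le_of_lt h3)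
  have hv' : LinearIndependent (ZMod 3) fun i => (v i : Fin 4 → ZMod 3) :=
    hv.map' (relationSpace φ).subtype (Submodule.ker_subtype _)
  obtain ⟨L, hL⟩ := exists_dual_family hv'
  obtain ⟨a, ha0, ha⟩ := exists_sum_eq_zero hs h2 (fun f hf => zassenhaus_three_le_two (hφ f hf))
    fun i => ⟨_, cub_mem_extCochain hφ ((LinearMap.proj i).comp L)⟩
  refine ha0 (funext fun j => ?_)
  obtain ⟨n, hn, hnv⟩ := (mem_relationSpace_iff hφ).mp (v j).2
  have h1 : a 0 * L (cub n) 0 + a 1 * L (cub n) 1 + a 2 * L (cub n) 2 = 0 := ha n hn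
  rw [hnv, hL] at h1
  fin_cases j <;> simpa using h1

/-- If relators lifting a basis of the relation space did not generate the kernel, a separating
cochain that kills both, together with the two dual to them, would violate the bound on `H²`. -/
theorem hasZassenhausType33_of_finrank [Module.Finite (ZMod 3) (H2 3 G)]
    (hs : Function.Surjective φ) (h2 : Module.finrank (ZMod 3) (H2 3 G) ≤ 2)
    (hφ : ∀ f, φ f = 1 → f ∈ zassenhaus 3 (FreeProP 3 2) 3)
    (hW : Module.finrank (ZMod 3) (relationSpace φ) = 2) : HasZassenhausType33 3 G := by
  let b := Module.finBasisOfFinrankEq (ZMod 3) (relationSpace φ) hW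
  choose r hr hrb using fun i => (mem_relationSpace_iff hφ).mp (b i).2
  have hv : LinearIndependent (ZMod 3) fun i => cub (r i) := by
    simp only [hrb]
    exact b.linearIndependent.map' (relationSpace φ).subtype (Submodule.ker_subtype _)
  refine ⟨φ, r, fun i => hφ _ (hr i), hs, ?_, ?_⟩
  · have hcl : IsClosed (φ.toMonoidHom.ker : Set (FreeProP 3 2)) :=
      isClosed_singleton.preimage φ.continuous_toFun
    have hle : (Subgroup.normalClosure (Set.range r)).topologicalClosure ≤ φ.toMonoidHom.ker :=
      Subgroup.topologicalClosure_minimal _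
        (Subgroup.normalClosure_le_normal (by rintro _ ⟨i, rfl⟩; exact hr i)) hcl
    refine le_antisymm (fun n₀ hn₀ => ?_) hle
    by_contra hn₀'
    have hN := Subgroup.is_normal_topologicalClosure (Subgroup.normalClosure (Set.range r))
    obtain ⟨f, hf, hf0, n, hn, hfn⟩ := exists_extCochain_separating
      (Subgroup.isClosed_topologicalClosure _) hn₀ hn₀'
    obtain ⟨L, hL⟩ := exists_dual_family hv
    obtain ⟨a, ha0, ha⟩ := exists_sum_eq_zero hs h2
      (fun f hf => zassenhaus_three_le_two (hφ f hf))
      ![⟨_, cub_mem_extCochain hφ ((LinearMap.proj 0).comp L)⟩,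
        ⟨_, cub_mem_extCochain hφ ((LinearMap.proj 1).comp L)⟩, ⟨f, hf⟩]
    have h1 : ∀ n, φ n = 1 → a 0 * L (cub n) 0 + a 1 * L (cub n) 1 + a 2 * f n = 0 := ha
    have hr0 : ∀ i, f (r i) = 0 := fun i => hf0 _ (Subgroup.le_topologicalClosure _
      (Subgroup.subset_normalClosure ⟨i, rfl⟩)) (hr i)
    have e0 : a 0 = 0 := by simpa [hL, hr0] using h1 _ (hr 0)
    have e1 : a 1 = 0 := by simpa [hL, hr0] using h1 _ (hr 1)
    have e2 : a 2 = 0 := by simpa [e0, e1, hfn] using h1 n hn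
    refine ha0 (funext fun j => ?_)
    fin_cases j
    exacts [e0, e1, e2]
  · rw [finrank_span_gr_three, finrank_span_eq_card hv, Fintype.card_fin]

/-- Conjugation is trivial on `gr_3`, so passing to the closed normal closure of the relators does
not enlarge their span. -/
theorem relationSpace_eq_span {ι : Type*} {r : ι → FreeProP 3 2}
    (hr : ∀ i, r i ∈ zassenhaus 3 (FreeProP 3 2) 3)
    (hker : φ.toMonoidHom.ker = (Subgroup.normalClosure (Set.range r)).topologicalClosure) :
    (∀ f, φ f = 1 → f ∈ zassenhaus 3 (FreeProP 3 2) 3) ∧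
      relationSpace φ = Submodule.span (ZMod 3) (Set.range fun i => cub (r i)) := by
  have hle : φ.toMonoidHom.ker ≤
      cubSubgroup (Submodule.span (ZMod 3) (Set.range fun i => cub (r i))) := by
    rw [hker]
    refine Subgroup.topologicalClosure_minimal _ (Subgroup.normalClosure_le_normal ?_)
      (isClosed_cubSubgroup _)
    rintro _ ⟨i, rfl⟩
    exact ⟨hr i, Submodule.subset_span ⟨i, rfl⟩⟩
  refine ⟨fun f hf => (hle hf).1, le_antisymm (Submodule.span_le.mpr ?_)
    (Submodule.span_le.mpr ?_)⟩
  · rintro _ ⟨f, hf, rfl⟩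
    exact (hle hf).2
  · rintro _ ⟨i, rfl⟩
    refine Submodule.subset_span ⟨r i, ?_, rfl⟩
    have : r i ∈ φ.toMonoidHom.ker := by
      rw [hker]
      exact Subgroup.le_topologicalClosure _ (Subgroup.subset_normalClosure ⟨i, rfl⟩)
    exact this

theorem HasZassenhausType33.exists_presentation (h : HasZassenhausType33 3 G) :
    ∃ φ : FreeProP 3 2 →ₜ* G, Function.Surjective φ ∧
      (∀ f, φ f = 1 → f ∈ zassenhaus 3 (FreeProP 3 2) 3) ∧
      Module.finrank (ZMod 3) (relationSpace φ) = 2 := by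
  obtain ⟨φ, r, hr, hs, hker, hrank⟩ := h
  obtain ⟨h1, h2⟩ := relationSpace_eq_span hr hker
  exact ⟨φ, hs, h1, by rw [h2, ← finrank_span_gr_three r hr, hrank]⟩

end Transgression

/-! ### Presentations of weak Schur `σ`-groups -/

theorem WeakSchurGroup.exists_presentation (G : WeakSchurGroup.{v} 3)
    (h1 : grDim 3 G.carrier 1 = 2) : T2Space G.carrier ∧
    ∃ φ : FreeProP 3 2 →ₜ* G.carrier, Function.Surjective φ ∧
      (∀ f, φ f = 1 → f ∈ zassenhaus 3 (FreeProP 3 2) 3) ∧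
      Module.finrank (ZMod 3) (relationSpace φ) ≤ 2 ∧
      (Module.finrank (ZMod 3) (relationSpace φ) = 2 → HasZassenhausType33 3 G.carrier) := by
  have hT2 := G.isProP.t2Space
  refine ⟨hT2, ?_⟩
  obtain ⟨b, hb⟩ := exists_generators h1 two_ne_zero
  have hodd : ∀ f ∈ Z1 3 G.carrier, ∀ a, f (G.σ a) = -f a := fun f hf a =>
    congrFun (congrArg Subtype.val (G.σ_H1 ⟨f, hf⟩)) a
  -- The generators are replaced by the odd elements `b (σ b)⁻¹`. As `σ` is `-1` on `H¹`, a
  -- homomorphism to `𝔽_3` takes on them twice its value on `b`, so they still generate.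
  obtain ⟨φ, hφb, hs⟩ := exists_surjective_of_generators G.isProP
    (fun i => b i * (G.σ (b i))⁻¹) fun f hf h0 => hb f hf fun i => by
      have h2 := h0 i
      have h3 := hf.2 (b i * (G.σ (b i))⁻¹) (G.σ (b i))
      rw [inv_mul_cancel_right, h2, hodd f hf] at h3
      linear_combination -h3 + f (b i) * Magnus.three_eq_zero
  have hσ : ∀ a, φ (flip a) = G.σ (φ a) := FreeProP.hom_ext (φ := φ.comp flip)
    (ψ := ContinuousMonoidHom.comp ⟨G.σ.toMulEquiv.toMonoidHom, G.σ.continuous⟩ φ) fun i => by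
      change φ (flip _) = G.σ (φ _)
      rw [flip_gen, map_inv, hφb, map_mul, map_inv, G.σ_σ, mul_inv_rev, inv_inv]
  have hidx := relIndex_of_grDim two_ne_zero h1
  rw [← relIndex_comap_zassenhaus φ hs (isClosedMap_of_freeProP φ)] at hidx
  have hle : (zassenhaus 3 G.carrier 2).comap φ.toMonoidHom ≤ zassenhaus 3 (FreeProP 3 2) 2 := by
    refine le_of_relIndex_eq (fun f hf => map_mem_zassenhaus φ hf)
      (fun f _ => mem_zassenhaus_one f) ?_ (by rw [hidx]; norm_num)
    rw [hidx, relIndex_two_one fun f => Iff.rfl]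
  have hφ2 : ∀ f, φ f = 1 → f ∈ zassenhaus 3 (FreeProP 3 2) 2 := fun f hf => hle (by
    rw [Subgroup.mem_comap]
    exact hf ▸ Subgroup.one_mem _)
  have hφ3 : ∀ f, φ f = 1 → f ∈ zassenhaus 3 (FreeProP 3 2) 3 := fun f hf =>
    ker_le_zassenhaus_three hs hσ G.σ_H2 hφ2 hf
  obtain ⟨hfin, hrank⟩ := finrank_H1_le_two hs
  have hfin2 : Module.Finite (ZMod 3) (H2 3 G.carrier) :=
    Module.rank_lt_aleph0_iff.mp (G.rank_H2_le.trans_lt G.rank_H1_lt)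
  have hrank2 : Module.finrank (ZMod 3) (H2 3 G.carrier) ≤ 2 := by
    refine le_trans ?_ hrank
    have := G.rank_H2_le
    rwa [← Module.finrank_eq_rank, ← Module.finrank_eq_rank, Nat.cast_le] at this
  exact ⟨φ, hs, hφ3, finrank_relationSpace_le hs hrank2 hφ3,
    hasZassenhausType33_of_finrank hs hrank2 hφ3⟩

end SchurSigma

namespace SchurSigma

/-! ### Construction of weak Schur `σ`-groups -/

theorem IsProP.of_surjective {p : ℕ} [Fact p.Prime] {G : Type u} [Group G] [TopologicalSpace G]
    (hG : IsProP p G) {G' : Type v} [Group G'] [TopologicalSpace G'] [IsTopologicalGroup G']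
    [T2Space G'] (φ : G →ₜ* G') (hs : Function.Surjective φ) : IsProP p G' := by
  have := hG.isTopologicalGroup
  have := hG.compact
  have hq : Topology.IsQuotientMap φ := φ.continuous_toFun.isClosedMap.isQuotientMap
    φ.continuous_toFun hs
  refine ⟨inferInstance, hs.compactSpace φ.continuous_toFun, ?_, fun V => ?_⟩
  -- Two distinct points are separated by a coset of the image of `ker φ · U`, for an open normal
  -- `U` so small that this product avoids a lift of their quotient.
  · have : TotallySeparatedSpace G' := by
      rw [totallySeparatedSpace_iff_exists_isClopen]
      intro a b hab
      obtain ⟨c, hc⟩ := hs (a⁻¹ * b)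
      have hcl : IsClosed (φ.toMonoidHom.ker : Set G) :=
        isClosed_singleton.preimage φ.continuous_toFun
      have hcn : c ∉ φ.toMonoidHom.ker := by
        intro h
        have h1 : φ c = 1 := h
        rw [hc, inv_mul_eq_one] at h1
        exact hab h1
      obtain ⟨U, hU⟩ := hG.exists_openNormalSubgroup_notMem_sup hcl hcn
      have hopen : IsOpen (((φ.toMonoidHom.ker ⊔ U.toSubgroup).map φ.toMonoidHom : Subgroup G') :
          Set G') := by
        rw [← hq.isOpen_preimage]
        have : φ ⁻¹' ((φ.toMonoidHom.ker ⊔ U.toSubgroup).map φ.toMonoidHom : Subgroup G') =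
            ((φ.toMonoidHom.ker ⊔ U.toSubgroup : Subgroup G) : Set G) :=
          congrArg (fun S : Subgroup G => (S : Set G))
            (Subgroup.comap_map_eq_self (f := φ.toMonoidHom) le_sup_left)
        rw [this]
        exact Subgroup.isOpen_mono le_sup_right U.isOpen'
      have hclopen : IsClopen (((φ.toMonoidHom.ker ⊔ U.toSubgroup).map φ.toMonoidHom :
          Subgroup G') : Set G') := ⟨Subgroup.isClosed_of_isOpen _ hopen, hopen⟩
      refine ⟨_, hclopen.preimage (continuous_const_mul a⁻¹), ?_, ?_⟩
      · change a⁻¹ * a ∈ (φ.toMonoidHom.ker ⊔ U.toSubgroup).map φ.toMonoidHom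
        rw [inv_mul_cancel]
        exact Subgroup.one_mem _
      · intro h
        have h1 : φ.toMonoidHom c ∈ (φ.toMonoidHom.ker ⊔ U.toSubgroup).map φ.toMonoidHom := by
          change φ c ∈ _
          rw [hc]
          exact h
        have h2 := Subgroup.mem_comap.mpr h1
        rw [Subgroup.comap_map_eq_self (f := φ.toMonoidHom) le_sup_left] at h2
        exact hU h2
    infer_instance
  · have hV : V.toSubgroup.Normal := V.isNormal'
    have h := hG.isPGroup_quotient ⟨⟨V.toSubgroup.comap φ.toMonoidHom,
      V.isOpen'.preimage φ.continuous_toFun⟩, hV.comap φ.toMonoidHom⟩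
    refine h.of_surjective (QuotientGroup.map (V.toSubgroup.comap φ.toMonoidHom) V.toSubgroup
      φ.toMonoidHom le_rfl) fun q => ?_
    obtain ⟨g, rfl⟩ := QuotientGroup.mk_surjective q
    obtain ⟨a, rfl⟩ := hs g
    exact ⟨QuotientGroup.mk a, rfl⟩

section Construction

variable {G : Type u} [Group G] [TopologicalSpace G] [IsTopologicalGroup G] [T2Space G]
  {φ : FreeProP 3 2 →ₜ* G}

theorem grDim_one_eq_two (hs : Function.Surjective φ)
    (hφ : ∀ f, φ f = 1 → f ∈ zassenhaus 3 (FreeProP 3 2) 2) : grDim 3 G 1 = 2 := by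
  apply grDim_eq_of_relIndex
  rw [← relIndex_comap_zassenhaus φ hs (isClosedMap_of_freeProP φ)]
  refine relIndex_two_one fun f => ⟨fun h => ?_, fun h => map_mem_zassenhaus φ h⟩
  obtain ⟨g, hg, hgf⟩ := exists_mem_zassenhaus_map_eq φ hs (isClosedMap_of_freeProP φ)
    (Subgroup.mem_comap.mp h)
  have h1 : φ (g⁻¹ * f) = 1 := by
    rw [map_mul, map_inv, hgf]
    exact inv_mul_cancel _
  simpa using mul_mem hg (hφ _ h1)

theorem evalGen_surjective (hs : Function.Surjective φ)
    (hφ : ∀ f, φ f = 1 → f ∈ zassenhaus 3 (FreeProP 3 2) 2) :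
    Function.Surjective (evalGen φ) := by
  intro t
  let l : FreeProP 3 2 → ZMod 3 := fun f => t 0 * (magnus f).c1 0 + t 1 * (magnus f).c1 1
  have hl : Continuous l := (continuous_of_discreteTopology
    (f := fun m : Magnus => t 0 * m.c1 0 + t 1 * m.c1 1)).comp magnus.continuous_toFun
  have hlm : ∀ a b, l (a * b) = l a + l b := fun a b => by
    simp only [l, map_mul, Magnus.mul_c1]; ring
  have key : ∀ a, l (Function.surjInv hs (φ a)) = l a := by
    intro a
    have h1 : φ (Function.surjInv hs (φ a) * a⁻¹) = 1 := by
      rw [map_mul, Function.surjInv_eq hs, map_inv, mul_inv_cancel]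
    have h2 := hlm (Function.surjInv hs (φ a) * a⁻¹) a
    have h3 : l (Function.surjInv hs (φ a) * a⁻¹) = 0 := by
      simp only [l, c1_eq_zero (hφ _ h1), mul_zero, add_zero]
    rwa [inv_mul_cancel_right, h3, zero_add] at h2
  refine ⟨⟨fun g => l (Function.surjInv hs g), ?_, fun g h => ?_⟩, funext fun i => ?_⟩
  · exact (isQuotientMap_of_freeProP hs).continuous_iff.mpr (hl.congr fun a => (key a).symm)
  · obtain ⟨a, rfl⟩ := hs g
    obtain ⟨b, rfl⟩ := hs h
    beta_reduce
    rw [← map_mul, key, key, key, hlm]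
  · change l (Function.surjInv hs (φ _)) = _
    rw [key]
    simp only [l, magnus_gen]
    fin_cases i <;> simp

variable {ι : Type*} {r : ι → FreeProP 3 2}

/-- The zeros of `f` in the kernel form a closed normal subgroup, so the kernel is reached from the
relators. -/
theorem ExtCochain.eq_zero_of_relators {f : FreeProP 3 2 → ZMod 3} (hf : f ∈ ExtCochain φ)
    (hker : φ.toMonoidHom.ker = (Subgroup.normalClosure (Set.range r)).topologicalClosure)
    (h : ∀ i, f (r i) = 0) {n : FreeProP 3 2} (hn : φ n = 1) : f n = 0 := by
  let S : Subgroup (FreeProP 3 2) :=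
    { carrier := {n | φ n = 1 ∧ f n = 0}
      one_mem' := ⟨_root_.map_one φ, ExtCochain.map_one hf⟩
      mul_mem' := fun {a b} ha hb =>
        ⟨by rw [map_mul, ha.1, hb.1, one_mul], by rw [hf.2.1 a ha.1, ha.2, hb.2, add_zero]⟩
      inv_mem' := fun {a} ha => ⟨by rw [map_inv, ha.1, inv_one], by
        have h1 := hf.2.1 a ha.1 a⁻¹
        rwa [mul_inv_cancel, ExtCochain.map_one hf, ha.2, zero_add, eq_comm] at h1⟩ }
  have hSn : S.Normal := ⟨fun a ha g => by
    have h0 : φ (g * a * g⁻¹) = 1 := by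
      rw [map_mul, map_mul, ha.1, mul_one, map_inv, mul_inv_cancel]
    refine ⟨h0, ?_⟩
    have h1 := hf.2.1 _ h0 g
    rw [inv_mul_cancel_right, hf.2.2 _ ha.1, ha.2] at h1
    linear_combination -h1⟩
  have hSc : IsClosed (S : Set (FreeProP 3 2)) :=
    (isClosed_singleton.preimage φ.continuous_toFun).inter (isClosed_singleton.preimage hf.1)
  have hr : ∀ i, φ (r i) = 1 := fun i => by
    have : r i ∈ φ.toMonoidHom.ker := by
      rw [hker]
      exact Subgroup.le_topologicalClosure _ (Subgroup.subset_normalClosure ⟨i, rfl⟩)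
    exact this
  have hle : φ.toMonoidHom.ker ≤ S := by
    rw [hker]
    refine Subgroup.topologicalClosure_minimal _ (Subgroup.normalClosure_le_normal ?_) hSc
    rintro _ ⟨i, rfl⟩
    exact ⟨hr i, h i⟩
  exact (hle hn).2

/-- Every class is the transgression of a cochain, and transgression factors through the values of
the cochain on the relators. -/
theorem finrank_H2_le [Fintype ι] (hs : Function.Surjective φ)
    (hker : φ.toMonoidHom.ker = (Subgroup.normalClosure (Set.range r)).topologicalClosure) :
    Module.Finite (ZMod 3) (H2 3 G) ∧ Module.finrank (ZMod 3) (H2 3 G) ≤ Fintype.card ι := by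
  let ev : ExtCochain φ →ₗ[ZMod 3] ι → ZMod 3 :=
    { toFun := fun f i => f.1 (r i)
      map_add' := fun _ _ => rfl
      map_smul' := fun _ _ => rfl }
  have hle : LinearMap.ker ev ≤ LinearMap.ker (transgression hs) := fun f hf =>
    transgression_eq_zero_of_forall hs fun n hn =>
      ExtCochain.eq_zero_of_relators f.2 hker (fun i => congrFun hf i) hn
  let T : (ExtCochain φ ⧸ LinearMap.ker ev) →ₗ[ZMod 3] H2 3 G := (LinearMap.ker ev).liftQ _ hle
  have hT : Function.Surjective T := by
    intro t
    obtain ⟨f, rfl⟩ := transgression_surjective hs t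
    exact ⟨Submodule.Quotient.mk f, rfl⟩
  have hfin : Module.Finite (ZMod 3) (ExtCochain φ ⧸ LinearMap.ker ev) :=
    Module.Finite.equiv ev.quotKerEquivRange.symm
  refine ⟨Module.Finite.of_surjective T hT,
    (LinearMap.finrank_le_finrank_of_surjective hT).trans ?_⟩
  rw [ev.quotKerEquivRange.finrank_eq, ← Module.finrank_fintype_fun_eq_card (ZMod 3) (η := ι)]
  exact Submodule.finrank_le _

/-- On odd relators a cochain changes sign under `flip`, and its values there determine its
transgression. -/
theorem H2_map_eq_neg (hs : Function.Surjective φ) {σ : G ≃ₜ* G}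
    (hσ : ∀ a, φ (flip a) = σ (φ a))
    (hker : φ.toMonoidHom.ker = (Subgroup.normalClosure (Set.range r)).topologicalClosure)
    (hr : ∀ i, flip (r i) = (r i)⁻¹) (t : H2 3 G) : H2.map 3 σ t = -t := by
  obtain ⟨f, rfl⟩ := transgression_surjective hs t
  rw [← transgression_comp hs hσ, eq_neg_iff_add_eq_zero, ← map_add]
  refine transgression_eq_zero_of_forall hs fun n hn =>
    ExtCochain.eq_zero_of_relators (Subtype.prop _) hker (fun i => ?_) hn
  have h1 : φ (r i) = 1 := by
    have : r i ∈ φ.toMonoidHom.ker := by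
      rw [hker]
      exact Subgroup.le_topologicalClosure _ (Subgroup.subset_normalClosure ⟨i, rfl⟩)
    exact this
  change f.1 (flip (r i)) + f.1 (r i) = 0
  rw [hr, ← f.2.2.2 _ h1, inv_mul_cancel, ExtCochain.map_one f.2]

theorem H1_map_eq_neg (hs : Function.Surjective φ) {σ : G ≃ₜ* G}
    (hσ : ∀ a, φ (flip a) = σ (φ a)) (t : H1 3 G) : H1.map 3 σ t = -t := by
  rw [eq_neg_iff_add_eq_zero]
  ext g
  obtain ⟨a, rfl⟩ := hs g
  change t.1 (σ (φ a)) + t.1 (φ a) = 0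
  rw [← hσ]
  have h0 := comp_mem_Z1 (φ := φ) t.2
  refine eq_zero_of_gen (f := fun a => t.1 (φ (flip a)) + t.1 (φ a))
    ((Z1 3 (FreeProP 3 2)).add_mem (comp_mem_Z1 (φ := flip) h0) h0) (fun i => ?_) a
  rw [flip_gen, ← t.2.2, ← map_mul, inv_mul_cancel]
  exact apply_eq_zero_of_mem_zassenhaus_two h0 (one_mem _)

theorem map_flip_eq_one_iff
    (hker : φ.toMonoidHom.ker = (Subgroup.normalClosure (Set.range r)).topologicalClosure)
    (hr : ∀ i, flip (r i) = (r i)⁻¹) (a : FreeProP 3 2) : φ a = 1 ↔ φ (flip a) = 1 := by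
  have hle : φ.toMonoidHom.ker ≤ φ.toMonoidHom.ker.comap flip.toMonoidHom := by
    conv_lhs => rw [hker]
    refine Subgroup.topologicalClosure_minimal _ (Subgroup.normalClosure_le_normal ?_)
      ((isClosed_singleton.preimage φ.continuous_toFun).preimage flip.continuous_toFun)
    rintro _ ⟨i, rfl⟩
    change flip (r i) ∈ φ.toMonoidHom.ker
    rw [hr, hker]
    exact inv_mem (Subgroup.le_topologicalClosure _ (Subgroup.subset_normalClosure ⟨i, rfl⟩))
  refine ⟨fun h => hle h, fun h => ?_⟩
  have h1 : φ (flip (flip a)) = 1 := hle (x := flip a) h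
  rwa [flip_flip] at h1

end Construction

/-- The relators are odd lifts of a basis of `W`. There are `dim W ≤ 2` of them, which bounds `H²`,
while `H¹` has dimension 2 because the relators lie in `D_2`. -/
theorem exists_weakSchurGroup (W : Submodule (ZMod 3) (Fin 4 → ZMod 3))
    (hW : Module.finrank (ZMod 3) W ≤ 2) :
    ∃ (G : WeakSchurGroup.{v} 3) (φ : FreeProP 3 2 →ₜ* G.carrier),
      Function.Surjective φ ∧ (∀ f, φ f = 1 → f ∈ zassenhaus 3 (FreeProP 3 2) 3) ∧
      relationSpace φ = W := by
  let b := Module.finBasis (ZMod 3) W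
  choose r hr hrflip hrb using fun i => exists_odd_cub_eq (b i : Fin 4 → ZMod 3)
  have hspan : Submodule.span (ZMod 3) (Set.range fun i => cub (r i)) = W := by
    simp only [hrb]
    have h := congrArg (Submodule.map W.subtype) b.span_eq
    rwa [Submodule.map_span, ← Set.range_comp, Submodule.map_subtype_top] at h
  let N := (Subgroup.normalClosure (Set.range r)).topologicalClosure
  have hN : N.Normal := Subgroup.is_normal_topologicalClosure _
  have hNc : IsClosed (N : Set (FreeProP 3 2)) := Subgroup.isClosed_topologicalClosure _
  let φ : FreeProP 3 2 →ₜ* ULift.{v} (FreeProP 3 2 ⧸ N) :=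
    { toFun := fun f => ULift.up (QuotientGroup.mk f)
      map_one' := rfl
      map_mul' := fun _ _ => rfl
      continuous_toFun := continuous_uliftUp.comp QuotientGroup.continuous_mk }
  have hs : Function.Surjective φ := by
    rintro ⟨q⟩
    obtain ⟨f, rfl⟩ := QuotientGroup.mk_surjective q
    exact ⟨f, rfl⟩
  have hker : φ.toMonoidHom.ker = N := by
    ext f
    exact ULift.up_inj.trans (QuotientGroup.eq_one_iff (N := N) f)
  obtain ⟨h3, hrel⟩ := relationSpace_eq_span hr hker
  have h2 : ∀ f, φ f = 1 → f ∈ zassenhaus 3 (FreeProP 3 2) 2 := fun f hf =>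
    zassenhaus_three_le_two (h3 f hf)
  have hflip : Function.Surjective flip := fun a => ⟨flip a, flip_flip a⟩
  obtain ⟨σ, hσ⟩ := exists_equiv_of_ker_eq φ (isQuotientMap_of_freeProP hs) (φ.comp flip)
    (isQuotientMap_of_freeProP (φ := φ.comp flip) (hs.comp hflip))
    (map_flip_eq_one_iff hker hrflip)
  have hσ' : ∀ a, φ (flip a) = σ (φ a) := fun a => (hσ a).symm
  obtain ⟨hfin1, hle1⟩ := finrank_H1_le_two hs
  obtain ⟨hfin2, hle2⟩ := finrank_H2_le hs hker
  have hge1 : 2 ≤ Module.finrank (ZMod 3) (H1 3 (ULift.{v} (FreeProP 3 2 ⧸ N))) := by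
    have := LinearMap.finrank_le_finrank_of_surjective (evalGen_surjective hs h2)
    rwa [Module.finrank_fin_fun] at this
  rw [Fintype.card_fin] at hle2
  refine ⟨{
    carrier := ULift.{v} (FreeProP 3 2 ⧸ N)
    isProP := FreeProP.isProP.of_surjective φ hs
    σ := σ
    σ_σ := fun g => by
      obtain ⟨a, rfl⟩ := hs g
      rw [← hσ', ← hσ', flip_flip]
    rank_H2_le := by
      rw [← Module.finrank_eq_rank, ← Module.finrank_eq_rank, Nat.cast_le]
      omega
    rank_H1_lt := Module.rank_lt_aleph0_iff.mpr hfin1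
    σ_H1 := H1_map_eq_neg hs hσ'
    σ_H2 := H2_map_eq_neg hs hσ' hker hrflip }, φ, hs, h3, hrel.trans hspan⟩

end SchurSigma

namespace SchurSigma

/-! ### Equivalence of subspaces of `gr_3` -/

/-- No polynomial identity is checked: matrices lift to endomorphisms, whose composition acts on
`gr_3` by the product. -/
theorem cubMatrix_mul (g h : Matrix (Fin 2) (Fin 2) (ZMod 3)) :
    cubMatrix (g * h) = cubMatrix g * cubMatrix h := by
  obtain ⟨θ, rfl, -⟩ := exists_endo_of_matrix g
  obtain ⟨η, rfl, -⟩ := exists_endo_of_matrix h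
  have hm : endoMatrix (θ.comp η) = endoMatrix θ * endoMatrix η := by
    ext i j
    exact congrFun (c1_endo θ (η (FreeProP.gen 3 j))) i
  refine Matrix.mulVec_injective (funext fun w => ?_)
  obtain ⟨f, hf, rfl⟩ := exists_cub_eq w
  rw [← hm, ← cub_endo _ hf, ← Matrix.mulVec_mulVec, ← cub_endo η hf,
    ← cub_endo θ (map_mem_zassenhaus η hf)]
  rfl

/-- Two subspaces of `gr_3` are equivalent if a linear change of generators maps the first to the
second. -/
def Equivalent (W W' : Submodule (ZMod 3) (Fin 4 → ZMod 3)) : Prop :=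
  ∃ g : Matrix (Fin 2) (Fin 2) (ZMod 3), g.det ≠ 0 ∧ W.map (cubMatrix g).mulVecLin = W'

theorem cubMatrix_inv_mul {g : Matrix (Fin 2) (Fin 2) (ZMod 3)} (hg : g.det ≠ 0) :
    cubMatrix g⁻¹ * cubMatrix g = 1 ∧ cubMatrix g * cubMatrix g⁻¹ = 1 := by
  rw [← cubMatrix_mul, ← cubMatrix_mul, Matrix.nonsing_inv_mul _ (isUnit_iff_ne_zero.mpr hg),
    Matrix.mul_nonsing_inv _ (isUnit_iff_ne_zero.mpr hg), cubMatrix_one]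
  exact ⟨rfl, rfl⟩

theorem equivalent_iff {W W' : Submodule (ZMod 3) (Fin 4 → ZMod 3)} : Equivalent W W' ↔
    ∃ g : Matrix (Fin 2) (Fin 2) (ZMod 3), g.det ≠ 0 ∧
      ∀ w, w ∈ W ↔ (cubMatrix g).mulVec w ∈ W' := by
  refine exists_congr fun g => and_congr_right fun hg => ?_
  obtain ⟨h1, h2⟩ := cubMatrix_inv_mul hg
  constructor
  · rintro rfl w
    refine ⟨fun h => ⟨w, h, rfl⟩, ?_⟩
    rintro ⟨w', hw', h⟩
    rw [Matrix.mulVecLin_apply] at h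
    have h3 := congrArg (cubMatrix g⁻¹).mulVec h
    rw [Matrix.mulVec_mulVec, Matrix.mulVec_mulVec, h1, Matrix.one_mulVec, Matrix.one_mulVec] at h3
    exact h3 ▸ hw'
  · intro h
    ext w
    constructor
    · rintro ⟨w', hw', rfl⟩
      exact (h w').mp hw'
    · intro hw
      have h3 : (cubMatrix g).mulVec ((cubMatrix g⁻¹).mulVec w) = w := by
        rw [Matrix.mulVec_mulVec, h2, Matrix.one_mulVec]
      exact ⟨_, (h _).mpr (h3.symm ▸ hw), h3⟩

theorem Equivalent.trans {W W' W'' : Submodule (ZMod 3) (Fin 4 → ZMod 3)} (h : Equivalent W W')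
    (h' : Equivalent W' W'') : Equivalent W W'' := by
  obtain ⟨g, hg, hW⟩ := equivalent_iff.mp h
  obtain ⟨g', hg', hW'⟩ := equivalent_iff.mp h'
  refine equivalent_iff.mpr ⟨g' * g, ?_, fun w => ?_⟩
  · rw [Matrix.det_mul]
    exact mul_ne_zero hg' hg
  · rw [hW, hW', Matrix.mulVec_mulVec, cubMatrix_mul]

/-! ### Numerical encoding of vectors and subspaces -/

/-- The vector whose coordinates are the ternary digits of a natural number. -/
def vec (n : ℕ) : Fin 4 → ZMod 3 := ![(n / 27 : ℕ), (n / 9 : ℕ), (n / 3 : ℕ), n]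

/-- The natural number with given ternary digits modulo `3`. -/
def ofDigits (a b c d : ℕ) : ℕ := 27 * (a % 3) + 9 * (b % 3) + 3 * (c % 3) + d % 3

theorem ofDigits_lt (a b c d : ℕ) : ofDigits a b c d < 81 := by
  unfold ofDigits
  omega

theorem vec_ofDigits (a b c d : ℕ) :
    vec (ofDigits a b c d) = ![(a : ZMod 3), (b : ZMod 3), (c : ZMod 3), (d : ZMod 3)] := by
  have h : ∀ m n : ℕ, m % 3 = n % 3 → (m : ZMod 3) = n := fun m n =>
    (ZMod.natCast_eq_natCast_iff m n 3).mpr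
  have h0 : ofDigits a b c d / 27 % 3 = a % 3 := by unfold ofDigits; omega
  have h1 : ofDigits a b c d / 9 % 3 = b % 3 := by unfold ofDigits; omega
  have h2 : ofDigits a b c d / 3 % 3 = c % 3 := by unfold ofDigits; omega
  have h3 : ofDigits a b c d % 3 = d % 3 := by unfold ofDigits; omega
  ext i
  fin_cases i
  exacts [h _ _ h0, h _ _ h1, h _ _ h2, h _ _ h3]

theorem exists_vec_eq (w : Fin 4 → ZMod 3) : ∃ n < 81, vec n = w := by
  refine ⟨ofDigits (w 0).val (w 1).val (w 2).val (w 3).val, ofDigits_lt _ _ _ _, ?_⟩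
  rw [vec_ofDigits]
  ext i
  fin_cases i <;> simp

theorem vec_injective {m n : ℕ} (hm : m < 81) (hn : n < 81) (h : vec m = vec n) : m = n := by
  have key : ∀ a b : ℕ, (a : ZMod 3) = b → a % 3 = b % 3 := fun a b =>
    (ZMod.natCast_eq_natCast_iff a b 3).mp
  have h0 := key _ _ (congrFun h 0)
  have h1 := key _ _ (congrFun h 1)
  have h2 := key _ _ (congrFun h 2)
  have h3 := key _ _ (congrFun h 3)
  omega

/-- Linear combinations of encoded vectors. -/
def comb (s t m n : ℕ) : ℕ :=
  ofDigits (s * (m / 27) + t * (n / 27)) (s * (m / 9) + t * (n / 9)) (s * (m / 3) + t * (n / 3))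
    (s * m + t * n)

theorem vec_comb (s t m n : ℕ) :
    vec (comb s t m n) = (s : ZMod 3) • vec m + (t : ZMod 3) • vec n := by
  rw [comb, vec_ofDigits]
  ext i
  fin_cases i <;> simp [vec]

/-- The matrix with given entries. -/
def entries (a b c d : ℕ) : Matrix (Fin 2) (Fin 2) (ZMod 3) := !![(a : ZMod 3), c; b, d]

/-- The action of a matrix on encoded vectors. -/
def act (g : ℕ × ℕ × ℕ × ℕ) (n : ℕ) : ℕ :=
  match g with
  | (a, b, c, d) => ofDigits (a ^ 3 * (n / 27) + c ^ 3 * n)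
    (a ^ 2 * b * (n / 27) + (a ^ 2 * d + 2 * a * b * c) * (n / 9) +
      (2 * a * c * d + b * c ^ 2) * (n / 3) + c ^ 2 * d * n)
    (a * b ^ 2 * (n / 27) + (2 * a * b * d + b ^ 2 * c) * (n / 9) +
      (a * d ^ 2 + 2 * b * c * d) * (n / 3) + c * d ^ 2 * n)
    (b ^ 3 * (n / 27) + d ^ 3 * n)

theorem vec_act (a b c d n : ℕ) :
    vec (act (a, b, c, d) n) = (cubMatrix (entries a b c d)).mulVec (vec n) := by
  rw [act, vec_ofDigits]
  ext i
  fin_cases i <;> simp [vec, cubMatrix, entries, Matrix.mulVec, dotProduct, Fin.sum_univ_four]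

/-- The set of codes of the elements of the span of two encoded vectors, as a bit mask. -/
def mask (m n : ℕ) : ℕ :=
  2 ^ comb 0 0 m n ||| 2 ^ comb 0 1 m n ||| 2 ^ comb 0 2 m n |||
  2 ^ comb 1 0 m n ||| 2 ^ comb 1 1 m n ||| 2 ^ comb 1 2 m n |||
  2 ^ comb 2 0 m n ||| 2 ^ comb 2 1 m n ||| 2 ^ comb 2 2 m n

/-- The span of two encoded vectors. -/
def vecSpan (m n : ℕ) : Submodule (ZMod 3) (Fin 4 → ZMod 3) :=
  Submodule.span (ZMod 3) {vec m, vec n}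

theorem testBit_mask (m n k : ℕ) : (mask m n).testBit k ↔ k < 81 ∧ vec k ∈ vecSpan m n := by
  have h1 : (mask m n).testBit k ↔ ∃ s ∈ [0, 1, 2], ∃ t ∈ [0, 1, 2], comb s t m n = k := by
    simp [mask, Nat.testBit_or, Nat.testBit_two_pow, or_assoc]
  rw [h1, vecSpan, Submodule.mem_span_pair]
  constructor
  · rintro ⟨s, -, t, -, rfl⟩
    exact ⟨ofDigits_lt _ _ _ _, _, _, (vec_comb _ _ _ _).symm⟩
  · rintro ⟨hk, s, t, h⟩
    have h3 : ∀ s : ZMod 3, s.val ∈ [0, 1, 2] := by decide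
    refine ⟨s.val, h3 s, t.val, h3 t, vec_injective (ofDigits_lt _ _ _ _) hk ?_⟩
    rw [vec_comb, ← h]
    simp

/-- Equality of subspaces thus becomes equality of natural numbers, which can be decided by
evaluation. -/
theorem vecSpan_eq_iff {m n m' n' : ℕ} : vecSpan m n = vecSpan m' n' ↔ mask m n = mask m' n' := by
  constructor
  · intro h
    refine Nat.eq_of_testBit_eq fun k => ?_
    rw [Bool.eq_iff_iff, testBit_mask, testBit_mask, h]
  · intro h
    ext w
    obtain ⟨k, hk, rfl⟩ := exists_vec_eq w
    have h1 := testBit_mask m n k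
    rw [h, testBit_mask] at h1
    simpa [hk] using h1.symm

theorem map_vecSpan (a b c d m n : ℕ) :
    (vecSpan m n).map (cubMatrix (entries a b c d)).mulVecLin =
      vecSpan (act (a, b, c, d) m) (act (a, b, c, d) n) := by
  rw [vecSpan, vecSpan, Submodule.map_span, Set.image_pair, vec_act, vec_act]
  rfl

/-- The invertible matrices, by their entries. -/
def invertibleEntries : List (ℕ × ℕ × ℕ × ℕ) :=
  [0, 1, 2].flatMap fun a => [0, 1, 2].flatMap fun b => [0, 1, 2].flatMap fun c =>
    [0, 1, 2].flatMap fun d => if a * d % 3 = b * c % 3 then [] else [(a, b, c, d)]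

theorem det_entries_ne_zero_iff {a b c d : ℕ} :
    (entries a b c d).det ≠ 0 ↔ a * d % 3 ≠ b * c % 3 := by
  rw [entries, Matrix.det_fin_two_of, sub_ne_zero, ← Nat.cast_mul, ← Nat.cast_mul, Ne,
    ZMod.natCast_eq_natCast_iff, Nat.ModEq, mul_comm c b]

theorem mem_invertibleEntries {a b c d : ℕ} : (a, b, c, d) ∈ invertibleEntries ↔
    (a < 3 ∧ b < 3 ∧ c < 3 ∧ d < 3) ∧ (entries a b c d).det ≠ 0 := by
  have h3 : ∀ a : ℕ, a ∈ [0, 1, 2] ↔ a < 3 := fun a => by simp; omega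
  rw [det_entries_ne_zero_iff]
  simp only [invertibleEntries, List.mem_flatMap, h3]
  constructor
  · rintro ⟨a', ha, b', hb, c', hc, d', hd, h⟩
    split_ifs at h with h'
    · simp at h
    · simp only [List.mem_singleton, Prod.mk.injEq] at h
      obtain ⟨rfl, rfl, rfl, rfl⟩ := h
      exact ⟨⟨ha, hb, hc, hd⟩, h'⟩
  · rintro ⟨⟨ha, hb, hc, hd⟩, h⟩
    exact ⟨a, ha, b, hb, c, hc, d, hd, by rw [if_neg h]; simp⟩

theorem exists_entries_eq (g : Matrix (Fin 2) (Fin 2) (ZMod 3)) :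
    ∃ a b c d, (a < 3 ∧ b < 3 ∧ c < 3 ∧ d < 3) ∧ entries a b c d = g := by
  refine ⟨(g 0 0).val, (g 1 0).val, (g 0 1).val, (g 1 1).val,
    ⟨ZMod.val_lt _, ZMod.val_lt _, ZMod.val_lt _, ZMod.val_lt _⟩, ?_⟩
  ext i j
  fin_cases i <;> fin_cases j <;> simp [entries]

theorem equivalent_of_mask_eq {m n m' n' : ℕ} {g : ℕ × ℕ × ℕ × ℕ} (hg : g ∈ invertibleEntries)
    (h : mask (act g m) (act g n) = mask m' n') : Equivalent (vecSpan m n) (vecSpan m' n') := by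
  obtain ⟨a, b, c, d⟩ := g
  exact ⟨entries a b c d, (mem_invertibleEntries.mp hg).2, by
    rw [map_vecSpan, vecSpan_eq_iff.mpr h]⟩

theorem exists_mask_eq_of_equivalent {m n m' n' : ℕ}
    (h : Equivalent (vecSpan m n) (vecSpan m' n')) :
    ∃ g ∈ invertibleEntries, mask (act g m) (act g n) = mask m' n' := by
  obtain ⟨g, hg, h⟩ := h
  obtain ⟨a, b, c, d, hlt, rfl⟩ := exists_entries_eq g
  refine ⟨(a, b, c, d), mem_invertibleEntries.mpr ⟨hlt, hg⟩, ?_⟩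
  rwa [map_vecSpan, vecSpan_eq_iff] at h

/-! ### Classification of the subspaces of dimension at most two -/

/-- Representatives for the classes of subspaces of dimension at most two. -/
def reps : List (ℕ × ℕ) :=
  -- Codes of two spanning vectors: the zero space, then five lines with first code 0, then thirteen
  -- planes.
  [(0, 0), (0, 1), (0, 3), (0, 4), (0, 10), (0, 11), (1, 3), (1, 9), (1, 27), (1, 30), (1, 33),
    (3, 9), (3, 10), (3, 11), (3, 28), (4, 28), (4, 29), (10, 31), (11, 33)]

/-- Application to a natural number that is evaluated first. -/
def force {α : Type} (n : ℕ) (f : ℕ → α) : α := Nat.rec (f 0) (fun m _ => f (m + 1)) n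

theorem force_eq {α : Type} (n : ℕ) (f : ℕ → α) : force n f = f n := by
  cases n <;> rfl

/-- Moving one nonzero spanning vector to one of five normal forms first leaves only `5 · 81` pairs
for `subspace_check`. -/
theorem vector_check : ((List.range 81).all fun m => m == 0 || invertibleEntries.any fun g =>
    [1, 3, 4, 10, 11].contains (act g m)) = true := by
  decide +kernel

theorem subspace_check : ([1, 3, 4, 10, 11].all fun m => (List.range 81).all fun n =>
    invertibleEntries.any fun g => force (act g m) fun m => force (act g n) fun n =>
      force (mask m n) fun k => reps.any fun r => Nat.beq k (mask r.1 r.2)) = true := by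
  decide +kernel

/-- Irredundancy of the list: no invertible matrix carries one representative to another. -/
theorem reps_check : (reps.all fun r => invertibleEntries.all fun g =>
    force (act g r.1) fun m => force (act g r.2) fun n => force (mask m n) fun k =>
      reps.all fun r' => !Nat.beq k (mask r'.1 r'.2) || r == r') = true := by
  decide +kernel

theorem exists_vecSpan_eq {W : Submodule (ZMod 3) (Fin 4 → ZMod 3)}
    (hW : Module.finrank (ZMod 3) W ≤ 2) : ∃ m < 81, ∃ n < 81, vecSpan m n = W := by
  let b := Module.finBasis (ZMod 3) W
  -- A basis with fewer than two elements is padded with zeros.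
  let c : ℕ → Fin 4 → ZMod 3 := fun j => if h : j < Module.finrank (ZMod 3) W then b ⟨j, h⟩ else 0
  have hc : ∀ j, c j ∈ W := fun j => by
    by_cases h : j < Module.finrank (ZMod 3) W
    · simp only [c, dif_pos h]
      exact (b ⟨j, h⟩).2
    · simp only [c, dif_neg h]
      exact W.zero_mem
  obtain ⟨m, hm, hmc⟩ := exists_vec_eq (c 0)
  obtain ⟨n, hn, hnc⟩ := exists_vec_eq (c 1)
  refine ⟨m, hm, n, hn, ?_⟩
  rw [vecSpan, hmc, hnc]
  refine le_antisymm (Submodule.span_le.mpr ?_) ?_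
  · rintro _ (rfl | rfl)
    exacts [hc 0, hc 1]
  · have h := congrArg (Submodule.map W.subtype) b.span_eq
    rw [Submodule.map_span, ← Set.range_comp, Submodule.map_subtype_top] at h
    conv_lhs => rw [← h]
    refine Submodule.span_mono ?_
    rintro _ ⟨⟨i, hi⟩, rfl⟩
    have hci : c i = b ⟨i, hi⟩ := dif_pos hi
    change ((b ⟨i, hi⟩ : W) : Fin 4 → ZMod 3) ∈ _
    rw [← hci]
    have : i = 0 ∨ i = 1 := by omega
    rcases this with rfl | rfl
    exacts [Or.inl rfl, Or.inr rfl]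

theorem vecSpan_comm (m n : ℕ) : vecSpan m n = vecSpan n m := by
  rw [vecSpan, vecSpan, Set.pair_comm]

theorem exists_equivalent_of_ne_zero {m n : ℕ} (hm : m < 81) (hm0 : m ≠ 0) :
    ∃ r ∈ reps, Equivalent (vecSpan m n) (vecSpan r.1 r.2) := by
  have h1 := List.all_eq_true.mp vector_check m (List.mem_range.mpr hm)
  rw [Bool.or_eq_true, beq_iff_eq, or_iff_right hm0, List.any_eq_true] at h1
  obtain ⟨⟨a, b, c, d⟩, hg, h1⟩ := h1
  obtain ⟨k, hk, hkn⟩ := exists_vec_eq (vec (act (a, b, c, d) n))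
  have h2 := List.all_eq_true.mp (List.all_eq_true.mp subspace_check _ (List.contains_iff_mem.mp h1))
    k (List.mem_range.mpr hk)
  obtain ⟨g', hg', h2⟩ := List.any_eq_true.mp h2
  simp only [force_eq] at h2
  obtain ⟨r, hr, h2⟩ := List.any_eq_true.mp h2
  refine ⟨r, hr, Equivalent.trans ⟨entries a b c d, (mem_invertibleEntries.mp hg).2, ?_⟩
    (equivalent_of_mask_eq hg' (Nat.eq_of_beq_eq_true h2))⟩
  rw [map_vecSpan, vecSpan, vecSpan, hkn]

theorem exists_equivalent {W : Submodule (ZMod 3) (Fin 4 → ZMod 3)}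
    (hW : Module.finrank (ZMod 3) W ≤ 2) : ∃ r ∈ reps, Equivalent W (vecSpan r.1 r.2) := by
  obtain ⟨m, hm, n, hn, rfl⟩ := exists_vecSpan_eq hW
  by_cases hm0 : m = 0
  · by_cases hn0 : n = 0
    · subst hm0 hn0
      refine ⟨(0, 0), by simp [reps], equivalent_of_mask_eq (g := (1, 0, 0, 1)) ?_ (by decide)⟩
      exact mem_invertibleEntries.mpr ⟨by norm_num, by decide⟩
    · rw [vecSpan_comm]
      exact exists_equivalent_of_ne_zero hn hn0
  · exact exists_equivalent_of_ne_zero hm hm0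

theorem eq_of_equivalent {r r' : ℕ × ℕ} (hr : r ∈ reps) (hr' : r' ∈ reps)
    (h : Equivalent (vecSpan r.1 r.2) (vecSpan r'.1 r'.2)) : r = r' := by
  obtain ⟨g, hg, h⟩ := exists_mask_eq_of_equivalent h
  have h1 := List.all_eq_true.mp (List.all_eq_true.mp reps_check r hr) g hg
  simp only [force_eq] at h1
  have h2 := List.all_eq_true.mp h1 r' hr'
  rw [h] at h2
  simpa using h2

/-- The subspaces representing the classes. -/
def repSpace (i : Fin 19) : Submodule (ZMod 3) (Fin 4 → ZMod 3) :=
  vecSpan (reps.get i).1 (reps.get i).2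

theorem exists_equivalent_repSpace {W : Submodule (ZMod 3) (Fin 4 → ZMod 3)}
    (hW : Module.finrank (ZMod 3) W ≤ 2) : ∃ i, Equivalent W (repSpace i) := by
  obtain ⟨r, hr, h⟩ := exists_equivalent hW
  obtain ⟨i, rfl⟩ := List.get_of_mem hr
  exact ⟨i, h⟩

theorem eq_of_equivalent_repSpace {i j : Fin 19} (h : Equivalent (repSpace i) (repSpace j)) :
    i = j := by
  have hn : reps.Nodup := by decide
  exact hn.injective_get (eq_of_equivalent (List.get_mem _ _) (List.get_mem _ _) h)

theorem finrank_vecSpan_le (m n : ℕ) : Module.finrank (ZMod 3) (vecSpan m n) ≤ 2 := by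
  classical
  have h := finrank_span_finset_le_card (R := ZMod 3) ({vec m, vec n} : Finset (Fin 4 → ZMod 3))
  rw [Finset.coe_pair] at h
  exact h.trans Finset.card_le_two

theorem finrank_repSpace_eq_two_iff (i : Fin 19) :
    Module.finrank (ZMod 3) (repSpace i) = 2 ↔ 6 ≤ i := by
  constructor
  · intro h
    by_contra hi
    have h0 : ∀ i : Fin 19, ¬ 6 ≤ i → vec (reps.get i).1 = 0 := by decide
    rw [repSpace, vecSpan, h0 i hi, Submodule.span_insert_zero] at h
    have h1 := finrank_span_finset_le_card (R := ZMod 3) {vec (reps.get i).2}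
    rw [Set.finrank, Finset.coe_singleton, Finset.card_singleton] at h1
    omega
  · intro hi
    have h0 : ∀ i : Fin 19, 6 ≤ i → ∀ s t : ZMod 3,
      comb s.val t.val (reps.get i).1 (reps.get i).2 = 0 → s = 0 ∧ t = 0 := by decide +kernel
    have h1 := finrank_span_eq_card (LinearIndependent.pair_iff.mpr fun s t h => h0 i hi s t
      (vec_injective (ofDigits_lt _ _ _ _) (by norm_num) (by
        rw [vec_comb, ZMod.natCast_zmod_val, ZMod.natCast_zmod_val, h]
        decide)))
    rw [Matrix.range_cons_cons_empty] at h1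
    exact h1

theorem ncard_finrank_repSpace :
    {i | Module.finrank (ZMod 3) (repSpace i) = 2}.ncard = 13 := by
  simp only [finrank_repSpace_eq_two_iff]
  rw [Set.ncard_eq_toFinset_card']
  decide

end SchurSigma

namespace SchurSigma

/-! ### The quotients `G / D_4(G)` -/

section Quotient

variable {H : Type u} [Group H] [TopologicalSpace H] [DiscreteTopology H]

theorem IsD4Quotient.exists_isPresentation {G : WeakSchurGroup.{v} 3}
    (h1 : grDim 3 G.carrier 1 = 2) (h : IsD4Quotient G H) :
    ∃ (ψ : FreeProP 3 2 →ₜ* H) (W : Submodule (ZMod 3) (Fin 4 → ZMod 3)), IsPresentation ψ W ∧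
      Module.finrank (ZMod 3) W ≤ 2 ∧
      (Module.finrank (ZMod 3) W = 2 → HasZassenhausType33 3 G.carrier) := by
  obtain ⟨hT2, φ, hs, hφ, hW, h33⟩ := G.exists_presentation h1
  obtain ⟨e⟩ := h
  obtain ⟨ψ, hψ⟩ := exists_isPresentation_of_equiv_quotient hs hφ e
  exact ⟨ψ, _, hψ, hW, h33⟩

theorem IsD4Quotient.hasZassenhausType33_iff {G : WeakSchurGroup.{v} 3}
    (h1 : grDim 3 G.carrier 1 = 2) (h : IsD4Quotient G H) :
    HasZassenhausType33 3 G.carrier ↔ grDim 3 H 3 = 2 := by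
  constructor
  · intro h33
    have := G.isProP.t2Space
    obtain ⟨φ, hs, hφ, hW⟩ := h33.exists_presentation
    obtain ⟨e⟩ := h
    obtain ⟨ψ, hψ⟩ := exists_isPresentation_of_equiv_quotient hs hφ e
    rw [hψ.grDim_three, hW]
  · intro h3
    obtain ⟨ψ, W, hψ, hW, h33⟩ := h.exists_isPresentation h1
    rw [hψ.grDim_three] at h3
    exact h33 (by omega)

theorem IsPresentation.exists_isD4Quotient {ψ : FreeProP 3 2 →ₜ* H}
    {W : Submodule (ZMod 3) (Fin 4 → ZMod 3)} (hψ : IsPresentation ψ W)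
    (hW : Module.finrank (ZMod 3) W ≤ 2) :
    ∃ G : WeakSchurGroup.{v} 3, grDim 3 G.carrier 1 = 2 ∧ IsD4Quotient G H := by
  obtain ⟨G, φ, hs, hφ, rfl⟩ := exists_weakSchurGroup.{v} W hW
  have := G.isProP.t2Space
  exact ⟨G, grDim_one_eq_two hs fun f hf => zassenhaus_three_le_two (hφ f hf),
    hψ.nonempty_equiv_quotient hs hφ⟩

theorem IsPresentation.of_mulEquiv {ψ : FreeProP 3 2 →ₜ* H}
    {W : Submodule (ZMod 3) (Fin 4 → ZMod 3)} (hψ : IsPresentation ψ W) {K : Type u} [Group K]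
    [TopologicalSpace K] (e : K ≃* H) :
    ∃ ψ' : FreeProP 3 2 →ₜ* K, IsPresentation ψ' W := by
  refine ⟨⟨e.symm.toMonoidHom.comp ψ.toMonoidHom,
    (continuous_of_discreteTopology (f := e.symm)).comp ψ.continuous_toFun⟩,
    e.symm.surjective.comp hψ.surjective, fun f => ?_⟩
  rw [← hψ.map_eq_one_iff]
  exact EmbeddingLike.map_eq_one_iff (f := e.symm)

theorem isD4Quotient_iff_grDim [Finite H] (hH : IsPGroup 3 H) :
    (∃ G : WeakSchurGroup.{v} 3, grDim 3 G.carrier 1 = 2 ∧ IsD4Quotient G H) ↔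
      (grDim 3 H 1 = 2 ∧ grDim 3 H 2 = 1 ∧ 2 ≤ grDim 3 H 3 ∧ zassenhaus 3 H 4 = ⊥) := by
  constructor
  · rintro ⟨G, h1, h⟩
    obtain ⟨ψ, W, hψ, hW, -⟩ := h.exists_isPresentation h1
    refine ⟨hψ.grDim_one, hψ.grDim_two, ?_, hψ.zassenhaus_four⟩
    rw [hψ.grDim_three]
    omega
  · rintro ⟨h1, h2, h3, h4⟩
    obtain ⟨ψ, W, hψ⟩ := exists_isPresentation_of_grDim hH h1 h2 h4
    rw [hψ.grDim_three] at h3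
    exact hψ.exists_isD4Quotient (by omega)

theorem IsD4Quotient.exists_equivariant {G : WeakSchurGroup.{v} 3}
    (h1 : grDim 3 G.carrier 1 = 2) (h : IsD4Quotient G H) :
    ∃ σ : MulAut H, IsOddlyGenerated σ ∧
      ∀ (K : Type u) [Group K] (τ : MulAut K), IsOddlyGenerated τ → Nonempty (K ≃* H) →
        ∃ e : K ≃* H, ∀ a, e (τ a) = σ (e a) := by
  obtain ⟨ψ, W, hψ, -, -⟩ := h.exists_isPresentation h1
  obtain ⟨σ, hσ⟩ := hψ.exists_isOddlyGenerated
  refine ⟨σ, hσ, fun K _ τ hτ ⟨e⟩ => ?_⟩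
  let _ : TopologicalSpace K := ⊥
  have : DiscreteTopology K := ⟨rfl⟩
  obtain ⟨ψ', hψ'⟩ := hψ.of_mulEquiv e
  exact exists_equivariant_mulEquiv hψ' hψ e hτ hσ

end Quotient

/-- A lift of the matrix that moves the relation space of `G` to a representative turns the
canonical presentation of the representative into one with the relation space of `G`. -/
theorem exists_isD4Quotient_cubQuotient {G : WeakSchurGroup.{v} 3}
    (h1 : grDim 3 G.carrier 1 = 2) : ∃ i, IsD4Quotient G (CubQuotient.{u} (repSpace i)) := by
  obtain ⟨hT2, φ, hs, hφ, hW, -⟩ := G.exists_presentation h1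
  obtain ⟨i, hi⟩ := exists_equivalent_repSpace hW
  obtain ⟨g, hg, hgW⟩ := equivalent_iff.mp hi
  obtain ⟨θ, rfl, -⟩ := exists_endo_of_matrix g
  exact ⟨i, ((isPresentation_cubPresentation.{u} (repSpace i)).comp hg hgW).nonempty_equiv_quotient
    hs hφ⟩

theorem eq_of_mulEquiv_cubQuotient {i j : Fin 19}
    (e : CubQuotient.{u} (repSpace i) ≃* CubQuotient.{u} (repSpace j)) : i = j :=
  eq_of_equivalent_repSpace (equivalent_iff.mpr (exists_matrix_of_mulEquiv
    (isPresentation_cubPresentation.{u} _) (isPresentation_cubPresentation.{u} _) e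
    continuous_of_discreteTopology))

theorem exists_isD4Quotient_repSpace (i : Fin 19) :
    ∃ G : WeakSchurGroup.{v} 3, grDim 3 G.carrier 1 = 2 ∧
      IsD4Quotient G (CubQuotient.{u} (repSpace i)) :=
  (isPresentation_cubPresentation.{u} (repSpace i)).exists_isD4Quotient (finrank_vecSpan_le _ _)

theorem exists_type33_iff (i : Fin 19) : (∃ G : WeakSchurGroup.{v} 3, grDim 3 G.carrier 1 = 2 ∧
    HasZassenhausType33 3 G.carrier ∧ IsD4Quotient G (CubQuotient.{u} (repSpace i))) ↔
      Module.finrank (ZMod 3) (repSpace i) = 2 := by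
  have h3 := (isPresentation_cubPresentation.{u} (repSpace i)).grDim_three
  have hle : Module.finrank (ZMod 3) (repSpace i) ≤ 2 := finrank_vecSpan_le _ _
  constructor
  · rintro ⟨G, h1, h33, h⟩
    have := (h.hasZassenhausType33_iff h1).mp h33
    omega
  · intro h2
    obtain ⟨G, h1, h⟩ := exists_isD4Quotient_repSpace.{u, v} i
    exact ⟨G, h1, (h.hasZassenhausType33_iff h1).mpr (by rw [h3, h2]), h⟩

end SchurSigma

open SchurSigma in
theorem mainTheorem8 :
    (∀ (H : Type u) [Group H] [TopologicalSpace H] [DiscreteTopology H] [Finite H],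
      IsPGroup 3 H →
      -- (a) ↔ (b)
      ((∃ G : WeakSchurGroup.{v} 3, grDim 3 G.carrier 1 = 2 ∧ IsD4Quotient G H) ↔
        (grDim 3 H 1 = 2 ∧ grDim 3 H 2 = 1 ∧ 2 ≤ grDim 3 H 3 ∧ zassenhaus 3 H 4 = ⊥)) ∧
      ∀ G : WeakSchurGroup.{v} 3, grDim 3 G.carrier 1 = 2 → IsD4Quotient G H →
        -- (c)
        (HasZassenhausType33 3 G.carrier ↔ grDim 3 H 3 = 2) ∧
        -- (d)
        (∃ σ : MulAut H, IsOddlyGenerated σ ∧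
          ∀ (K : Type u) [Group K] (τ : MulAut K), IsOddlyGenerated τ → Nonempty (K ≃* H) →
            ∃ e : K ≃* H, ∀ a, e (τ a) = σ (e a)) ∧
        -- (e)
        (∀ σ : MulAut H, IsOddlyGenerated σ → (sigmaAut σ).index = 3 ^ 2)) ∧
    -- there are 19 isomorphism classes, of which 13 come from Zassenhaus type (3,3)
    (∃ (K : Fin 19 → Type u) (_ : ∀ i, Group (K i)) (_ : ∀ i, TopologicalSpace (K i))
        (_ : ∀ i, DiscreteTopology (K i)) (_ : ∀ i, Finite (K i)),
      (∀ i, IsPGroup 3 (K i) ∧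
        ∃ G : WeakSchurGroup.{v} 3, grDim 3 G.carrier 1 = 2 ∧ IsD4Quotient G (K i)) ∧
      (∀ i j, Nonempty (K i ≃* K j) → i = j) ∧
      (∀ G : WeakSchurGroup.{v} 3, grDim 3 G.carrier 1 = 2 → ∃ i, IsD4Quotient G (K i)) ∧
      {i | ∃ G : WeakSchurGroup.{v} 3, grDim 3 G.carrier 1 = 2 ∧
        HasZassenhausType33 3 G.carrier ∧ IsD4Quotient G (K i)}.ncard = 13) := by
  refine ⟨fun H _ _ _ _ hH => ⟨isD4Quotient_iff_grDim hH, fun G h1 h =>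
    ⟨h.hasZassenhausType33_iff h1, h.exists_equivariant h1, fun σ hσ => ?_⟩⟩,
    fun i => CubQuotient (repSpace i), fun _ => inferInstance, fun _ => inferInstance,
    fun _ => inferInstance, fun _ => inferInstance,
    fun i => ⟨isPGroup_cubQuotient _, exists_isD4Quotient_repSpace i⟩,
    fun i j ⟨e⟩ => eq_of_mulEquiv_cubQuotient e, fun G h1 => exists_isD4Quotient_cubQuotient h1, ?_⟩
  · obtain ⟨ψ, W, hψ, -, -⟩ := h.exists_isPresentation h1
    exact index_sigmaAut hψ hσ
  · simp only [exists_type33_iff]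
    exact ncard_finrank_repSpace
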